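/- For a finitely generated group $K$ let $\operatorname{r}(K)$ be its rank (the minimal number of generators) and $\tilde{\operatorname r}(K)=\max\{0,\operatorname{r}(K)-1\}$ its reduced rank. For a finitely generated subgroup $H$ of a group $G$ let $$\operatorname{dc}_G(H)=\sup\{\tilde{\operatorname r}(H)/\tilde{\operatorname r}(K) : H\leqslant K\leqslant G,\ K\text{ finitely generated}\},$$ where throughout $0/0=1$. For finitely generated subgroups $H\leqslant J$ of a free group $F_n$, call $J$ an algebraic extension of $H$ if $H\leqslant X\leqslant J=X*Y$ implies $Y=1$; let $\mathcal{AE}(H)$ be the set of algebraic extensions of $H$ in $F_n$. Let $G=\mathbb Z^m\times F_n$ with $m,n\geqslant 0$, write its elements as $t^a u$ with $a\in\mathbb Z^m$ and $u\in F_n$, and let $\pi\colon G\to F_n$ be the projection. Let $H\leqslant G$ be finitely generated. A basis of $H$ is a generating set $\{t^{a_1}u_1,\dots,t^{a_r}u_r,t^{b_1},\dots,t^{b_s}\}$ of $H$ such that $\{u_1,\dots,u_r\}$ is a free basis of $H\pi$ and $\{b_1,\dots,b_s\}$ is a free-abelian basis of $H\cap\mathbb Z^m$. Let $A\in M_{r\times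 m}(\mathbb Z)$ and $B\in M_{s\times m}(\mathbb Z)$ be the matrices with rows $a_i$ and $b_j$. For $J\in\mathcal{AE}(H\pi)$ with a chosen free basis $v_1,\dots,v_p$, let $U_J\in M_{r\times p}(\mathbb Z)$ be the matrix whose $(i,k)$ entry is the exponent sum of $v_k$ in the word that expresses $u_i$ in $v_1,\dots,v_p$. For integer matrices $A\in M_{r\times m}(\mathbb Z)$, $B\in M_{s\times m}(\mathbb Z)$, $U\in M_{r\times p}(\mathbb Z)$ let $d(A,B,U)$ be the minimal rank of a subgroup $L\leqslant\mathbb Z^m$ with $\operatorname{row}(B)\leqslant L$ and $\operatorname{row}(A-UC)\leqslant L$ for some $C\in M_{p\times m}(\mathbb Z)$, where $\operatorname{row}(M)$ is the subgroup generated by the rows of $M$. **Theorem.** (1) If $H\pi\neq 1$ or $H=1$, then for every basis of $H$ and every choice of free bases of the $J\in\mathcal{AE}(H\pi)$, $$\operatorname{dc}_G(H)=\tilde{\operatorname r}(H)\Big/\min_{J\in\mathcal{AE}(H\pi)}\{\tilde{\operatorname r}(J)+d(A,B,U_J)\}.$$ (2) If $H\pi=1$, that is, $H\leqslant\mathbb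 Z^m$, then $\operatorname{dc}_G(H)=1$. (3) $\operatorname{dc}_G(H)$ is algorithmically computable: there is one algorithm which, given $m$, $n$ and a finite list of elements of $G=\mathbb Z^m\times F_n$ (each as an integer vector and a word), outputs $\operatorname{dc}_G(H)$, as a fraction of natural numbers with non-zero denominator, for the subgroup $H$ generated by the list. -/

import Mathlib

open scoped ENNReal

noncomputable section

namespace FATF

/-! ## Reduced rank and degree of compression -/

/-- The reduced rank `max {0, r(G) - 1}` of a finitely generated group (the subtraction in `ℕ` is
truncated). -/
def redRank (G : Type*) [Group G] [Group.FG G] : ℕ :=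
  Group.rank G - 1

/-- The quotient `a / b`, with the convention `0 / 0 = 1`. -/
def ratio (a b : ℕ) : ℝ≥0∞ :=
  if a = 0 ∧ b = 0 then 1 else (a : ℝ≥0∞) / (b : ℝ≥0∞)

/-- The degree of compression of a finitely generated subgroup `H` of `G`: the supremum of
`r̃(H) / r̃(K)` over all finitely generated subgroups `K` of `G` that contain `H`. -/
def dc {G : Type*} [Group G] (H : Subgroup G) [Group.FG H] : ℝ≥0∞ :=
  ⨆ (K : Subgroup G) (_ : H ≤ K) (_ : Group.FG K), ratio (redRank H) (redRank K)

/-! ## Algebraic extensions -/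

/-- `K` is the internal free product `K = A * B` of its subgroups `A` and `B`: the natural map from
the abstract free product is injective with image `K`. -/
def IsInternalFreeProduct {F : Type*} [Group F] (K A B : Subgroup F) : Prop :=
  Function.Injective (Monoid.Coprod.lift A.subtype B.subtype) ∧
    (Monoid.Coprod.lift A.subtype B.subtype).range = K

/-- `H ≤ K` is an algebraic extension of finitely generated subgroups: `H` is not contained in any
proper free factor of `K`. -/
structure IsAlgebraicExtension {F : Type*} [Group F] (H K : Subgroup F) : Prop where
  fg_left : Group.FG H
  fg_right : Group.FG K
  le : H ≤ K
  eq_bot : ∀ A B : Subgroup F, IsInternalFreeProduct K A B → H ≤ A → B = ⊥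

/-- The set of algebraic extensions of `H`. -/
def AE {F : Type*} [Group F] (H : Subgroup F) : Set (Subgroup F) :=
  {K | IsAlgebraicExtension H K}

instance {F : Type*} [Group F] {H : Subgroup F} (J : AE H) : Group.FG (J : Subgroup F) :=
  J.2.fg_right

/-! ## The group `ℤ^m × F_n` -/

/-- The group `G = ℤ^m × F_n`; the element `t^a u` is `(Multiplicative.ofAdd a, u)`. -/
abbrev G (m n : ℕ) : Type :=
  Multiplicative (Fin m → ℤ) × FreeGroup (Fin n)

/-- The element `t^a u` of `ℤ^m × F_n`. -/
def elt {m n : ℕ} (a : Fin m → ℤ) (u : FreeGroup (Fin n)) : G m n :=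
  (Multiplicative.ofAdd a, u)

/-- The image `Hπ` of `H` under the projection `π : ℤ^m × F_n → F_n`. -/
def proj {m n : ℕ} (H : Subgroup (G m n)) : Subgroup (FreeGroup (Fin n)) :=
  H.map (MonoidHom.snd _ _)

/-- `L_H = H ∩ ℤ^m`, written additively: the set of all `a` with `t^a ∈ H`. -/
def lattice {m n : ℕ} (H : Subgroup (G m n)) : Submodule ℤ (Fin m → ℤ) :=
  AddSubgroup.toIntSubmodule (Subgroup.toAddSubgroup' (H.comap (MonoidHom.inl _ _)))

/-- A basis `{t^{a_1} u_1, …, t^{a_r} u_r, t^{b_1}, …, t^{b_s}}` of `H ≤ ℤ^m × F_n`: here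
`u` is a free basis of `Hπ`, `b` is a free-abelian basis of `L_H`, and the elements listed
generate `H`. The rows of the matrix `A` are `a_1, …, a_r`. -/
structure SubgroupBasis {m n : ℕ} (H : Subgroup (G m n)) (r s : ℕ) where
  u : FreeGroupBasis (Fin r) (proj H)
  b : Module.Basis (Fin s) ℤ (lattice H)
  A : Matrix (Fin r) (Fin m) ℤ
  closure_eq : Subgroup.closure
    (Set.range (fun i => elt (A i) (u i : FreeGroup (Fin n))) ∪
      Set.range (fun j => elt (b j : Fin m → ℤ) (1 : FreeGroup (Fin n)))) = H

/-- The matrix `B`, with rows `b_1, …, b_s`. -/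
def SubgroupBasis.B {m n r s : ℕ} {H : Subgroup (G m n)} (β : SubgroupBasis H r s) :
    Matrix (Fin s) (Fin m) ℤ :=
  Matrix.of fun j => (β.b j : Fin m → ℤ)

/-- Abelianization `w ↦ (|w|_1, …, |w|_p)`: the exponent sums of the letters in `w`. -/
def abelianize {p : ℕ} (w : FreeGroup (Fin p)) : Fin p → ℤ :=
  Multiplicative.toAdd
    (FreeGroup.lift (fun k : Fin p => Multiplicative.ofAdd (Pi.single k (1 : ℤ) : Fin p → ℤ)) w)

/-- The matrix `U_J`: its `i`-th row is the abelianization of the word that expresses `u_i` in the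
free basis `v` of `J`. -/
def SubgroupBasis.U {m n r s p : ℕ} {H : Subgroup (G m n)} (β : SubgroupBasis H r s)
    (J : AE (proj H)) (v : FreeGroupBasis (Fin p) (J : Subgroup (FreeGroup (Fin n)))) :
    Matrix (Fin r) (Fin p) ℤ :=
  Matrix.of fun i => abelianize (v.repr ⟨(β.u i : FreeGroup (Fin n)), J.2.le (β.u i).2⟩)

/-- The subgroup of `ℤ^m` generated by the rows of a matrix. -/
def rowSpan {k m : ℕ} (M : Matrix (Fin k) (Fin m) ℤ) : Submodule ℤ (Fin m → ℤ) :=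
  Submodule.span ℤ (Set.range M.row)

/-- `d(A,B,U)`: the least rank of a subgroup `L ≤ ℤ^m` that contains `row(B)` and `row(A - U C)`
for some integer matrix `C` (the set is never empty, as `L = ℤ^m` qualifies). -/
def d {r s p m : ℕ} (A : Matrix (Fin r) (Fin m) ℤ) (B : Matrix (Fin s) (Fin m) ℤ)
    (U : Matrix (Fin r) (Fin p) ℤ) : ℕ :=
  sInf {k | ∃ L : Submodule ℤ (Fin m → ℤ), Module.finrank ℤ L = k ∧ rowSpan B ≤ L ∧
    ∃ C : Matrix (Fin p) (Fin m) ℤ, rowSpan (A - U * C) ≤ L}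

/-! ## Inputs of algorithms -/

/-- An expression for an element `t^a u` of `ℤ^m × F_n`: the vector `a`, and a (possibly unreduced)
word for `u`, in which `(x, true)` is the letter `x` and `(x, false)` its inverse. -/
abbrev Expr (m n : ℕ) : Type :=
  (Fin m → ℤ) × List (Fin n × Bool)

/-- The element of `ℤ^m × F_n` that an expression represents. -/
def Expr.eval {m n : ℕ} (e : Expr m n) : G m n :=
  elt e.1 (FreeGroup.mk e.2)

/-- The subgroup generated by a finite list of elements. -/
def generated {m n : ℕ} (g : List (Expr m n)) : Subgroup (G m n) :=
  Subgroup.closure (Set.range fun i : Fin g.length => Expr.eval (g.get i))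

instance {m n : ℕ} (g : List (Expr m n)) : Group.FG (generated g) :=
  Group.closure_finite_fg _

/-- A list of expressions as plain data, in a type that does not depend on `m` and `n`. -/
def code {m n : ℕ} (g : List (Expr m n)) : List (List ℤ × List (ℕ × Bool)) :=
  g.map fun e => (List.ofFn e.1, e.2.map fun l => ((l.1 : ℕ), l.2))

end FATF

end

/-! Since `ratio` is antitone in its denominator, the degree of compression is r̃(H)/c, where c is
the least reduced rank of a finitely generated K ≥ H (`dc_eq`). Everything therefore reduces to
least ranks of overgroups of H.

The formula. Homomorphisms to free-abelian groups give rank(Kπ) + rank(K ∩ ℤ^m) ≤ rank K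
(`rank_proj_add_finrank_lattice_le`). Given K ≥ H, a subgroup J of least rank between Hπ and Kπ is
an algebraic extension of Hπ, because a proper free factor has smaller rank
(`exists_algebraicExtension_le`). Lifting a basis of J into K supplies the rows of a matrix C for
which K ∩ ℤ^m is an admissible lattice in the definition of `d`, so r̃(J) + d ≤ r̃(K). Conversely,
an optimal pair (L, C) for J yields an overgroup of H with rank J + d generators, namely the lifts
t^{C_k} v_k and a basis of L. The condition Hπ ≠ 1 makes rank J positive, so that the truncated
subtraction of 1 is harmless. If Hπ = 1, comparing lattice ranks alone gives rank H ≤ rank K.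

The algorithm does not enumerate algebraic extensions. Let H be generated by t^{a_i} w_i. Labelling
the positions along the words w_i by bounded numbers, with all endpoints labelled 0, describes a
quotient of a bouquet of loops, with vertex set V and edge set E; there are finitely many such
closed labellings. Put vectors C_e on the edges, and let a lattice with l generators absorb the
differences between each a_i and the signed sum of C along w_i. A spanning tree then gives an
overgroup of H with |E| - |V| + 1 + l generators (`exists_generators_of_labelling`). Conversely,
labelling positions by cosets of Kπ shows that every overgroup K has at least that rank for some
labelling (`exists_coset_labelling`). So the least rank of an overgroup is a minimum over closed
labellings.

The rank of H itself is a maximum over closed folded labellings. A folded labelling extends to a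
permutation action, hence signed edge counts and the abelian part define a homomorphism from H to an
abelian group, and the rank spanned by the images of the generators is at most rank H. The coset
labelling for K = H attains equality.

The least l is `factorRank`, the minimal number of generators of the image of A in the cokernel of
U. It is found by unbounded search, since both bounds have finite certificates: a factorization from
above and a surjection onto (ℤ/p)^k from below (`exists_factors_and_obstruction`). -/

noncomputable section
namespace FATF

/-! ### Primitive recursive integer arithmetic and search for certificates -/

section Primrec

variable {α : Type*} [Primcodable α]

/-- Nonnegative integers have the even codes and negative integers the odd ones, so integer
operations can be checked to be primitive recursive through arithmetic on codes. -/
theorem primrec_int_encode (z : ℤ) :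
    Encodable.encode z = if 0 ≤ z then 2 * z.toNat else 2 * (-z).toNat - 1 := by
  cases z with
  | ofNat n =>
    have : Encodable.encode (Int.ofNat n) = 2 * n := rfl
    rw [this, if_pos (show (0 : ℤ) ≤ Int.ofNat n from Int.natCast_nonneg n)]; simp
  | negSucc n =>
    have : Encodable.encode (Int.negSucc n) = 2 * n + 1 := rfl
    rw [this, if_neg (by simp)]
    have : (-Int.negSucc n).toNat = n + 1 := by simp [Int.neg_negSucc]
    rw [this]; omega

theorem primrec_int_toNat : Primrec Int.toNat := by
  have h : Primrec fun z : ℤ =>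
      if Encodable.encode z % 2 = 0 then Encodable.encode z / 2 else 0 :=
    Primrec.ite (Primrec.eq.comp (Primrec.nat_mod.comp Primrec.encode (Primrec.const 2))
      (Primrec.const 0)) (Primrec.nat_div.comp Primrec.encode (Primrec.const 2)) (Primrec.const 0)
  refine h.of_eq fun z => ?_
  rw [primrec_int_encode]
  split_ifs <;> omega

theorem primrec_int_neg_toNat : Primrec fun z : ℤ => (-z).toNat := by
  have h : Primrec fun z : ℤ =>
      if Encodable.encode z % 2 = 0 then 0 else Encodable.encode z / 2 + 1 :=
    Primrec.ite (Primrec.eq.comp (Primrec.nat_mod.comp Primrec.encode (Primrec.const 2))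
      (Primrec.const 0)) (Primrec.const 0)
      (Primrec.succ.comp (Primrec.nat_div.comp Primrec.encode (Primrec.const 2)))
  refine h.of_eq fun z => ?_
  rw [primrec_int_encode]
  split_ifs <;> omega

theorem primrec_nat_sub_int : Primrec₂ fun a b : ℕ => (a : ℤ) - (b : ℤ) := by
  have h : Primrec₂ fun a b : ℕ => if b ≤ a then Denumerable.ofNat ℤ (2 * (a - b))
      else Denumerable.ofNat ℤ (2 * (b - a) - 1) := by
    refine Primrec.ite (Primrec.nat_le.comp .snd .fst) ((Primrec.ofNat ℤ).comp ?_)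
      ((Primrec.ofNat ℤ).comp ?_)
    · exact Primrec.nat_mul.comp (.const 2) (Primrec.nat_sub.comp .fst .snd)
    · exact Primrec.nat_sub.comp (Primrec.nat_mul.comp (.const 2) (Primrec.nat_sub.comp .snd .fst))
        (.const 1)
  refine h.of_eq fun a b => ?_
  split_ifs with hab
  · rw [Denumerable.ofNat_of_decode]
    rw [show 2 * (a - b) = Encodable.encode ((a : ℤ) - b) by
      rw [primrec_int_encode, if_pos (by omega)]; omega]
    exact Encodable.encodek _
  · rw [Denumerable.ofNat_of_decode]
    rw [show 2 * (b - a) - 1 = Encodable.encode ((a : ℤ) - b) by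
      rw [primrec_int_encode, if_neg (by omega)]; omega]
    exact Encodable.encodek _

theorem primrec_int_add : Primrec₂ fun a b : ℤ => a + b := by
  have h : Primrec₂ fun a b : ℤ =>
      ((a.toNat + b.toNat : ℕ) : ℤ) - (((-a).toNat + (-b).toNat : ℕ) : ℤ) :=
    primrec_nat_sub_int.comp₂
      (Primrec.nat_add.comp (primrec_int_toNat.comp .fst) (primrec_int_toNat.comp .snd))
      (Primrec.nat_add.comp (primrec_int_neg_toNat.comp .fst) (primrec_int_neg_toNat.comp .snd))
  exact h.of_eq fun a b => by omega

theorem primrec_int_mul : Primrec₂ fun a b : ℤ => a * b := by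
  have h : Primrec₂ fun a b : ℤ =>
      ((a.toNat * b.toNat + (-a).toNat * (-b).toNat : ℕ) : ℤ) -
        ((a.toNat * (-b).toNat + (-a).toNat * b.toNat : ℕ) : ℤ) := by
    have p1 := primrec_int_toNat.comp (Primrec.fst (α := ℤ) (β := ℤ))
    have p2 := primrec_int_toNat.comp (Primrec.snd (α := ℤ) (β := ℤ))
    have n1 := primrec_int_neg_toNat.comp (Primrec.fst (α := ℤ) (β := ℤ))
    have n2 := primrec_int_neg_toNat.comp (Primrec.snd (α := ℤ) (β := ℤ))
    exact primrec_nat_sub_int.comp₂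
      (Primrec.nat_add.comp (Primrec.nat_mul.comp p1 p2) (Primrec.nat_mul.comp n1 n2))
      (Primrec.nat_add.comp (Primrec.nat_mul.comp p1 n2) (Primrec.nat_mul.comp n1 p2))
  refine h.of_eq fun a b => ?_
  have ha : a = (a.toNat : ℤ) - ((-a).toNat : ℤ) := by omega
  have hb : b = (b.toNat : ℤ) - ((-b).toNat : ℤ) := by omega
  conv_rhs => rw [ha, hb]
  push_cast
  ring

theorem primrec_sum_int {b : α → ℕ} {f : α → ℕ → ℤ} (hb : Primrec b) (hf : Primrec₂ f) :
    Primrec fun x => ∑ i ∈ Finset.range (b x), f x i := by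
  have h₁ : Primrec₂ fun (x : α) (p : ℕ × ℤ) => p.2 + f x p.1 :=
    primrec_int_add.comp (Primrec.snd.comp .snd) (hf.comp .fst (Primrec.fst.comp .snd))
  have h : Primrec fun x => Nat.rec (motive := fun _ => ℤ) 0 (fun i s => s + f x i) (b x) :=
    Primrec.nat_rec' hb (.const 0) h₁
  refine h.of_eq fun x => ?_
  induction b x with
  | zero => simp
  | succ k ih => rw [Finset.sum_range_succ, ← ih]

theorem primrec_sum_nat {b : α → ℕ} {f : α → ℕ → ℕ} (hb : Primrec b) (hf : Primrec₂ f) :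
    Primrec fun x => ∑ i ∈ Finset.range (b x), f x i := by
  have h₁ : Primrec₂ fun (x : α) (p : ℕ × ℕ) => p.2 + f x p.1 :=
    Primrec.nat_add.comp (Primrec.snd.comp .snd) (hf.comp .fst (Primrec.fst.comp .snd))
  have h : Primrec fun x => Nat.rec (motive := fun _ => ℕ) 0 (fun i s => s + f x i) (b x) :=
    Primrec.nat_rec' hb (.const 0) h₁
  refine h.of_eq fun x => ?_
  induction b x with
  | zero => simp
  | succ k ih => rw [Finset.sum_range_succ, ← ih]

theorem primrecPred_exists_lt {b : α → ℕ} {p : α → ℕ → Prop} (hb : Primrec b)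
    (hp : PrimrecPred fun y : α × ℕ => p y.1 y.2) : PrimrecPred fun x => ∃ i < b x, p x i := by
  have h : PrimrecRel fun (i : ℕ) (x : α) => p x i :=
    PrimrecPred.comp (p := fun y : α × ℕ => p y.1 y.2) hp (Primrec.pair .snd .fst)
  exact (h.exists_mem_list.comp (Primrec.list_range.comp hb) Primrec.id).of_eq fun x => by simp

theorem primrecPred_forall_lt {b : α → ℕ} {p : α → ℕ → Prop} (hb : Primrec b)
    (hp : PrimrecPred fun y : α × ℕ => p y.1 y.2) : PrimrecPred fun x => ∀ i < b x, p x i := by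
  have h : PrimrecRel fun (i : ℕ) (x : α) => p x i :=
    PrimrecPred.comp (p := fun y : α × ℕ => p y.1 y.2) hp (Primrec.pair .snd .fst)
  exact (h.forall_mem_list.comp (Primrec.list_range.comp hb) Primrec.id).of_eq fun x => by simp

theorem primrec_nat_pow : Primrec₂ fun a b : ℕ => a ^ b := by
  have h₁ : Primrec₂ fun (x : ℕ × ℕ) (p : ℕ × ℕ) => p.2 * x.1 :=
    Primrec.nat_mul.comp (Primrec.snd.comp .snd) (Primrec.fst.comp .fst)
  have h : Primrec fun x : ℕ × ℕ =>
      Nat.rec (motive := fun _ => ℕ) 1 (fun _ s => s * x.1) x.2 :=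
    Primrec.nat_rec' .snd (.const 1) h₁
  refine h.of_eq fun x => ?_
  induction x.2 with
  | zero => simp
  | succ k ih => exact (congrArg (· * x.1) ih).trans (pow_succ x.1 k).symm

/-- A function all of whose values have a checkable certificate is computable. -/
theorem computable_of_certificate {σ γ : Type*} [Primcodable σ] [Primcodable γ] (h : α → σ)
    (R : α × σ × γ → Prop) (hR : PrimrecPred R) (sound : ∀ x k y, R (x, k, y) → k = h x)
    (complete : ∀ x, ∃ y, R (x, h x, y)) : Computable h := by
  obtain ⟨_, hR⟩ := hR
  let f : α → ℕ → Option σ := fun x e =>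
    (Encodable.decode (α := σ × γ) e).bind fun ky => bif decide (R (x, ky)) then some ky.1 else none
  have hf : Computable₂ f := by
    refine Primrec₂.to_comp (Primrec.option_bind (Primrec.decode.comp .snd) ?_)
    refine Primrec.cond (hR.comp (Primrec.pair (Primrec.fst.comp .fst) .snd))
      (Primrec.option_some.comp (Primrec.fst.comp .snd)) (.const none)
  -- Unbounded search over codes of pairs (value, certificate): soundness makes any hit correct, and
  -- completeness makes the search halt.
  refine (Partrec.rfindOpt hf).of_eq_tot fun x => ?_
  have hval : ∀ e a, a ∈ f x e → a = h x := by
    intro e a ha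
    simp only [f, Option.mem_def, Option.bind_eq_some_iff] at ha
    obtain ⟨ky, -, hk⟩ := ha
    by_cases hr : R (x, ky)
    · simp only [hr, decide_true, cond_true, Option.some.injEq] at hk
      rw [← hk]; exact sound x ky.1 ky.2 hr
    · simp [hr] at hk
  have hdom : (Nat.rfindOpt (f x)).Dom := by
    rw [Nat.rfindOpt_dom]
    obtain ⟨y, hy⟩ := complete x
    refine ⟨Encodable.encode (h x, y), h x, ?_⟩
    simp [f, hy]
  obtain ⟨e, he⟩ := Nat.rfindOpt_spec (Part.get_mem hdom)
  rw [← hval e _ he]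
  exact Part.get_mem hdom

end Primrec
-- Minimal number of generators of an image in a cokernel
/-- The matrix `A` (of size `q × c`) is the sum of a matrix `U * C` and of a matrix that factors
through `ℤ^l`. -/
def Factors (q c u : ℕ) (A U : ℕ → ℕ → ℤ) (l : ℕ) : Prop :=
  ∃ C X Λ : ℕ → ℕ → ℤ, ∀ i < q, ∀ j < c, A i j =
    ∑ e ∈ Finset.range u, U i e * C e j + ∑ t ∈ Finset.range l, X i t * Λ t j

/-- A witness that the image of `A` in the cokernel of `U` cannot be generated by fewer than `k`
elements: it maps onto `(ℤ/p)^k`. -/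
def FactorObstruction (q c u : ℕ) (A U : ℕ → ℕ → ℤ) (k : ℕ) : Prop :=
  ∃ (D p : ℤ) (Ξ η Z₁ Z₂ : ℕ → ℕ → ℤ), D ≠ 0 ∧ 2 ≤ p ∧
    (∀ t < k, ∀ e < u, ∑ i ∈ Finset.range q, Ξ t i * U i e = D * p * Z₁ t e) ∧
    ∀ t < k, ∀ s < k,
      ∑ i ∈ Finset.range q, Ξ t i * ∑ j ∈ Finset.range c, A i j * η j s =
        D * ((if t = s then 1 else 0) + p * Z₂ t s)

/-- Extension of a matrix by zeros. -/
def extendZero {a b : ℕ} (M : Fin a → Fin b → ℤ) : ℕ → ℕ → ℤ := fun i j =>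
  if h : i < a ∧ j < b then M ⟨i, h.1⟩ ⟨j, h.2⟩ else 0

@[simp] theorem extendZero_apply {a b : ℕ} (M : Fin a → Fin b → ℤ) (i : Fin a) (j : Fin b) :
    extendZero M i j = M i j := by simp [extendZero]

/-- The matrix is the identity modulo p, so its determinant is 1 modulo p. -/
theorem Matrix.det_one_add_mul_ne_zero {k : ℕ} (p : ℤ) (hp : 2 ≤ p) (Z : Matrix (Fin k) (Fin k) ℤ) :
    (1 + p • Z).det ≠ 0 := by
  intro h
  lift p to ℕ using by omega
  have h1 := (Int.castRingHom (ZMod p)).map_det (1 + (p : ℤ) • Z)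
  have : (Int.castRingHom (ZMod p)).mapMatrix (1 + (p : ℤ) • Z) = 1 := by
    rw [map_add, map_one]
    convert add_zero _
    ext i j
    change (((p : ℤ) * Z i j : ℤ) : ZMod p) = 0
    simp
  rw [this, Matrix.det_one, h, map_zero] at h1
  have : Fact (1 < p) := ⟨by omega⟩
  exact zero_ne_one h1

theorem Matrix.det_mul_eq_zero_of_lt {k l : ℕ} (h : l < k) (X : Matrix (Fin k) (Fin l) ℤ)
    (Y : Matrix (Fin l) (Fin k) ℤ) : (X * Y).det = 0 := by
  by_contra hne
  have hY : ∃ v : Fin k → ℤ, v ≠ 0 ∧ Y.mulVec v = 0 := by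
    by_contra! hall
    refine absurd (le_of_fin_injective ℤ Y.mulVecLin ?_) (by omega)
    rw [← LinearMap.ker_eq_bot, LinearMap.ker_eq_bot']
    intro v hv
    by_contra h0
    exact hall v h0 hv
  obtain ⟨v, hv0, hv⟩ := hY
  exact hne (Matrix.exists_mulVec_eq_zero_iff.1 ⟨v, hv0, by rw [← Matrix.mulVec_mulVec, hv]; simp⟩)

/-- Multiplying the decomposition of A by Ξ on the left and η on the right turns the part through U
into a multiple of D p. What remains is D times a matrix congruent to 1 modulo p, hence nonsingular,
yet it factors through ℤ^l. This is impossible for l < k. -/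
theorem FactorObstruction.le {q c u : ℕ} {A U : ℕ → ℕ → ℤ} {k l : ℕ}
    (ho : FactorObstruction q c u A U k) (hf : Factors q c u A U l) : k ≤ l := by
  obtain ⟨D, p, Ξ, η, Z₁, Z₂, hD, hp, h1, h2⟩ := ho
  obtain ⟨C, X, Λ, hA⟩ := hf
  by_contra! hlt
  let Ξ' : Matrix (Fin k) (Fin q) ℤ := .of fun t i => Ξ t i
  let η' : Matrix (Fin c) (Fin k) ℤ := .of fun t i => η t i
  let A' : Matrix (Fin q) (Fin c) ℤ := .of fun t i => A t i
  let U' : Matrix (Fin q) (Fin u) ℤ := .of fun t i => U t i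
  let C' : Matrix (Fin u) (Fin c) ℤ := .of fun t i => C t i
  let X' : Matrix (Fin q) (Fin l) ℤ := .of fun t i => X t i
  let Λ' : Matrix (Fin l) (Fin c) ℤ := .of fun t i => Λ t i
  let Z1 : Matrix (Fin k) (Fin u) ℤ := .of fun t i => Z₁ t i
  let Z2 : Matrix (Fin k) (Fin k) ℤ := .of fun t i => Z₂ t i
  have e1 : Ξ' * U' = (D * p) • Z1 := by
    ext t e
    have := h1 t t.2 e e.2
    rw [Finset.sum_range] at this
    simpa [Matrix.mul_apply, Ξ', U', Z1] using this
  have e2 : Ξ' * (A' * η') = D • (1 + p • Z2) := by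
    ext t s
    have := h2 t t.2 s s.2
    simp only [Finset.sum_range] at this
    simpa [Matrix.mul_apply, Ξ', A', η', Z2, Matrix.one_apply, Fin.ext_iff] using this
  have e3 : A' = U' * C' + X' * Λ' := by
    ext i j
    have := hA i i.2 j j.2
    simp only [Finset.sum_range] at this
    simpa [Matrix.mul_apply, A', U', C', X', Λ'] using this
  have e4 : (Ξ' * X') * (Λ' * η') = D • (1 + p • (Z2 - Z1 * C' * η')) := by
    have : (Ξ' * X') * (Λ' * η') = Ξ' * (A' * η') - Ξ' * U' * C' * η' := by
      rw [e3]; simp only [Matrix.add_mul, Matrix.mul_add, Matrix.mul_assoc]; abel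
    rw [this, e1, e2]
    simp only [Matrix.smul_mul, smul_add, smul_sub, smul_smul]
    abel
  have := Matrix.det_mul_eq_zero_of_lt hlt (Ξ' * X') (Λ' * η')
  rw [e4, Matrix.det_smul] at this
  rcases mul_eq_zero.1 this with h | h
  · exact pow_ne_zero _ hD h
  · exact Matrix.det_one_add_mul_ne_zero p hp _ h

/-- The relations of a generating family of least length are all divisible by some `p ≥ 2`. -/
theorem exists_dvd_of_minimal_generators {Y : Type*} [AddCommGroup Y] {k : ℕ}
    (π : (Fin k → ℤ) →ₗ[ℤ] Y) (hπ : Function.Surjective π)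
    (hmin : ∀ l < k, ∀ ρ : (Fin l → ℤ) →ₗ[ℤ] Y, ¬ Function.Surjective ρ) :
    ∃ p : ℤ, 2 ≤ p ∧ ∀ x, π x = 0 → ∀ i, p ∣ x i := by
  -- In Smith form the question is whether the elementary divisors have a common prime factor.
  obtain ⟨n, snf⟩ := Submodule.smithNormalForm (Pi.basisFun ℤ (Fin k)) (LinearMap.ker π)
  have hspan : ∃ g : ℤ, Ideal.span (Set.range snf.a) = Ideal.span {g} :=
    (IsPrincipalIdealRing.principal (Ideal.span (Set.range snf.a))).principal
  obtain ⟨g, hg⟩ := hspan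
  by_cases hu : IsUnit g
  · exfalso
    rw [Ideal.span_singleton_eq_top.2 hu] at hg
    have h1 : (1 : ℤ) ∈ Ideal.span (Set.range snf.a) := by rw [hg]; trivial
    obtain ⟨y, hy⟩ := Ideal.mem_span_range_iff_exists_fun.1 h1
    -- When the elementary divisors generate the unit ideal, the relation r is unimodular: the form
    -- ℓ takes the value 1 on it. Then ℤ^k = ker ℓ ⊕ ℤr, and ker ℓ, of rank k - 1, already surjects
    -- onto Y, against minimality.
    let r : Fin k → ℤ := ∑ i, (snf.bN i : Fin k → ℤ)
    have hr : π r = 0 := by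
      have : ∀ i, π (snf.bN i : Fin k → ℤ) = 0 := fun i => (snf.bN i).2
      simp [r, this]
    let ℓ : (Fin k → ℤ) →ₗ[ℤ] ℤ := ∑ i, y i • snf.bM.coord (snf.f i)
    have hℓ : ℓ r = 1 := by
      rw [← hy]
      simp only [ℓ, r, snf.snf, LinearMap.sum_apply, LinearMap.smul_apply, map_sum, map_smul,
        Module.Basis.coord_apply, Module.Basis.repr_self]
      refine Finset.sum_congr rfl fun i _ => ?_
      rw [Finset.sum_eq_single i]
      · simp [mul_comm]
      · intro j _ hj
        simp [snf.f.injective.eq_iff, hj]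
      · simp
    have hrange : LinearMap.range ℓ = ⊤ :=
      LinearMap.range_eq_top.2 fun z => ⟨z • r, by rw [map_smul, hℓ, smul_eq_mul, mul_one]⟩
    have hfin := Submodule.finrank_quotient_add_finrank (LinearMap.ker ℓ)
    rw [(ℓ.quotKerEquivOfSurjective (LinearMap.range_eq_top.1 hrange)).finrank_eq] at hfin
    simp only [Module.finrank_self, Module.finrank_fin_fun] at hfin
    let b := Module.finBasis ℤ (LinearMap.ker ℓ)
    refine hmin (Module.finrank ℤ (LinearMap.ker ℓ)) (by omega)
      (π ∘ₗ (LinearMap.ker ℓ).subtype ∘ₗ b.equivFun.symm.toLinearMap) fun z => ?_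
    obtain ⟨x, rfl⟩ := hπ z
    refine ⟨b.equivFun ⟨x - ℓ x • r, by
      rw [LinearMap.mem_ker, map_sub, map_smul, hℓ, smul_eq_mul, mul_one, sub_self]⟩, ?_⟩
    simp only [LinearMap.comp_apply, LinearEquiv.coe_coe, LinearEquiv.symm_apply_apply,
      Submodule.subtype_apply, map_sub, map_smul, hr, smul_zero, sub_zero]
  · have hp : ∃ p : ℤ, 2 ≤ p ∧ p ∣ g := by
      have : g.natAbs ≠ 1 := fun h => hu (Int.isUnit_iff_natAbs_eq.2 h)
      obtain ⟨p, hp, hpg⟩ := Nat.exists_prime_and_dvd this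
      exact ⟨p, by exact_mod_cast hp.two_le, Int.natCast_dvd.2 hpg⟩
    obtain ⟨p, hp, hpg⟩ := hp
    refine ⟨p, hp, fun x hx i => ?_⟩
    have ha : ∀ i, p ∣ snf.a i := fun i => hpg.trans <| Ideal.mem_span_singleton.1 <| by
      rw [← hg]; exact Ideal.subset_span ⟨i, rfl⟩
    have hx' := congrArg (Subtype.val) (snf.bN.sum_repr ⟨x, hx⟩)
    simp only [Submodule.coe_sum, Submodule.coe_smul, snf.snf] at hx'
    rw [← hx']
    simp only [Finset.sum_apply, Pi.smul_apply, smul_eq_mul]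
    exact Finset.dvd_sum fun j _ => (Dvd.dvd.mul_right (ha j) _).mul_left _

theorem exists_common_denominator {a b : ℕ} (ρ : Fin a → Fin b → ℚ) :
    ∃ N : ℤ, N ≠ 0 ∧ ∃ z : Fin a → Fin b → ℤ, ∀ t i, (N : ℚ) * ρ t i = z t i := by
  obtain ⟨N, hN⟩ := IsLocalization.exist_integer_multiples_of_finite (nonZeroDivisors ℤ)
    (fun x : Fin a × Fin b => ρ x.1 x.2)
  choose z hz using hN
  refine ⟨N, nonZeroDivisors.ne_zero N.2, fun t i => z (t, i), fun t i => ?_⟩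
  have := hz (t, i)
  simp only [Algebra.smul_def, algebraMap_int_eq] at this
  simpa using this.symm

/-- Take k to be the minimal number of generators of the image Y of A in the cokernel of U. Lifting
the generators gives the factorization. For the obstruction, all relations among them are divisible
by some p, so the coordinates divided by p define characters of Y in ℚ/ℤ; as ℚ/ℤ is injective these
extend to the whole cokernel, and clearing denominators gives integer matrices. -/
theorem exists_factors_and_obstruction (q c u : ℕ) (A U : ℕ → ℕ → ℤ) :
    ∃ k, Factors q c u A U k ∧ FactorObstruction q c u A U k := by
  classical
  let A' : Matrix (Fin q) (Fin c) ℤ := .of fun t i => A t i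
  let U' : Matrix (Fin q) (Fin u) ℤ := .of fun t i => U t i
  let S : Submodule ℤ (Fin q → ℤ) := LinearMap.range U'.mulVecLin
  let α : (Fin c → ℤ) →ₗ[ℤ] ((Fin q → ℤ) ⧸ S) := S.mkQ ∘ₗ A'.mulVecLin
  let Y := LinearMap.range α
  have hex : ∃ k, ∃ π : (Fin k → ℤ) →ₗ[ℤ] Y, Function.Surjective π :=
    ⟨c, α.rangeRestrict, α.surjective_rangeRestrict⟩
  obtain ⟨π, hπ⟩ := Nat.find_spec hex
  have hmin := fun l (hl : l < Nat.find hex) => Nat.find_min hex hl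
  generalize Nat.find hex = k at π hmin
  push Not at hmin
  refine ⟨k, ?_, ?_⟩
  · have hX : ∀ t, ∃ x : Fin q → ℤ, S.mkQ x = π (Pi.single t 1) := fun t => S.mkQ_surjective _
    choose X hX using hX
    have hL : ∀ j, ∃ y : Fin k → ℤ, (π y : (Fin q → ℤ) ⧸ S) = α (Pi.single j 1) := fun j => by
      obtain ⟨y, hy⟩ := hπ ⟨α (Pi.single j 1), _, rfl⟩
      exact ⟨y, by rw [hy]⟩
    choose L hL using hL
    have hC : ∀ j, ∃ z : Fin u → ℤ, U'.mulVec z = A'.mulVec (Pi.single j 1) - ∑ t, L j t • X t := by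
      intro j
      have : A'.mulVec (Pi.single j 1) - ∑ t, L j t • X t ∈ S := by
        rw [← S.ker_mkQ, LinearMap.mem_ker, map_sub, sub_eq_zero]
        simp only [map_sum, map_smul, hX]
        have e : π (L j) = ∑ t, L j t • π (Pi.single t 1) := by
          conv_lhs => rw [← (Pi.basisFun ℤ (Fin k)).sum_repr (L j)]
          simp only [map_sum, map_smul, Pi.basisFun_repr, Pi.basisFun_apply]
        have := hL j
        rw [e] at this
        simpa [α] using this.symm
      obtain ⟨z, hz⟩ := this
      exact ⟨z, hz⟩
    choose Cm hC using hC
    refine ⟨extendZero fun e j => Cm j e, extendZero fun i t => X t i,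
      extendZero fun t j => L j t, fun i hi j hj => ?_⟩
    have := congrFun (hC ⟨j, hj⟩) ⟨i, hi⟩
    simp only [Matrix.mulVec_single_one, Pi.sub_apply, Finset.sum_apply, Pi.smul_apply,
      smul_eq_mul, Matrix.mulVec, dotProduct, Matrix.col_apply, A', U', Matrix.of_apply] at this
    rw [Finset.sum_range, Finset.sum_range]
    rw [eq_sub_iff_add_eq] at this
    rw [← this]
    congr 1
    · refine Finset.sum_congr rfl fun e _ => ?_
      rw [show extendZero (fun e j => Cm j e) e j = Cm ⟨j, hj⟩ e from
        extendZero_apply (fun e j => Cm j e) e ⟨j, hj⟩]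
    · refine Finset.sum_congr rfl fun t _ => ?_
      rw [show extendZero (fun i t => X t i) i t = X t ⟨i, hi⟩ from
        extendZero_apply (fun i t => X t i) ⟨i, hi⟩ t,
        show extendZero (fun t j => L j t) t j = L ⟨j, hj⟩ t from
        extendZero_apply (fun t j => L j t) t ⟨j, hj⟩, mul_comm]
  · obtain ⟨p, hp, hdvd⟩ := exists_dvd_of_minimal_generators π hπ fun l hl ρ => hmin l hl ρ
    have hp0 : (p : ℚ) ≠ 0 := by
      have : p ≠ 0 := by omega
      exact_mod_cast this
    -- The character ψ t sends the s-th generator to δ_{ts}/p; it is well defined because p divides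
    -- every coordinate of every relation.
    have hψ : ∀ t : Fin k, ∃ ψ : Y →+ AddCircle (1 : ℚ),
        ∀ x, ψ (π x) = (((x t : ℚ) / p : ℚ) : AddCircle (1 : ℚ)) := by
      intro t
      let g : (Fin k → ℤ) →+ AddCircle (1 : ℚ) :=
        { toFun := fun x => (((x t : ℚ) / p : ℚ) : AddCircle (1 : ℚ))
          map_zero' := by simp
          map_add' := fun x y => by
            rw [← AddCircle.coe_add]; congr 1; push_cast [Pi.add_apply]; ring }
      have hker : π.toAddMonoidHom.ker ≤ g.ker := by
        intro x hx
        obtain ⟨z, hz⟩ := hdvd x hx t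
        have hz' : (x t : ℚ) / p = z := by rw [hz]; push_cast; field_simp
        change (((x t : ℚ) / p : ℚ) : AddCircle (1 : ℚ)) = 0
        rw [hz', AddCircle.coe_eq_zero_iff]
        exact ⟨z, by simp⟩
      refine ⟨AddMonoidHom.liftOfSurjective π.toAddMonoidHom hπ ⟨g, hker⟩, fun x => ?_⟩
      exact AddMonoidHom.liftOfRightInverse_comp_apply _ _ _ ⟨g, hker⟩ x
    choose ψ hψ using hψ
    have hχ : ∀ t : Fin k, ∃ χ : ((Fin q → ℤ) ⧸ S) →+ AddCircle (1 : ℚ),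
        ∀ y : Y, χ y = ψ t y := by
      intro t
      obtain ⟨χ, hχ⟩ := CharacterModule.dual_surjective_of_injective (R := ℤ) Y.subtype
        Y.injective_subtype (ψ t)
      exact ⟨χ, fun y => DFunLike.congr_fun hχ y⟩
    choose χ hχ using hχ
    have hρ : ∀ t i, ∃ ρ : ℚ, (ρ : AddCircle (1 : ℚ)) = χ t (S.mkQ (Pi.single i 1)) := fun t i =>
      QuotientAddGroup.mk_surjective _
    choose ρ hρ using hρ
    have hsum : ∀ t (v : Fin q → ℤ), χ t (S.mkQ v) =
        ((∑ i, ρ t i * v i : ℚ) : AddCircle (1 : ℚ)) := by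
      intro t v
      conv_lhs => rw [← (Pi.basisFun ℤ (Fin q)).sum_repr v]
      simp only [Pi.basisFun_repr, Pi.basisFun_apply, map_sum, map_smul, map_zsmul, ← hρ]
      refine Eq.trans ?_ (map_sum (QuotientAddGroup.mk' (AddSubgroup.zmultiples (1 : ℚ))) _ _).symm
      refine Finset.sum_congr rfl fun i _ => ?_
      rw [← AddCircle.coe_zsmul, zsmul_eq_mul, mul_comm]
      rfl
    obtain ⟨N, hN, z, hz⟩ := exists_common_denominator ρ
    -- The extended character kills the columns of U, so the rational functional ρ t that represents
    -- it is integral on them.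
    have hZ1 : ∀ t e, ∃ y : ℤ, ∑ i, ρ t i * (U' i e : ℚ) = y := by
      intro t e
      have h0 : χ t (S.mkQ (U'.mulVec (Pi.single e 1))) = 0 := by
        rw [show S.mkQ (U'.mulVec (Pi.single e 1)) = 0 from ?_, map_zero]
        rw [← LinearMap.mem_ker, S.ker_mkQ]; exact ⟨_, rfl⟩
      rw [hsum, AddCircle.coe_eq_zero_iff] at h0
      obtain ⟨y, hy⟩ := h0
      exact ⟨y, by simpa using hy.symm⟩
    choose Z1 hZ1 using hZ1
    have hη : ∀ s : Fin k, ∃ η : Fin c → ℤ, α η = π (Pi.single s 1) := fun s =>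
      (π (Pi.single s 1)).2
    choose η hη using hη
    have hZ2 : ∀ t s, ∃ y : ℤ,
        ∑ i, ρ t i * ((A'.mulVec (η s) i : ℤ) : ℚ) = (if t = s then 1 else 0) / p + y := by
      intro t s
      have h0 : χ t (S.mkQ (A'.mulVec (η s))) =
          (((if t = s then 1 else 0 : ℚ) / p : ℚ) : AddCircle (1 : ℚ)) := by
        have : S.mkQ (A'.mulVec (η s)) = π (Pi.single s 1) := hη s
        rw [this, hχ, hψ]
        congr 2
        simp [Pi.single_apply]
      rw [hsum, ← sub_eq_zero, ← AddCircle.coe_sub, AddCircle.coe_eq_zero_iff] at h0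
      obtain ⟨y, hy⟩ := h0
      refine ⟨y, ?_⟩
      simp only [zsmul_eq_mul, mul_one] at hy
      rw [hy]; ring
    choose Z2 hZ2 using hZ2
    -- With N a common denominator of ρ, the matrix Ξ = N p ρ is integral. Thus D = N, and dividing
    -- Ξ by D p recovers the characters.
    refine ⟨N, p, extendZero fun t i => p * z t i, extendZero fun j s => η s j, extendZero Z1,
      extendZero Z2, hN, hp, fun t ht e he => ?_, fun t ht s hs => ?_⟩
    · lift t to Fin k using ht
      lift e to Fin u using he
      rw [Finset.sum_range]
      simp only [extendZero_apply]
      rw [← Int.cast_inj (α := ℚ)]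
      push_cast
      rw [← hZ1, Finset.mul_sum]
      refine Finset.sum_congr rfl fun i _ => ?_
      rw [← hz]; simp only [U', Matrix.of_apply]; ring
    · lift t to Fin k using ht
      lift s to Fin k using hs
      simp only [Finset.sum_range, extendZero_apply]
      rw [← Int.cast_inj (α := ℚ)]
      have h2 := hZ2 t s
      push_cast
      rw [show (N : ℚ) * ((if (t : ℕ) = s then 1 else 0) + p * Z2 t s) =
        N * p * ((if t = s then 1 else 0) / p + Z2 t s) by
          simp only [Fin.ext_iff]; field_simp, ← h2, Finset.mul_sum]
      refine Finset.sum_congr rfl fun i _ => ?_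
      rw [← hz]; simp only [A', Matrix.mulVec, dotProduct, Matrix.of_apply]; push_cast; ring

/-- The least `l` such that `A` is the sum of some `U * C` and of a matrix that factors through
`ℤ^l`. -/
def factorRank (q c u : ℕ) (A U : ℕ → ℕ → ℤ) : ℕ :=
  sInf {l | Factors q c u A U l}

theorem factorRank_le {q c u : ℕ} {A U : ℕ → ℕ → ℤ} {l : ℕ} (h : Factors q c u A U l) :
    factorRank q c u A U ≤ l := Nat.sInf_le h

theorem factors_factorRank (q c u : ℕ) (A U : ℕ → ℕ → ℤ) :
    Factors q c u A U (factorRank q c u A U) :=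
  let ⟨k, hk, _⟩ := exists_factors_and_obstruction q c u A U
  Nat.sInf_mem (s := {l | Factors q c u A U l}) ⟨k, hk⟩

theorem eq_factorRank {q c u : ℕ} {A U : ℕ → ℕ → ℤ} {k : ℕ} (h : Factors q c u A U k)
    (ho : FactorObstruction q c u A U k) : k = factorRank q c u A U :=
  le_antisymm (ho.le (factors_factorRank q c u A U)) (factorRank_le h)

/-- The `r`-th matrix of a list of matrices. -/
def nthMatrix (L : List (List (List ℤ))) (r i j : ℕ) : ℤ :=
  ((L.getD r []).getD i []).getD j 0

/-- The list of rows of the upper left `a × b` block. -/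
def blockList (a b : ℕ) (M : ℕ → ℕ → ℤ) : List (List ℤ) :=
  (List.range a).map fun i => (List.range b).map (M i)

theorem getD_blockList {a b : ℕ} (M : ℕ → ℕ → ℤ) {i j : ℕ} (hi : i < a) (hj : j < b) :
    ((blockList a b M).getD i []).getD j 0 = M i j := by
  simp [blockList, List.getD_eq_getElem?_getD, hi, hj]

section

variable {σ : Type*} [Primcodable σ]

theorem primrec_nthMatrix {L : σ → List (List (List ℤ))} (hL : Primrec L) (r : ℕ) :
    Primrec fun y : σ × ℕ × ℕ => nthMatrix (L y.1) r y.2.1 y.2.2 :=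
  (Primrec.list_getD 0).comp ((Primrec.list_getD []).comp
    ((Primrec.list_getD []).comp (hL.comp .fst) (.const r)) (Primrec.fst.comp .snd))
    (Primrec.snd.comp .snd)

theorem primrec_matrix_mul {b : σ → ℕ} {M N : σ → ℕ → ℕ → ℤ} (hb : Primrec b)
    (hM : Primrec fun y : σ × ℕ × ℕ => M y.1 y.2.1 y.2.2)
    (hN : Primrec fun y : σ × ℕ × ℕ => N y.1 y.2.1 y.2.2) :
    Primrec fun y : σ × ℕ × ℕ => ∑ e ∈ Finset.range (b y.1), M y.1 y.2.1 e * N y.1 e y.2.2 := by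
  have h : Primrec₂ fun (y : σ × ℕ × ℕ) (e : ℕ) => M y.1 y.2.1 e * N y.1 e y.2.2 :=
    primrec_int_mul.comp
      (hM.comp (Primrec.pair (Primrec.fst.comp .fst)
        (Primrec.pair (Primrec.fst.comp (Primrec.snd.comp .fst)) .snd)))
      (hN.comp (Primrec.pair (Primrec.fst.comp .fst)
        (Primrec.pair .snd (Primrec.snd.comp (Primrec.snd.comp .fst)))))
  exact primrec_sum_int (hb.comp .fst) h

theorem primrecPred_matrix_eq {a b : σ → ℕ} {M N : σ → ℕ → ℕ → ℤ} (ha : Primrec a) (hb : Primrec b)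
    (hM : Primrec fun y : σ × ℕ × ℕ => M y.1 y.2.1 y.2.2)
    (hN : Primrec fun y : σ × ℕ × ℕ => N y.1 y.2.1 y.2.2) :
    PrimrecPred fun z => ∀ i < a z, ∀ j < b z, M z i j = N z i j := by
  have h : Primrec fun y : (σ × ℕ) × ℕ => (y.1.1, y.1.2, y.2) :=
    (Primrec.fst.comp .fst).pair ((Primrec.snd.comp .fst).pair .snd)
  exact primrecPred_forall_lt ha (primrecPred_forall_lt (hb.comp .fst)
    (Primrec.eq.comp (hM.comp h) (hN.comp h)))

end

theorem computable_factorRank {α : Type*} [Primcodable α] {q c u : α → ℕ} {A U : α → ℕ → ℕ → ℤ}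
    (hq : Primrec q) (hc : Primrec c) (hu : Primrec u)
    (hA : Primrec fun y : α × ℕ × ℕ => A y.1 y.2.1 y.2.2)
    (hU : Primrec fun y : α × ℕ × ℕ => U y.1 y.2.1 y.2.2) :
    Computable fun x => factorRank (q x) (c x) (u x) (A x) (U x) := by
  let γ := (ℤ × ℤ) × List (List (List ℤ))
  -- The certificate consists of the pair (D, p) and a list holding C, X, Λ, Ξ, η, Z₁, Z₂ in
  -- positions 0 to 6. It proves both k ≥ `factorRank` and k ≤ `factorRank`.
  let R : α × ℕ × γ → Prop := fun z =>
    (z.2.2.1.1 ≠ 0 ∧ z.2.2.1.2.toNat ≥ 2) ∧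
    (∀ i < q z.1, ∀ j < c z.1, A z.1 i j =
      ∑ e ∈ Finset.range (u z.1), U z.1 i e * nthMatrix z.2.2.2 0 e j +
      ∑ t ∈ Finset.range z.2.1, nthMatrix z.2.2.2 1 i t * nthMatrix z.2.2.2 2 t j) ∧
    (∀ t < z.2.1, ∀ e < u z.1,
      ∑ i ∈ Finset.range (q z.1), nthMatrix z.2.2.2 3 t i * U z.1 i e =
        z.2.2.1.1 * z.2.2.1.2 * nthMatrix z.2.2.2 5 t e) ∧
    ∀ t < z.2.1, ∀ s < z.2.1,
      ∑ i ∈ Finset.range (q z.1), nthMatrix z.2.2.2 3 t i *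
        ∑ j ∈ Finset.range (c z.1), A z.1 i j * nthMatrix z.2.2.2 4 j s =
        z.2.2.1.1 * ((if t = s then 1 else 0) + z.2.2.1.2 * nthMatrix z.2.2.2 6 t s)
  refine computable_of_certificate (γ := γ) _ R ?_ ?_ ?_
  · have hx : Primrec fun z : α × ℕ × γ => z.1 := .fst
    have hk : Primrec fun z : α × ℕ × γ => z.2.1 := Primrec.fst.comp .snd
    have hD : Primrec fun z : α × ℕ × γ => z.2.2.1.1 :=
      Primrec.fst.comp (Primrec.fst.comp (Primrec.snd.comp .snd))
    have hp : Primrec fun z : α × ℕ × γ => z.2.2.1.2 :=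
      Primrec.snd.comp (Primrec.fst.comp (Primrec.snd.comp .snd))
    have hL : Primrec fun z : α × ℕ × γ => z.2.2.2 := Primrec.snd.comp (Primrec.snd.comp .snd)
    have hM := fun r => primrec_nthMatrix hL r
    let τ := α × ℕ × γ
    have hA' : Primrec fun y : τ × ℕ × ℕ => A y.1.1 y.2.1 y.2.2 :=
      hA.comp ((hx.comp .fst).pair .snd)
    have hU' : Primrec fun y : τ × ℕ × ℕ => U y.1.1 y.2.1 y.2.2 :=
      hU.comp ((hx.comp .fst).pair .snd)
    have h0 : PrimrecPred fun z : τ => z.2.2.1.1 ≠ 0 ∧ z.2.2.1.2.toNat ≥ 2 :=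
      (Primrec.eq.comp hD (.const 0)).not.and
        (Primrec.nat_le.comp (.const 2) (primrec_int_toNat.comp hp))
    have m1 := primrec_matrix_mul (M := fun z : τ => U z.1) (N := fun z => nthMatrix z.2.2.2 0)
      (hu.comp hx) hU' (hM 0)
    have m2 := primrec_matrix_mul (M := fun z : τ => nthMatrix z.2.2.2 1)
      (N := fun z => nthMatrix z.2.2.2 2) hk (hM 1) (hM 2)
    have m3 := primrec_matrix_mul (M := fun z : τ => nthMatrix z.2.2.2 3) (N := fun z => U z.1)
      (hq.comp hx) (hM 3) hU'
    have m4 := primrec_matrix_mul (M := fun z : τ => A z.1) (N := fun z => nthMatrix z.2.2.2 4)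
      (hc.comp hx) hA' (hM 4)
    have m5 := primrec_matrix_mul (M := fun z : τ => nthMatrix z.2.2.2 3)
      (N := fun z i s => ∑ j ∈ Finset.range (c z.1), A z.1 i j * nthMatrix z.2.2.2 4 j s)
      (hq.comp hx) (hM 3) m4
    have m6 : Primrec fun y : τ × ℕ × ℕ =>
        y.1.2.2.1.1 * y.1.2.2.1.2 * nthMatrix y.1.2.2.2 5 y.2.1 y.2.2 :=
      primrec_int_mul.comp ((primrec_int_mul.comp hD hp).comp .fst) (hM 5)
    have m7 : Primrec fun y : τ × ℕ × ℕ => y.1.2.2.1.1 *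
        ((if y.2.1 = y.2.2 then 1 else 0) +
          y.1.2.2.1.2 * nthMatrix y.1.2.2.2 6 y.2.1 y.2.2) :=
      primrec_int_mul.comp (hD.comp .fst) (primrec_int_add.comp
          (Primrec.ite (Primrec.eq.comp (Primrec.fst.comp .snd) (Primrec.snd.comp .snd))
            (.const 1) (.const 0)) (primrec_int_mul.comp (hp.comp .fst) (hM 6)))
    have c1 := primrecPred_matrix_eq (M := fun z : τ => A z.1)
      (N := fun z i j => ∑ e ∈ Finset.range (u z.1), U z.1 i e * nthMatrix z.2.2.2 0 e j +
        ∑ t ∈ Finset.range z.2.1, nthMatrix z.2.2.2 1 i t * nthMatrix z.2.2.2 2 t j)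
      (hq.comp hx) (hc.comp hx) hA' (primrec_int_add.comp m1 m2)
    have c2 := primrecPred_matrix_eq
      (M := fun z : τ => fun t e => ∑ i ∈ Finset.range (q z.1),
        nthMatrix z.2.2.2 3 t i * U z.1 i e)
      (N := fun z t e => z.2.2.1.1 * z.2.2.1.2 * nthMatrix z.2.2.2 5 t e) hk (hu.comp hx) m3 m6
    have c3 := primrecPred_matrix_eq
      (M := fun z : τ => fun t s => ∑ i ∈ Finset.range (q z.1), nthMatrix z.2.2.2 3 t i *
        ∑ j ∈ Finset.range (c z.1), A z.1 i j * nthMatrix z.2.2.2 4 j s)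
      (N := fun z t s => z.2.2.1.1 *
        ((if t = s then 1 else 0) + z.2.2.1.2 * nthMatrix z.2.2.2 6 t s)) hk hk m5 m7
    exact h0.and (c1.and (c2.and c3))
  · rintro x k ⟨⟨D, p⟩, L⟩ ⟨⟨h1, h2⟩, h3, h4, h5⟩
    exact eq_factorRank ⟨_, _, _, h3⟩ ⟨D, p, _, _, _, _, h1, by dsimp only at h2; omega, h4, h5⟩
  · intro x
    obtain ⟨k, hk, ho⟩ := exists_factors_and_obstruction (q x) (c x) (u x) (A x) (U x)
    rw [← eq_factorRank hk ho]
    obtain ⟨C, X, Λ, h3⟩ := hk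
    obtain ⟨D, p, Ξ, η, Z₁, Z₂, h1, h2, h4, h5⟩ := ho
    refine ⟨((D, p), [blockList (u x) (c x) C, blockList (q x) k X, blockList k (c x) Λ,
      blockList k (q x) Ξ, blockList (c x) k η, blockList k (u x) Z₁, blockList k k Z₂]),
      ⟨h1, by dsimp only; omega⟩, fun i hi j hj => ?_, fun t ht e he => ?_, fun t ht s hs => ?_⟩
    · rw [h3 i hi j hj]
      congr 1
      · refine Finset.sum_congr rfl fun e he => ?_
        rw [nthMatrix, List.getD_cons_zero, getD_blockList C (Finset.mem_range.1 he) hj]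
      · refine Finset.sum_congr rfl fun t ht => ?_
        simp only [nthMatrix, List.getD_cons_zero, List.getD_cons_succ]
        rw [getD_blockList X hi (Finset.mem_range.1 ht),
          getD_blockList Λ (Finset.mem_range.1 ht) hj]
    · simp only [nthMatrix, List.getD_cons_zero, List.getD_cons_succ]
      rw [getD_blockList Z₁ ht he, ← h4 t ht e he]
      refine Finset.sum_congr rfl fun i hi => ?_
      rw [getD_blockList Ξ ht (Finset.mem_range.1 hi)]
    · simp only [nthMatrix, List.getD_cons_zero, List.getD_cons_succ]
      rw [getD_blockList Z₂ ht hs, ← h5 t ht s hs]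
      refine Finset.sum_congr rfl fun i hi => ?_
      rw [getD_blockList Ξ ht (Finset.mem_range.1 hi)]
      congr 1
      refine Finset.sum_congr rfl fun j hj => ?_
      rw [getD_blockList η (Finset.mem_range.1 hj) hs]

/-! ### Rank bounds from abelian images, and crossed homomorphisms -/

section Basic

variable {m n : ℕ}

theorem elt_mul (a b : Fin m → ℤ) (u v : FreeGroup (Fin n)) :
    elt a u * elt b v = elt (a + b) (u * v) := rfl

theorem elt_inv (a : Fin m → ℤ) (u : FreeGroup (Fin n)) : (elt a u)⁻¹ = elt (-a) u⁻¹ := rfl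

theorem elt_zero_one : (elt 0 1 : G m n) = 1 := rfl

theorem mem_lattice {K : Subgroup (G m n)} {a : Fin m → ℤ} : a ∈ lattice K ↔ elt a 1 ∈ K :=
  Iff.rfl

theorem mem_proj {K : Subgroup (G m n)} {u : FreeGroup (Fin n)} :
    u ∈ proj K ↔ ∃ a, elt a u ∈ K := by
  constructor
  · rintro ⟨⟨a, u⟩, h, rfl⟩
    exact ⟨Multiplicative.toAdd a, h⟩
  · rintro ⟨a, h⟩
    exact ⟨_, h, rfl⟩

/-- The vectors w are the images of a generating set of minimal size; this is how all lower bounds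
for ranks arise. -/
theorem exists_span_of_rank {K V : Type*} [Group K] [Group.FG K] [AddCommGroup V]
    (φ : K →* Multiplicative V) :
    ∃ w : Fin (Group.rank K) → V, ∀ x, (φ x).toAdd ∈ Submodule.span ℤ (Set.range w) := by
  obtain ⟨S, hS, hcl⟩ := Group.rank_spec K
  let e := S.equivFinOfCardEq hS
  refine ⟨fun i => (φ (e.symm i)).toAdd, fun x => ?_⟩
  have hx : x ∈ Subgroup.closure (S : Set K) := by rw [hcl]; trivial
  induction hx using Subgroup.closure_induction with
  | mem x hx => exact Submodule.subset_span ⟨e ⟨x, hx⟩, by simp⟩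
  | one => simp
  | mul x y _ _ hx hy => simpa using add_mem hx hy
  | inv x _ hx => simpa using hx

theorem card_le_of_linearIndependent_of_mem_span {ι κ V : Type*} [Fintype ι] [Fintype κ]
    [AddCommGroup V] {v : ι → V} {w : κ → V} (hv : LinearIndependent ℤ v)
    (h : ∀ i, v i ∈ Submodule.span ℤ (Set.range w)) : Fintype.card ι ≤ Fintype.card κ := by
  classical
  have h1 := linearIndependent_le_span_aux' v hv (Set.range w) (by rintro _ ⟨i, rfl⟩; exact h i)
  exact h1.trans (Fintype.card_range_le w)

/-- A crossed homomorphism on a free group can be prescribed on the free generators. -/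
theorem exists_crossedHom {α Q M : Type*} [MulAction (FreeGroup α) Q] [AddCommGroup M]
    (φ : α → Q → M) : ∃ θ : FreeGroup α → Q → M, θ 1 = 0 ∧
      (∀ u v c, θ (u * v) c = θ u c + θ v (u⁻¹ • c)) ∧ ∀ x, θ (FreeGroup.of x) = φ x := by
  -- A crossed homomorphism is the left component of a homomorphism to the semidirect product that
  -- is the identity on the right, and the free group maps freely to the latter.
  let F : FreeGroup α →* (Q → Multiplicative M) ⋊[mulAutArrow] FreeGroup α :=
    FreeGroup.lift fun x => ⟨fun c => Multiplicative.ofAdd (φ x c), FreeGroup.of x⟩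
  have hr : ∀ u, (F u).right = u := by
    have : SemidirectProduct.rightHom.comp F = MonoidHom.id _ := by
      ext x; simp [F]
    exact fun u => DFunLike.congr_fun this u
  refine ⟨fun u c => ((F u).left c).toAdd, ?_, fun u v c => ?_, fun x => ?_⟩
  · ext c; simp
  · simp only [map_mul, SemidirectProduct.mul_left, hr]
    rfl
  · ext c; simp [F]

end Basic

/-! ### Quotient graphs of a family of words and the subgroups read off from them -/

/-- Finitely many words: the `j`-th letter of the `i`-th word is `letter i j`, for `i < num` and
`j < len i`. -/
structure WordData where
  num : ℕ
  len : ℕ → ℕ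
  letter : ℕ → ℕ → ℕ × Bool

/-- The free generator with number `x`. -/
def gen (n x : ℕ) : FreeGroup (Fin n) := if h : x < n then FreeGroup.of ⟨x, h⟩ else 1

/-- The value of a letter. -/
def letterVal (n : ℕ) (l : ℕ × Bool) : FreeGroup (Fin n) := if l.2 then gen n l.1 else (gen n l.1)⁻¹

namespace WordData

variable (W : WordData)

/-- The value of the prefix of length `j` of the `i`-th word. -/
def pre (n i : ℕ) : ℕ → FreeGroup (Fin n)
  | 0 => 1
  | j + 1 => pre n i j * letterVal n (W.letter i j)

/-- The edge traversed by the `j`-th letter of the `i`-th word, when the vertices along the words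
are labelled by `f`. -/
def edge (f : ℕ → ℕ → ℕ) (i j : ℕ) : ℕ × ℕ × ℕ :=
  if (W.letter i j).2 then (f i j, (W.letter i j).1, f i (j + 1))
  else (f i (j + 1), (W.letter i j).1, f i j)

/-- The direction in which that edge is traversed. -/
def sgn (i j : ℕ) : ℤ := if (W.letter i j).2 then 1 else -1

/-- The vertices of the quotient graph. -/
def verts (f : ℕ → ℕ → ℕ) : Finset ℕ :=
  insert 0 ((Finset.range W.num).biUnion fun i => (Finset.range (W.len i + 1)).image (f i))

/-- The edges of the quotient graph. -/
def edges (f : ℕ → ℕ → ℕ) : Finset (ℕ × ℕ × ℕ) :=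
  (Finset.range W.num).biUnion fun i => (Finset.range (W.len i)).image (W.edge f i)

/-- All words are loops at the vertex `0`. -/
def Closed (f : ℕ → ℕ → ℕ) : Prop := ∀ i < W.num, f i 0 = 0 ∧ f i (W.len i) = 0

/-- Edges with the same letter have the same source if and only if they have the same target. -/
def Folded (f : ℕ → ℕ → ℕ) : Prop :=
  ∀ e ∈ W.edges f, ∀ e' ∈ W.edges f, e.2.1 = e'.2.1 → (e.1 = e'.1 ↔ e.2.2 = e'.2.2)

/-- The total length of the words, plus one. -/
def size : ℕ := 1 + ∑ i ∈ Finset.range W.num, W.len i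

/-- The subgroup generated by the elements `t^{a_i} w_i`. -/
def subgroup {m n : ℕ} (a : ℕ → Fin m → ℤ) : Subgroup (G m n) :=
  Subgroup.closure ((fun i => elt (a i) (W.pre n i (W.len i))) '' Set.Iio W.num)

variable {W}

theorem mem_edges {f : ℕ → ℕ → ℕ} {e : ℕ × ℕ × ℕ} :
    e ∈ W.edges f ↔ ∃ i < W.num, ∃ j < W.len i, W.edge f i j = e := by
  simp [edges]

theorem mem_verts {f : ℕ → ℕ → ℕ} {v : ℕ} :
    v ∈ W.verts f ↔ v = 0 ∨ ∃ i < W.num, ∃ j ≤ W.len i, f i j = v := by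
  simp [verts]

end WordData

/-- The tree grows one vertex and one edge at a time, with z v the product of the values along the
tree path from 0 to v. The last clause compares z with any other system of transports g: along tree
paths the two differ by elements of D. It bounds from above the subgroup generated by the non-tree
edges. -/
theorem exists_spanning_tree {Γ : Type*} [Group Γ] (E : Finset (ℕ × ℕ × ℕ)) (V : Finset ℕ)
    (γ : ℕ × ℕ × ℕ → Γ) (h0 : 0 ∈ V)
    (hconn : ∀ S ⊆ V, 0 ∈ S → S ≠ V → ∃ e ∈ E,
      (e.1 ∈ S ∧ e.2.2 ∈ V ∧ e.2.2 ∉ S) ∨ (e.2.2 ∈ S ∧ e.1 ∈ V ∧ e.1 ∉ S)) :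
    ∃ z : ℕ → Γ, z 0 = 1 ∧ ∃ T ⊆ E, T.card + 1 = V.card ∧
      (∀ e ∈ T, z e.1 * γ e * (z e.2.2)⁻¹ = 1) ∧
      ∀ (D : Subgroup Γ) (g : ℕ → Γ), g 0 = 1 → (∀ e ∈ E, g e.1 * γ e * (g e.2.2)⁻¹ ∈ D) →
        ∀ v ∈ V, z v * (g v)⁻¹ ∈ D := by
  have key : ∀ k, k < V.card → ∃ S ⊆ V, 0 ∈ S ∧ S.card = k + 1 ∧ ∃ z : ℕ → Γ, z 0 = 1 ∧
      ∃ T ⊆ E, T.card = k ∧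
      (∀ e ∈ T, e.1 ∈ S ∧ e.2.2 ∈ S ∧ z e.1 * γ e * (z e.2.2)⁻¹ = 1) ∧
      ∀ (D : Subgroup Γ) (g : ℕ → Γ), g 0 = 1 → (∀ e ∈ E, g e.1 * γ e * (g e.2.2)⁻¹ ∈ D) →
        ∀ v ∈ S, z v * (g v)⁻¹ ∈ D := by
    intro k
    induction k with
    | zero =>
      intro _
      refine ⟨{0}, by simpa using h0, by simp, by simp, 1, rfl, ∅, by simp, rfl, by simp, ?_⟩
      intro D g hg _ v hv
      rw [Finset.mem_singleton.1 hv, hg]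
      simp
    | succ k ih =>
      intro hk
      obtain ⟨S, hSV, h0S, hS, z, hz, T, hTE, hT, hzT, hD⟩ := ih (by omega)
      have step : ∀ (v : ℕ) (x : Γ) (e : ℕ × ℕ × ℕ), v ∈ V → v ∉ S → e ∈ E →
          ((e.1 ∈ S ∧ e.2.2 = v ∧ x = z e.1 * γ e) ∨
            (e.2.2 ∈ S ∧ e.1 = v ∧ x = z e.2.2 * (γ e)⁻¹)) →
          ∃ S ⊆ V, 0 ∈ S ∧ S.card = k + 1 + 1 ∧ ∃ z : ℕ → Γ, z 0 = 1 ∧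
            ∃ T ⊆ E, T.card = k + 1 ∧
            (∀ e ∈ T, e.1 ∈ S ∧ e.2.2 ∈ S ∧ z e.1 * γ e * (z e.2.2)⁻¹ = 1) ∧
            ∀ (D : Subgroup Γ) (g : ℕ → Γ), g 0 = 1 →
              (∀ e ∈ E, g e.1 * γ e * (g e.2.2)⁻¹ ∈ D) → ∀ v ∈ S, z v * (g v)⁻¹ ∈ D := by
        intro v x e hvV hvS he hx
        have hne : ∀ s ∈ S, Function.update z v x s = z s := fun s hs =>
          Function.update_of_ne (by rintro rfl; exact hvS hs) _ _
        have heT : e ∉ T := by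
          intro h
          rcases hx with ⟨-, h', -⟩ | ⟨-, h', -⟩
          · exact hvS (h' ▸ (hzT e h).2.1)
          · exact hvS (h' ▸ (hzT e h).1)
        refine ⟨insert v S, Finset.insert_subset hvV hSV, Finset.mem_insert_of_mem h0S,
          by rw [Finset.card_insert_of_notMem hvS, hS], Function.update z v x,
          by rw [hne 0 h0S, hz], insert e T, Finset.insert_subset he hTE,
          by rw [Finset.card_insert_of_notMem heT, hT], fun e' he' => ?_, fun D g hg hgE s hs => ?_⟩
        · rcases Finset.mem_insert.1 he' with rfl | he'
          · rcases hx with ⟨h1, h2, h3⟩ | ⟨h1, h2, h3⟩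
            · refine ⟨Finset.mem_insert_of_mem h1, by rw [h2]; exact Finset.mem_insert_self _ _, ?_⟩
              rw [hne _ h1, h2, Function.update_self, h3, mul_inv_cancel]
            · refine ⟨by rw [h2]; exact Finset.mem_insert_self _ _, Finset.mem_insert_of_mem h1, ?_⟩
              rw [hne _ h1, h2, Function.update_self, h3]
              group
          · obtain ⟨h1, h2, h3⟩ := hzT e' he'
            refine ⟨Finset.mem_insert_of_mem h1, Finset.mem_insert_of_mem h2, ?_⟩
            rw [hne _ h1, hne _ h2, h3]
        · rcases Finset.mem_insert.1 hs with rfl | hs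
          · rw [Function.update_self]
            have h5 := hgE e he
            rcases hx with ⟨h1, h2, h3⟩ | ⟨h1, h2, h3⟩
            · have h4 := mul_mem (hD D g hg hgE _ h1) h5
              rw [h2] at h4
              rw [h3]
              convert h4 using 1
              group
            · have h4 := mul_mem (hD D g hg hgE _ h1) (inv_mem h5)
              rw [h2] at h4
              rw [h3]
              convert h4 using 1
              group
          · rw [hne s hs]; exact hD D g hg hgE s hs
      obtain ⟨e, he, ⟨h1, h2, h3⟩ | ⟨h1, h2, h3⟩⟩ := hconn S hSV h0S (by rintro rfl; omega)
      · exact step e.2.2 _ e h2 h3 he (Or.inl ⟨h1, rfl, rfl⟩)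
      · exact step e.1 _ e h2 h3 he (Or.inr ⟨h1, rfl, rfl⟩)
  have hpos : 0 < V.card := Finset.card_pos.2 ⟨0, h0⟩
  obtain ⟨S, hSV, -, hS, z, hz, T, hTE, hT, hzT, hD⟩ := key (V.card - 1) (by omega)
  obtain rfl : S = V := Finset.eq_of_subset_of_card_le hSV (by omega)
  exact ⟨z, hz, T, hTE, by omega, fun e he => (hzT e he).2.2, hD⟩

namespace WordData

variable {W : WordData} {m n : ℕ}

/-- A word starts at 0, which lies in S, and reaches a vertex outside S, so one of its letters
crosses the boundary. This is the connectedness that the spanning tree needs. -/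
theorem exists_crossing_edge {f : ℕ → ℕ → ℕ} (hf : W.Closed f) (S : Finset ℕ) (hS : S ⊆ W.verts f)
    (h0 : 0 ∈ S) (hne : S ≠ W.verts f) : ∃ e ∈ W.edges f,
      (e.1 ∈ S ∧ e.2.2 ∈ W.verts f ∧ e.2.2 ∉ S) ∨ (e.2.2 ∈ S ∧ e.1 ∈ W.verts f ∧ e.1 ∉ S) := by
  obtain ⟨v, hv, hvS⟩ : ∃ v ∈ W.verts f, v ∉ S := by
    by_contra! h
    exact hne (Finset.Subset.antisymm hS h)
  rcases mem_verts.1 hv with rfl | ⟨i, hi, j, hj, rfl⟩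
  · exact absurd h0 hvS
  clear hv
  induction j with
  | zero => rw [(hf i hi).1] at hvS; exact absurd h0 hvS
  | succ j ih =>
    by_cases hjS : f i j ∈ S
    · have h1 : f i (j + 1) ∈ W.verts f := mem_verts.2 (Or.inr ⟨i, hi, j + 1, hj, rfl⟩)
      refine ⟨W.edge f i j, mem_edges.2 ⟨i, hi, j, by omega, rfl⟩, ?_⟩
      unfold edge
      split_ifs
      · exact Or.inl ⟨hjS, h1, hvS⟩
      · exact Or.inr ⟨hjS, h1, hvS⟩
    · exact ih (by omega) hjS

/-- If vertices carry elements `z` and every edge, transported to the base point, lies in `K`, then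
so do the words. -/
theorem prefix_mem {f : ℕ → ℕ → ℕ} {i : ℕ} (hi : i < W.num) (hf : f i 0 = 0)
    (C : ℕ × ℕ × ℕ → Fin m → ℤ) (z : ℕ → G m n) (hz : z 0 = 1) (K : Subgroup (G m n))
    (hK : ∀ e ∈ W.edges f, z e.1 * elt (C e) (gen n e.2.1) * (z e.2.2)⁻¹ ∈ K) (j : ℕ)
    (hj : j ≤ W.len i) :
    elt (∑ k ∈ Finset.range j, W.sgn i k • C (W.edge f i k)) (W.pre n i j) * (z (f i j))⁻¹ ∈ K := by
  induction j with
  | zero => simp [hf, hz, pre, elt_zero_one]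
  | succ j ih =>
    have h1 := ih (by omega)
    have h2 := hK (W.edge f i j) (mem_edges.2 ⟨i, hi, j, by omega, rfl⟩)
    rw [Finset.sum_range_succ, pre, ← elt_mul]
    by_cases hl : (W.letter i j).2 = true
    · have h3 := mul_mem h1 h2
      simp only [edge, hl, if_true, sgn, letterVal, one_smul] at h3 ⊢
      convert h3 using 1
      group
    · have h3 := mul_mem h1 (inv_mem h2)
      simp only [edge, hl, sgn, letterVal, Bool.false_eq_true, if_false, neg_smul, one_smul,
        ← elt_inv] at h3 ⊢
      convert h3 using 1
      group

/-- The subgroup read off from a labelled quotient graph contains the words, and has at most as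
many generators as its graph has independent cycles, plus those of the lattice. -/
theorem exists_generators_of_labelling {f : ℕ → ℕ → ℕ} (hf : W.Closed f)
    (C : ℕ × ℕ × ℕ → Fin m → ℤ) {l : ℕ} (Λ : Fin l → Fin m → ℤ) (a : ℕ → Fin m → ℤ)
    (h : ∀ i < W.num, a i - ∑ j ∈ Finset.range (W.len i), W.sgn i j • C (W.edge f i j) ∈
      Submodule.span ℤ (Set.range Λ)) :
    ∃ S : Finset (G m n), S.card + (W.verts f).card ≤ (W.edges f).card + 1 + l ∧
      W.subgroup a ≤ Subgroup.closure (S : Set (G m n)) ∧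
      ∀ (D : Subgroup (G m n)) (g : ℕ → G m n), g 0 = 1 →
        (∀ e ∈ W.edges f, g e.1 * elt (C e) (gen n e.2.1) * (g e.2.2)⁻¹ ∈ D) →
        (∀ t, elt (Λ t) 1 ∈ D) → Subgroup.closure (S : Set (G m n)) ≤ D := by
  classical
  obtain ⟨z, hz, T, hTE, hT, hzT, hD⟩ := exists_spanning_tree (W.edges f) (W.verts f)
    (fun e => (elt (C e) (gen n e.2.1) : G m n)) (mem_verts.2 (Or.inl rfl))
    (fun S h1 h2 h3 => exists_crossing_edge hf S h1 h2 h3)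
  let y : ℕ × ℕ × ℕ → G m n := fun e => z e.1 * elt (C e) (gen n e.2.1) * (z e.2.2)⁻¹
  -- One generator for each edge outside the tree, of which there are |E| - |V| + 1, and one for
  -- each generator of the lattice.
  let S : Finset (G m n) := (W.edges f \ T).image y ∪ Finset.univ.image fun t => elt (Λ t) 1
  have hy : ∀ e ∈ W.edges f, y e ∈ Subgroup.closure (S : Set (G m n)) := by
    intro e he
    by_cases heT : e ∈ T
    · simp only [y, hzT e heT]; exact one_mem _
    · refine Subgroup.subset_closure ?_
      simp only [S, Finset.coe_union, Finset.coe_image]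
      exact Or.inl ⟨e, by simpa using ⟨he, heT⟩, rfl⟩
  have hΛ : ∀ b ∈ Submodule.span ℤ (Set.range Λ),
      (elt b 1 : G m n) ∈ Subgroup.closure (S : Set (G m n)) := by
    intro b hb
    have : Submodule.span ℤ (Set.range Λ) ≤ lattice (Subgroup.closure (S : Set (G m n))) := by
      rw [Submodule.span_le]
      rintro _ ⟨t, rfl⟩
      refine Subgroup.subset_closure ?_
      simp only [S, Finset.coe_union, Finset.coe_image]
      exact Or.inr ⟨t, by simp, rfl⟩
    exact this hb
  refine ⟨S, ?_, ?_, fun D g hg hgE hgΛ => ?_⟩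
  · have h1 : ((W.edges f \ T).image y).card ≤ (W.edges f).card - T.card :=
      Finset.card_image_le.trans (Finset.card_sdiff_of_subset hTE).le
    have h2 : (Finset.univ.image fun t => (elt (Λ t) 1 : G m n)).card ≤ l :=
      Finset.card_image_le.trans (by simp)
    have h3 := Finset.card_union_le ((W.edges f \ T).image y)
      (Finset.univ.image fun t => (elt (Λ t) 1 : G m n))
    have h4 := Finset.card_le_card hTE
    change S.card ≤ _ at h3
    omega
  · rw [subgroup, Subgroup.closure_le]
    rintro _ ⟨i, hi, rfl⟩
    have h1 := prefix_mem hi (hf i hi).1 C z hz _ hy (W.len i) le_rfl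
    rw [(hf i hi).2, hz, inv_one, mul_one] at h1
    have h2 := mul_mem (hΛ _ (h i hi)) h1
    rwa [elt_mul, sub_add_cancel, one_mul] at h2
  · rw [Subgroup.closure_le]
    intro x hx
    simp only [S, Finset.coe_union, Finset.coe_image] at hx
    rcases hx with ⟨e, he, rfl⟩ | ⟨t, -, rfl⟩
    · have he' : e ∈ W.edges f := by simp at he; exact he.1
      have hv : e.1 ∈ W.verts f ∧ e.2.2 ∈ W.verts f := by
        obtain ⟨i, hi, j, hj, rfl⟩ := mem_edges.1 he'
        have h1 : f i j ∈ W.verts f := mem_verts.2 (Or.inr ⟨i, hi, j, hj.le, rfl⟩)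
        have h2 : f i (j + 1) ∈ W.verts f := mem_verts.2 (Or.inr ⟨i, hi, j + 1, hj, rfl⟩)
        unfold edge
        split_ifs
        · exact ⟨h1, h2⟩
        · exact ⟨h2, h1⟩
      have h1 := hD D g hg hgE e.1 hv.1
      have h2 := hD D g hg hgE e.2.2 hv.2
      have h3 := mul_mem (mul_mem h1 (hgE e he')) (inv_mem h2)
      change z e.1 * elt (C e) (gen n e.2.1) * (z e.2.2)⁻¹ ∈ D
      convert h3 using 1
      group
    · exact hgΛ t

end WordData

/-! ### Labellings by cosets and by permutation actions -/

namespace WordData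

variable {W : WordData} {m n : ℕ}

/-- The vertices visited when the words act on a set, starting from the point `o`. -/
def orbitPoint (W : WordData) (n : ℕ) {Q : Type*} [MulAction (FreeGroup (Fin n)) Q] (o : Q)
    (i j : ℕ) : Q := (W.pre n i j)⁻¹ • o

section Action

variable {Q : Type*} [MulAction (FreeGroup (Fin n)) Q] (o : Q)

theorem orbitPoint_zero (i : ℕ) : W.orbitPoint n o i 0 = o := by simp [orbitPoint, pre]

theorem orbitPoint_succ (i j : ℕ) :
    W.orbitPoint n o i (j + 1) = (letterVal n (W.letter i j))⁻¹ • W.orbitPoint n o i j := by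
  simp [orbitPoint, pre, mul_smul]

/-- The vector θ u c records the signed edges traversed when u is read from c; reading u leads from
c to u⁻¹ • c, which is the cocycle rule. The numbering ι need not be injective. -/
theorem exists_edge_crossedHom (ι : Q → ℕ) :
    ∃ θ : FreeGroup (Fin n) → Q → (ℕ × ℕ × ℕ → ℤ), θ 1 = 0 ∧
      (∀ u v c, θ (u * v) c = θ u c + θ v (u⁻¹ • c)) ∧
      ∀ x < n, ∀ c, θ (gen n x) c = Pi.single (ι c, x, ι ((gen n x)⁻¹ • c)) 1 := by
  obtain ⟨θ, h1, h2, h3⟩ := exists_crossedHom (α := Fin n) (Q := Q) (M := ℕ × ℕ × ℕ → ℤ)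
    fun x c => Pi.single (ι c, (x : ℕ), ι ((FreeGroup.of x)⁻¹ • c)) 1
  exact ⟨θ, h1, h2, fun x hx c => by simp [gen, hx, h3]⟩

theorem crossedHom_inv {M : Type*} [AddCommGroup M] {θ : FreeGroup (Fin n) → Q → M}
    (h1 : θ 1 = 0) (h2 : ∀ u v c, θ (u * v) c = θ u c + θ v (u⁻¹ • c))
    (u : FreeGroup (Fin n)) (c : Q) : θ u⁻¹ c = -θ u (u • c) := by
  have := h2 u⁻¹ u c
  rw [inv_mul_cancel, h1, inv_inv] at this
  rw [eq_neg_iff_add_eq_zero, ← this]; rfl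

theorem crossedHom_pre {ι : Q → ℕ} {θ : FreeGroup (Fin n) → Q → (ℕ × ℕ × ℕ → ℤ)}
    (h1 : θ 1 = 0) (h2 : ∀ u v c, θ (u * v) c = θ u c + θ v (u⁻¹ • c))
    (h3 : ∀ x < n, ∀ c, θ (gen n x) c = Pi.single (ι c, x, ι ((gen n x)⁻¹ • c)) 1)
    {f : ℕ → ℕ → ℕ} {i : ℕ} (hf : ∀ j ≤ W.len i, f i j = ι (W.orbitPoint n o i j))
    (hlet : ∀ j < W.len i, (W.letter i j).1 < n) (j : ℕ) (hj : j ≤ W.len i) :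
    θ (W.pre n i j) o =
      ∑ k ∈ Finset.range j, W.sgn i k • (Pi.single (W.edge f i k) 1 : ℕ × ℕ × ℕ → ℤ) := by
  induction j with
  | zero => simp [pre, h1]
  | succ j ih =>
    rw [pre, h2, ih (by omega), Finset.sum_range_succ]
    congr 1
    change θ _ (W.orbitPoint n o i j) = _
    have hs := orbitPoint_succ (W := W) (n := n) o i j
    have hx := hlet j hj
    by_cases hl : (W.letter i j).2 = true
    · simp only [letterVal, hl, if_true] at hs ⊢
      rw [h3 _ hx, ← hs, ← hf j (by omega), ← hf (j + 1) hj]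
      simp [sgn, edge, hl]
    · simp only [letterVal, hl, Bool.false_eq_true, if_false, inv_inv] at hs ⊢
      rw [crossedHom_inv h1 h2, h3 _ hx, inv_smul_smul, ← hs, ← hf j (by omega), ← hf (j + 1) hj]
      simp [sgn, edge, hl]

/-- Exponent sums on the edges of a covering, together with the abelian part, define a
homomorphism on subgroups that fix the base point. -/
theorem exists_edge_hom {θ : FreeGroup (Fin n) → Q → (ℕ × ℕ × ℕ → ℤ)}
    (h1 : θ 1 = 0) (h2 : ∀ u v c, θ (u * v) c = θ u c + θ v (u⁻¹ • c)) (K : Subgroup (G m n))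
    (hK : ∀ x ∈ K, x.2 • o = o) :
    ∃ Φ : K →* Multiplicative ((ℕ × ℕ × ℕ → ℤ) × (Fin m → ℤ)),
      ∀ a u (h : elt a u ∈ K), (Φ ⟨elt a u, h⟩).toAdd = (θ u o, a) := by
  refine ⟨{ toFun := fun x => Multiplicative.ofAdd (θ x.1.2 o, x.1.1.toAdd)
            map_one' := ?_
            map_mul' := fun x y => ?_ }, fun a u h => rfl⟩
  · simp [h1]
  · have : x.1.2⁻¹ • o = o := by rw [inv_smul_eq_iff, hK x.1 x.2]
    simp only [Subgroup.coe_mul, Prod.snd_mul, Prod.fst_mul, h2, this, toAdd_mul]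
    rfl

end Action

theorem exists_injOn_nat {Q : Type*} (s : Finset Q) (o : Q) (ho : o ∈ s) :
    ∃ ι : Q → ℕ, ι o = 0 ∧ Set.InjOn ι s ∧ ∀ c ∈ s, ι c < s.card := by
  classical
  have hpos : 0 < s.card := Finset.card_pos.2 ⟨o, ho⟩
  -- The transposition makes the base point receive the number 0.
  let σ := Equiv.swap (s.equivFin ⟨o, ho⟩) ⟨0, hpos⟩
  refine ⟨fun c => if h : c ∈ s then σ (s.equivFin ⟨c, h⟩) else 0, ?_, ?_, ?_⟩
  · simp [ho, σ]
  · intro c hc d hd h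
    have hc' : c ∈ s := hc
    have hd' : d ∈ s := hd
    simp only [hc', hd', dif_pos] at h
    simpa using σ.injective (Fin.ext h)
  · intro c hc
    simp [hc]

theorem elt_mem_subgroup {a : ℕ → Fin m → ℤ} {i : ℕ} (hi : i < W.num) :
    elt (a i) (W.pre n i (W.len i)) ∈ W.subgroup (n := n) a :=
  Subgroup.subset_closure ⟨i, hi, rfl⟩

/-- The exponent sums on the edges and the abelian part of the `i`-th element. -/
def edgeVector (W : WordData) (f : ℕ → ℕ → ℕ) (a : ℕ → Fin m → ℤ) (i : ℕ) :
    (ℕ × ℕ × ℕ → ℤ) × (Fin m → ℤ) :=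
  (∑ k ∈ Finset.range (W.len i), W.sgn i k • Pi.single (W.edge f i k) 1, a i)

/-- The labelling of the words by the cosets of the free part of `K`. -/
theorem exists_coset_labelling (hlet : ∀ i < W.num, ∀ j < W.len i, (W.letter i j).1 < n)
    (a : ℕ → Fin m → ℤ) (K : Subgroup (G m n)) (hK : W.subgroup a ≤ K) :
    ∃ (f : ℕ → ℕ → ℕ) (C : ℕ × ℕ × ℕ → Fin m → ℤ) (g : ℕ → FreeGroup (Fin n)),
      W.Closed f ∧ W.Folded f ∧ (∀ i < W.num, ∀ j ≤ W.len i, f i j < W.size) ∧ g 0 = 1 ∧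
      (∀ e ∈ W.edges f, elt (C e) (g e.1 * gen n e.2.1 * (g e.2.2)⁻¹) ∈ K) ∧
      (∀ i < W.num, a i - ∑ j ∈ Finset.range (W.len i), W.sgn i j • C (W.edge f i j) ∈
        lattice K) ∧
      ∃ Φ : K →* Multiplicative ((ℕ × ℕ × ℕ → ℤ) × (Fin m → ℤ)),
        (∀ i (hi : i < W.num), (Φ ⟨_, hK (elt_mem_subgroup hi)⟩).toAdd = W.edgeVector f a i) ∧
        ∀ (k : ℕ) (w : Fin k → (ℕ × ℕ × ℕ → ℤ) × (Fin m → ℤ)),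
          (∀ x, (Φ x).toAdd ∈ Submodule.span ℤ (Set.range w)) →
          (W.edges f).card + 1 + Module.finrank ℤ (lattice K) ≤ k + (W.verts f).card := by
  classical
  let Q := FreeGroup (Fin n) ⧸ proj K
  let o : Q := ((1 : FreeGroup (Fin n)) : Q)
  let κ := W.orbitPoint n o
  have hstab : ∀ u : FreeGroup (Fin n), u • o = o ↔ u ∈ proj K := by
    intro u
    change ((u * 1 : FreeGroup (Fin n)) : Q) = ((1 : FreeGroup (Fin n)) : Q) ↔ _
    rw [mul_one, eq_comm, QuotientGroup.eq]
    simp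
  -- The position 0 of every word is the base coset, so there is at most one further coset for each
  -- letter: at most `size` in all.
  let vis : Finset Q := insert o ((Finset.range W.num).biUnion fun i =>
    (Finset.range (W.len i)).image fun j => κ i (j + 1))
  have hvis : ∀ i < W.num, ∀ j ≤ W.len i, κ i j ∈ vis := by
    intro i hi j hj
    cases j with
    | zero => exact Finset.mem_insert.2 (Or.inl (orbitPoint_zero o i))
    | succ j =>
      refine Finset.mem_insert_of_mem (Finset.mem_biUnion.2 ⟨i, Finset.mem_range.2 hi, ?_⟩)
      exact Finset.mem_image.2 ⟨j, Finset.mem_range.2 hj, rfl⟩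
  have hcard : vis.card ≤ W.size := by
    refine (Finset.card_insert_le _ _).trans ?_
    rw [size, add_comm]
    refine Nat.add_le_add_left (Finset.card_biUnion_le.trans ?_) _
    exact Finset.sum_le_sum fun i _ => Finset.card_image_le.trans (by simp)
  obtain ⟨ι, hι0, hιinj, hιlt⟩ := exists_injOn_nat vis o (Finset.mem_insert_self _ _)
  let f : ℕ → ℕ → ℕ := fun i j => ι (κ i j)
  have hlen : ∀ i < W.num, κ i (W.len i) = o := by
    intro i hi
    change (W.pre n i (W.len i))⁻¹ • o = o
    rw [inv_smul_eq_iff, eq_comm, hstab]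
    exact mem_proj.2 ⟨_, hK (elt_mem_subgroup hi)⟩
  have hclosed : W.Closed f := fun i hi =>
    ⟨(congrArg ι (orbitPoint_zero o i)).trans hι0, (congrArg ι (hlen i hi)).trans hι0⟩
  have hedge : ∀ e ∈ W.edges f, e.2.1 < n ∧ ∃ c, (∃ i < W.num, ∃ j ≤ W.len i, c = κ i j) ∧
      (∃ i < W.num, ∃ j ≤ W.len i, (gen n e.2.1)⁻¹ • c = κ i j) ∧
      e.1 = ι c ∧ e.2.2 = ι ((gen n e.2.1)⁻¹ • c) := by
    intro e he
    obtain ⟨i, hi, j, hj, rfl⟩ := mem_edges.1 he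
    have hs := orbitPoint_succ (W := W) (n := n) o i j
    have hx := hlet i hi j hj
    by_cases hl : (W.letter i j).2 = true
    · simp only [letterVal, hl, if_true] at hs
      simp only [edge, hl, if_true]
      exact ⟨hx, κ i j, ⟨i, hi, j, hj.le, rfl⟩, ⟨i, hi, j + 1, hj, hs.symm⟩, rfl,
        congrArg ι hs⟩
    · simp only [letterVal, hl, Bool.false_eq_true, if_false, inv_inv] at hs
      simp only [edge, hl, Bool.false_eq_true, if_false]
      have hs' : (gen n (W.letter i j).1)⁻¹ • κ i (j + 1) = κ i j := by
        rw [inv_smul_eq_iff]; exact hs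
      exact ⟨hx, κ i (j + 1), ⟨i, hi, j + 1, hj, rfl⟩, ⟨i, hi, j, hj.le, hs'⟩, rfl,
        congrArg ι hs'.symm⟩
  have hinj : ∀ c d, (∃ i < W.num, ∃ j ≤ W.len i, c = κ i j) →
      (∃ i < W.num, ∃ j ≤ W.len i, d = κ i j) → ι c = ι d → c = d := by
    rintro _ _ ⟨i, hi, j, hj, rfl⟩ ⟨i', hi', j', hj', rfl⟩ h
    exact hιinj (hvis i hi j hj) (hvis i' hi' j' hj') h
  have hfold : W.Folded f := by
    intro e he e' he' hxx
    obtain ⟨-, c, hc, hc', h1, h2⟩ := hedge e he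
    obtain ⟨-, d, hd, hd', h1', h2'⟩ := hedge e' he'
    rw [← hxx] at h2' hd'
    constructor
    · intro h
      rw [h2, h2', hinj c d hc hd (by rw [← h1, ← h1', h])]
    · intro h
      have := hinj _ _ hc' hd' (by rw [← h2, ← h2', h])
      rw [h1, h1', smul_left_cancel _ this]
  -- Coset representatives: the prefix of some word that reaches the vertex v, trivial at the base
  -- vertex and, by default, at numbers that are not vertices.
  have hg : ∀ v : ℕ, ∃ γ : FreeGroup (Fin n), (v = 0 → γ = 1) ∧
      ∀ i < W.num, ∀ j ≤ W.len i, ι (κ i j) = v → γ⁻¹ • o = κ i j := by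
    intro v
    by_cases h0 : v = 0
    · refine ⟨1, fun _ => rfl, fun i hi j hj h => ?_⟩
      rw [inv_one, one_smul]
      exact hιinj (Finset.mem_insert_self _ _) (hvis i hi j hj) (by rw [hι0, h, h0])
    · by_cases hex : ∃ i < W.num, ∃ j ≤ W.len i, ι (κ i j) = v
      · obtain ⟨i, hi, j, hj, h⟩ := hex
        refine ⟨W.pre n i j, fun h => absurd h h0, fun i' hi' j' hj' h' => ?_⟩
        exact hιinj (hvis i hi j hj) (hvis i' hi' j' hj') (h.trans h'.symm)
      · exact ⟨1, fun _ => rfl, fun i hi j hj h => absurd ⟨i, hi, j, hj, h⟩ hex⟩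
  choose g hg0 hg using hg
  have hg' : ∀ c, (∃ i < W.num, ∃ j ≤ W.len i, c = κ i j) → (g (ι c))⁻¹ • o = c := by
    rintro _ ⟨i, hi, j, hj, rfl⟩
    exact hg _ i hi j hj rfl
  have hC : ∀ e : ℕ × ℕ × ℕ, ∃ c : Fin m → ℤ, e ∈ W.edges f →
      elt c (g e.1 * gen n e.2.1 * (g e.2.2)⁻¹) ∈ K := by
    intro e
    by_cases he : e ∈ W.edges f
    · obtain ⟨-, c, hc, hc', h1, h2⟩ := hedge e he
      have h3 := hg' c hc
      have h4 := hg' _ hc'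
      rw [← h1] at h3
      rw [← h2] at h4
      obtain ⟨b, hb⟩ : g e.1 * gen n e.2.1 * (g e.2.2)⁻¹ ∈ proj K := by
        rw [← hstab, mul_smul, mul_smul, h4, smul_inv_smul, ← h3, smul_inv_smul]
      exact ⟨b.1.toAdd, fun _ => hb.2 ▸ hb.1⟩
    · exact ⟨0, fun h => absurd h he⟩
  choose C hC using hC
  refine ⟨f, C, g, hclosed, hfold, fun i hi j hj => (hιlt _ (hvis i hi j hj)).trans_le hcard,
    hg0 0 rfl, hC, fun i hi => ?_, ?_⟩
  · have h1 := prefix_mem hi (hclosed i hi).1 C (fun v => (elt 0 (g v) : G m n))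
      (by simp [hg0 0 rfl, elt_zero_one]) K (fun e he => by
        rw [elt_inv, elt_mul, elt_mul]; simpa using hC e he) (W.len i) le_rfl
    rw [(hclosed i hi).2, hg0 0 rfl, elt_zero_one, inv_one, mul_one] at h1
    have h2 := mul_mem (hK (elt_mem_subgroup hi)) (inv_mem h1)
    rw [elt_inv, elt_mul, mul_inv_cancel, ← sub_eq_add_neg] at h2
    exact h2
  · obtain ⟨θ, h1, h2, h3⟩ := exists_edge_crossedHom (n := n) ι
    obtain ⟨Φ, hΦ⟩ := exists_edge_hom (m := m) o h1 h2 K fun x hx =>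
      (hstab _).2 (mem_proj.2 ⟨x.1.toAdd, hx⟩)
    refine ⟨Φ, fun i hi => ?_, fun k w hw => ?_⟩
    · rw [hΦ, crossedHom_pre (W := W) o h1 h2 h3 (f := f) (fun j _ => rfl) (hlet i hi) _ le_rfl]
      rfl
    · let b := Module.finBasis ℤ (lattice K)
      -- The vectors (δ_e, C_e), for edges e, and (0, b_t), for a basis b of the lattice, are
      -- independent. They lie in the span of the image of Φ and the |V| - 1 vectors (θ(g v) o, 0)
      -- with v ≠ 0; at v = 0 this vector vanishes. Counting gives the inequality.
      let V₀ := (W.verts f).erase 0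
      let w' : Fin k ⊕ V₀ → (ℕ × ℕ × ℕ → ℤ) × (Fin m → ℤ) :=
        Sum.elim w fun v => (θ (g v) o, 0)
      let v : W.edges f ⊕ Fin (Module.finrank ℤ (lattice K)) →
          (ℕ × ℕ × ℕ → ℤ) × (Fin m → ℤ) :=
        Sum.elim (fun e => (Pi.single e.1 1, C e.1)) fun t => (0, (b t : Fin m → ℤ))
      have hspan : ∀ p ∈ Submodule.span ℤ (Set.range w),
          p ∈ Submodule.span ℤ (Set.range w') := by
        refine fun p hp => Submodule.span_mono ?_ hp
        rintro _ ⟨t, rfl⟩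
        exact ⟨Sum.inl t, rfl⟩
      have hθg : ∀ v ∈ W.verts f,
          ((θ (g v) o, 0) : (ℕ × ℕ × ℕ → ℤ) × (Fin m → ℤ)) ∈
            Submodule.span ℤ (Set.range w') := by
        intro v hv
        by_cases h0 : v = 0
        · rw [h0, hg0 0 rfl, h1]; exact zero_mem _
        · exact Submodule.subset_span ⟨Sum.inr ⟨v, Finset.mem_erase.2 ⟨h0, hv⟩⟩, rfl⟩
      have hlin : LinearIndependent ℤ v := by
        rw [Fintype.linearIndependent_iff]
        intro c hc
        rw [Fintype.sum_sum_type] at hc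
        have hc1 : ∀ e, c (Sum.inl e) = 0 := by
          intro e
          have := congrFun (congrArg Prod.fst hc) e.1
          simp only [v, Sum.elim_inl, Sum.elim_inr, Prod.fst_add, Prod.fst_sum, Prod.smul_fst,
            smul_zero, Finset.sum_const_zero, add_zero, Finset.sum_apply, Pi.smul_apply,
            smul_eq_mul, Prod.fst_zero, Pi.zero_apply] at this
          rw [Finset.sum_eq_single e] at this
          · simpa using this
          · intro e' _ hne
            rw [Pi.single_eq_of_ne (fun h => hne (Subtype.ext h.symm)), mul_zero]
          · simp
        have hc2 : ∀ t, c (Sum.inr t) = 0 := by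
          have := congrArg Prod.snd hc
          simp only [hc1, zero_smul, Finset.sum_const_zero, zero_add, v, Sum.elim_inr,
            Prod.snd_sum, Prod.smul_snd, Prod.snd_zero] at this
          refine Fintype.linearIndependent_iff.1 b.linearIndependent _ (Subtype.ext ?_)
          simpa using this
        rintro (e | t)
        · exact hc1 e
        · exact hc2 t
      have hmem : ∀ i, v i ∈ Submodule.span ℤ (Set.range w') := by
        rintro (⟨e, he⟩ | t)
        · have h5 := hspan _ (hw ⟨_, hC e he⟩)
          obtain ⟨hx, c, hc, hc', hs, ht⟩ := hedge e he
          have hgs := hg' c hc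
          have hgt := hg' _ hc'
          rw [← hs] at hgs
          rw [← ht] at hgt
          -- The loop that runs to the source of e, across e and back from its target counts e once,
          -- up to the contributions of the two representatives.
          have hval : θ (g e.1 * gen n e.2.1 * (g e.2.2)⁻¹) o =
              θ (g e.1) o + Pi.single e 1 - θ (g e.2.2) o := by
            rw [h2, h2, hgs, h3 _ hx, crossedHom_inv h1 h2, mul_inv_rev, mul_smul, hgs, ← hgt,
              smul_inv_smul, hgt, ← hs, ← ht]
            exact (sub_eq_add_neg _ _).symm
          rw [hΦ, hval] at h5
          have hv : e.1 ∈ W.verts f ∧ e.2.2 ∈ W.verts f := by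
            obtain ⟨i, hi, j, hj, rfl⟩ := hc
            obtain ⟨i', hi', j', hj', h'⟩ := hc'
            rw [hs, ht, h']
            exact ⟨mem_verts.2 (Or.inr ⟨i, hi, j, hj, rfl⟩),
              mem_verts.2 (Or.inr ⟨i', hi', j', hj', rfl⟩)⟩
          have h6 := add_mem (sub_mem h5 (hθg _ hv.1)) (hθg _ hv.2)
          convert h6 using 1
          ext1
          · simp only [v, Sum.elim_inl, Prod.fst_add, Prod.fst_sub]
            abel
          · simp [v]
        · have h5 := hspan _ (hw ⟨elt (b t : Fin m → ℤ) 1, mem_lattice.1 (b t).2⟩)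
          rw [hΦ, h1] at h5
          exact h5
      have h6 := card_le_of_linearIndependent_of_mem_span hlin hmem
      have h7 : V₀.card + 1 = (W.verts f).card :=
        Finset.card_erase_add_one (mem_verts.2 (Or.inl rfl))
      simp only [Fintype.card_sum, Fintype.card_coe, Fintype.card_fin] at h6
      omega

/-- A folded labelling extends to an action of the free group on a finite set. -/
theorem Folded.exists_action {f : ℕ → ℕ → ℕ} (hfold : W.Folded f)
    (hlt : ∀ i < W.num, ∀ j ≤ W.len i, f i j < W.size) :
    ∃ ρ : FreeGroup (Fin n) →* Equiv.Perm (Fin W.size), ∀ e ∈ W.edges f, e.2.1 < n →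
      ∀ s t : Fin W.size, (s : ℕ) = e.1 → (t : ℕ) = e.2.2 → ρ (gen n e.2.1) t = s := by
  classical
  have hE : ∀ e ∈ W.edges f, e.1 < W.size ∧ e.2.2 < W.size := by
    intro e he
    obtain ⟨i, hi, j, hj, rfl⟩ := mem_edges.1 he
    have h1 := hlt i hi j hj.le
    have h2 := hlt i hi (j + 1) hj
    unfold edge
    split_ifs
    · exact ⟨h1, h2⟩
    · exact ⟨h2, h1⟩
  have hx : ∀ x : ℕ, ∃ σ : Equiv.Perm (Fin W.size), ∀ e ∈ W.edges f, e.2.1 = x →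
      ∀ s t : Fin W.size, (s : ℕ) = e.1 → (t : ℕ) = e.2.2 → σ t = s := by
    intro x
    -- The generator x moves the target of an x-edge to its source. Foldedness makes this a
    -- well-defined injective partial map, and an injective partial self-map of a finite set extends
    -- to a permutation.
    let T : Set (Fin W.size) := {t | ∃ s : Fin W.size, ((s : ℕ), x, (t : ℕ)) ∈ W.edges f}
    let φ : Fin W.size → Fin W.size := fun t => if h : t ∈ T then h.choose else t
    have hφ : ∀ t ∈ T, ((φ t : ℕ), x, (t : ℕ)) ∈ W.edges f := by
      intro t ht
      simp only [φ, ht, dif_pos]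
      exact ht.choose_spec
    have hinj : Set.InjOn φ T := by
      intro t ht t' ht' h
      exact Fin.ext ((hfold _ (hφ t ht) _ (hφ t' ht') rfl).1 (congrArg Fin.val h))
    obtain ⟨σ, hσ⟩ := Set.MapsTo.exists_equiv_extend_of_card_eq (t := Finset.univ)
      (by simp) (s := T) (f := φ) (fun _ _ => by simp) hinj
    refine ⟨σ.trans (Equiv.subtypeUnivEquiv (by simp)), ?_⟩
    rintro ⟨s', x', t'⟩ he rfl s t hs ht
    have htT : t ∈ T := ⟨s, by simpa [hs, ht] using he⟩
    have h1 := hσ t htT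
    change ((σ t : _) : Fin W.size) = s
    rw [h1]
    refine Fin.ext ?_
    rw [hs]
    exact (hfold _ (hφ t htT) _ he rfl).2 ht
  choose σ hσ using hx
  refine ⟨FreeGroup.lift fun x => σ x, fun e he hxn s t hs ht => ?_⟩
  simp only [gen, hxn, dif_pos, FreeGroup.lift_apply_of]
  exact hσ _ e he rfl s t hs ht

/-- The vectors of a closed folded labelling span a lattice of rank at most the rank of the
subgroup. -/
theorem Folded.exists_span {f : ℕ → ℕ → ℕ} (hfold : W.Folded f) (hclosed : W.Closed f)
    (hlt : ∀ i < W.num, ∀ j ≤ W.len i, f i j < W.size)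
    (hlet : ∀ i < W.num, ∀ j < W.len i, (W.letter i j).1 < n) (a : ℕ → Fin m → ℤ)
    [Group.FG (W.subgroup (n := n) a)] :
    ∃ w : Fin (Group.rank (W.subgroup (n := n) a)) → (ℕ × ℕ × ℕ → ℤ) × (Fin m → ℤ),
      ∀ i < W.num, W.edgeVector f a i ∈ Submodule.span ℤ (Set.range w) := by
  obtain ⟨ρ, hρ⟩ := Folded.exists_action (n := n) hfold hlt
  let _ : MulAction (FreeGroup (Fin n)) (Fin W.size) := MulAction.compHom (Fin W.size) ρ
  have hsmul : ∀ u (c : Fin W.size), u • c = ρ u c := fun _ _ => rfl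
  let o : Fin W.size := ⟨0, by unfold size; omega⟩
  -- The labels of each word are the trajectory of the point 0 under the action. As the labelling is
  -- closed, H fixes 0, so signed edge counts define a homomorphism on H.
  have hf : ∀ i < W.num, ∀ j ≤ W.len i, f i j = ((W.orbitPoint n o i j : Fin W.size) : ℕ) := by
    intro i hi j hj
    induction j with
    | zero => rw [orbitPoint_zero, (hclosed i hi).1]
    | succ j ih =>
      have ih := ih (by omega)
      rw [orbitPoint_succ]
      let t : Fin W.size := ⟨f i (j + 1), hlt i hi (j + 1) hj⟩
      have he : W.edge f i j ∈ W.edges f := mem_edges.2 ⟨i, hi, j, hj, rfl⟩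
      suffices (letterVal n (W.letter i j))⁻¹ • W.orbitPoint n o i j = t by rw [this]
      by_cases hl : (W.letter i j).2 = true
      · have h1 := hρ _ he (by simpa [edge, hl] using hlet i hi j hj) (W.orbitPoint n o i j) t
          (by simp [edge, hl, ih]) (by simp [edge, hl, t])
        simp only [edge, hl, if_true, letterVal] at h1 ⊢
        rw [inv_smul_eq_iff, ← h1, hsmul]
      · have h1 := hρ _ he (by simpa [edge, hl] using hlet i hi j hj) t (W.orbitPoint n o i j)
          (by simp [edge, hl, t]) (by simp [edge, hl, ih])
        simp only [edge, hl, letterVal, Bool.false_eq_true, if_false, inv_inv] at h1 ⊢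
        rw [← h1, hsmul]
  have hstab : ∀ x ∈ W.subgroup (n := n) a, x.2 • o = o := by
    have : W.subgroup (n := n) a ≤
        (MulAction.stabilizer (FreeGroup (Fin n)) o).comap (MonoidHom.snd _ _) := by
      rw [subgroup, Subgroup.closure_le]
      rintro _ ⟨i, hi, rfl⟩
      change W.pre n i (W.len i) • o = o
      have h1 : W.orbitPoint n o i (W.len i) = o :=
        Fin.ext (by rw [← hf i hi _ le_rfl, (hclosed i hi).2])
      rw [orbitPoint, inv_smul_eq_iff] at h1
      exact h1.symm
    exact fun x hx => this hx
  obtain ⟨θ, h1, h2, h3⟩ := exists_edge_crossedHom (n := n) (Fin.val : Fin W.size → ℕ)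
  obtain ⟨Φ, hΦ⟩ := exists_edge_hom (m := m) o h1 h2 _ hstab
  obtain ⟨w, hw⟩ := exists_span_of_rank Φ
  refine ⟨w, fun i hi => ?_⟩
  have h5 := hw ⟨_, elt_mem_subgroup hi⟩
  rw [hΦ, crossedHom_pre (W := W) o h1 h2 h3 (f := f) (hf i hi) (hlet i hi) _ le_rfl] at h5
  exact h5

end WordData
-- Enumeration of labellings by natural numbers, and the associated ranks
theorem exists_digits {B : ℕ} (hB : 0 < B) (N : ℕ) (d : ℕ → ℕ) (hd : ∀ p < N, d p < B) :
    ∃ e < B ^ N, ∀ p < N, e / B ^ p % B = d p := by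
  induction N with
  | zero => exact ⟨0, by simp, by simp⟩
  | succ N ih =>
    obtain ⟨e, he, h⟩ := ih fun p hp => hd p (by omega)
    have hdN := hd N (by omega)
    refine ⟨e + B ^ N * d N, ?_, fun p hp => ?_⟩
    · rw [pow_succ]
      calc e + B ^ N * d N < B ^ N * 1 + B ^ N * d N := by omega
        _ = B ^ N * (1 + d N) := by ring
        _ ≤ B ^ N * B := Nat.mul_le_mul_left _ (by omega)
    · rcases Nat.lt_succ_iff_lt_or_eq.1 hp with hp | rfl
      · rw [← h p hp]
        have : B ^ N * d N = B ^ p * (B * (B ^ (N - p - 1) * d N)) := by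
          rw [← mul_assoc, ← mul_assoc, ← pow_succ, ← pow_add]
          congr 2
          omega
        rw [this, Nat.add_mul_div_left _ _ (pow_pos hB p), Nat.add_mul_mod_self_left]
      · rw [Nat.add_mul_div_left _ _ (pow_pos hB p), Nat.div_eq_of_lt he, zero_add,
          Nat.mod_eq_of_lt hdN]

namespace WordData

variable (W : WordData)

/-- The labelling whose values are the digits of `e`. -/
def digitLabelling (e i j : ℕ) : ℕ := e / W.size ^ (i * W.size + j) % W.size

/-- The number of labellings by digits. -/
def labellingBound : ℕ := W.size ^ (W.num * W.size)

/-- The number of an edge. -/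
def edgeCode (n : ℕ) (e : ℕ × ℕ × ℕ) : ℕ := (e.1 * n + e.2.1) * W.size + e.2.2

/-- The edge with a given number. -/
def edgeDecode (n c : ℕ) : ℕ × ℕ × ℕ := (c / W.size / n, c / W.size % n, c % W.size)

/-- A bound for the numbers of the edges. -/
def edgeBound (n : ℕ) : ℕ := W.size * n * W.size

/-- The exponent sum of the edge with number `c` in the `i`-th word. -/
def edgeMatrix (n : ℕ) (f : ℕ → ℕ → ℕ) (i c : ℕ) : ℤ :=
  ∑ j ∈ Finset.range (W.len i), if W.edgeCode n (W.edge f i j) = c then W.sgn i j else 0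

/-- The matrix of exponent sums, followed by the abelian part. -/
def fullMatrix (n : ℕ) (f : ℕ → ℕ → ℕ) (a : ℕ → ℕ → ℤ) (i c : ℕ) : ℤ :=
  if c < W.edgeBound n then W.edgeMatrix n f i c else a i (c - W.edgeBound n)

variable {W}

theorem size_pos : 0 < W.size := by unfold size; omega

theorem len_lt_size {i : ℕ} (hi : i < W.num) : W.len i < W.size := by
  have := Finset.single_le_sum (f := W.len) (fun _ _ => Nat.zero_le _) (Finset.mem_range.2 hi)
  unfold size
  omega

theorem digitLabelling_lt (e i j : ℕ) : W.digitLabelling e i j < W.size :=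
  Nat.mod_lt _ size_pos

/-- Only labels at positions within the words matter. Since `size` exceeds every word length, the
digit positions i * size + j of distinct such pairs do not collide. -/
theorem exists_digitLabelling_eq (f : ℕ → ℕ → ℕ)
    (hf : ∀ i < W.num, ∀ j ≤ W.len i, f i j < W.size) :
    ∃ e < W.labellingBound, ∀ i < W.num, ∀ j ≤ W.len i, W.digitLabelling e i j = f i j := by
  classical
  obtain ⟨e, he, h⟩ := exists_digits (B := W.size) size_pos (W.num * W.size)
    (fun p => if f (p / W.size) (p % W.size) < W.size then f (p / W.size) (p % W.size) else 0)
    (fun p _ => by split_ifs with h; exacts [h, size_pos])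
  refine ⟨e, he, fun i hi j hj => ?_⟩
  have hj' : j < W.size := hj.trans_lt (len_lt_size hi)
  have hp : i * W.size + j < W.num * W.size := by
    calc i * W.size + j < i * W.size + W.size := by omega
      _ = (i + 1) * W.size := by ring
      _ ≤ W.num * W.size := Nat.mul_le_mul_right _ hi
  rw [digitLabelling, h _ hp]
  have h1 : (i * W.size + j) / W.size = i := by
    rw [mul_comm, Nat.mul_add_div size_pos, Nat.div_eq_of_lt hj', add_zero]
  have h2 : (i * W.size + j) % W.size = j := by
    rw [mul_comm, Nat.mul_add_mod, Nat.mod_eq_of_lt hj']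
  rw [h1, h2, if_pos (hf i hi j hj)]

theorem edgeDecode_edgeCode {n : ℕ} {e : ℕ × ℕ × ℕ} (hx : e.2.1 < n) (ht : e.2.2 < W.size) :
    W.edgeDecode n (W.edgeCode n e) = e := by
  have hs : 0 < W.size := size_pos
  have h1 : ((e.1 * n + e.2.1) * W.size + e.2.2) / W.size = e.1 * n + e.2.1 := by
    rw [mul_comm, Nat.mul_add_div hs, Nat.div_eq_of_lt ht, add_zero]
  have h2 : ((e.1 * n + e.2.1) * W.size + e.2.2) % W.size = e.2.2 := by
    rw [mul_comm, Nat.mul_add_mod, Nat.mod_eq_of_lt ht]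
  have h3 : (e.1 * n + e.2.1) / n = e.1 := by
    rw [mul_comm, Nat.mul_add_div (by omega), Nat.div_eq_of_lt hx, add_zero]
  have h4 : (e.1 * n + e.2.1) % n = e.2.1 := by
    rw [mul_comm, Nat.mul_add_mod, Nat.mod_eq_of_lt hx]
  simp only [edgeDecode, edgeCode, h1, h2, h3, h4]

theorem edgeCode_edgeDecode (n c : ℕ) : W.edgeCode n (W.edgeDecode n c) = c := by
  simp only [edgeDecode, edgeCode]
  rw [mul_comm (c / W.size / n), Nat.div_add_mod, mul_comm, Nat.div_add_mod]

theorem edgeCode_lt {n : ℕ} {e : ℕ × ℕ × ℕ} (hs : e.1 < W.size) (hx : e.2.1 < n)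
    (ht : e.2.2 < W.size) : W.edgeCode n e < W.edgeBound n := by
  have h1 : e.1 * n + e.2.1 + 1 ≤ W.size * n :=
    calc e.1 * n + e.2.1 + 1 ≤ (e.1 + 1) * n := by rw [add_mul]; omega
      _ ≤ W.size * n := Nat.mul_le_mul_right _ hs
  calc W.edgeCode n e < (e.1 * n + e.2.1 + 1) * W.size := by
        rw [edgeCode, add_mul _ 1]; omega
    _ ≤ W.edgeBound n := Nat.mul_le_mul_right _ h1

section Range

variable {n : ℕ} {f : ℕ → ℕ → ℕ} (hlt : ∀ i < W.num, ∀ j ≤ W.len i, f i j < W.size)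
  (hlet : ∀ i < W.num, ∀ j < W.len i, (W.letter i j).1 < n)

include hlt hlet

theorem edge_mem_range {i j : ℕ} (hi : i < W.num) (hj : j < W.len i) :
    (W.edge f i j).1 < W.size ∧ (W.edge f i j).2.1 < n ∧ (W.edge f i j).2.2 < W.size := by
  have h1 := hlt i hi j hj.le
  have h2 := hlt i hi (j + 1) hj
  have h3 := hlet i hi j hj
  unfold edge
  split_ifs
  · exact ⟨h1, h3, h2⟩
  · exact ⟨h2, h3, h1⟩

theorem sum_edgeMatrix {i : ℕ} (hi : i < W.num) (F : ℕ → ℤ) :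
    ∑ c ∈ Finset.range (W.edgeBound n), W.edgeMatrix n f i c * F c =
      ∑ j ∈ Finset.range (W.len i), W.sgn i j * F (W.edgeCode n (W.edge f i j)) := by
  simp only [edgeMatrix, Finset.sum_mul]
  rw [Finset.sum_comm]
  refine Finset.sum_congr rfl fun j hj => ?_
  obtain ⟨h1, h2, h3⟩ := edge_mem_range hlt hlet hi (Finset.mem_range.1 hj)
  simp only [ite_mul, zero_mul]
  rw [Finset.sum_ite_eq, if_pos (Finset.mem_range.2 (edgeCode_lt h1 h2 h3))]

theorem edgeVector_decode {m : ℕ} (a : ℕ → Fin m → ℤ) {i : ℕ} (hi : i < W.num) (c : ℕ) :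
    (W.edgeVector f a i).1 (W.edgeDecode n c) = W.edgeMatrix n f i c := by
  simp only [edgeVector, edgeMatrix, Finset.sum_apply, Pi.smul_apply, smul_eq_mul]
  refine Finset.sum_congr rfl fun j hj => ?_
  obtain ⟨h1, h2, h3⟩ := edge_mem_range hlt hlet hi (Finset.mem_range.1 hj)
  by_cases h : W.edgeCode n (W.edge f i j) = c
  · rw [if_pos h, ← h, edgeDecode_edgeCode h2 h3, Pi.single_eq_same, mul_one]
  · rw [if_neg h, Pi.single_eq_of_ne, mul_zero]
    intro h'
    exact h (by rw [← h', edgeCode_edgeDecode])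

theorem edgeVector_eq_zero {m : ℕ} (a : ℕ → Fin m → ℤ) {i : ℕ} (hi : i < W.num) {e : ℕ × ℕ × ℕ}
    (he : ¬ (e.1 < W.size ∧ e.2.1 < n ∧ e.2.2 < W.size)) : (W.edgeVector f a i).1 e = 0 := by
  simp only [edgeVector, Finset.sum_apply, Pi.smul_apply, smul_eq_mul]
  refine Finset.sum_eq_zero fun j hj => ?_
  have h := edge_mem_range hlt hlet hi (Finset.mem_range.1 hj)
  rw [Pi.single_eq_of_ne, mul_zero]
  rintro rfl
  exact he h

/-- The rank of the rows of the full matrix is the rank of the edge vectors. -/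
theorem factors_fullMatrix_iff {m : ℕ} (a : ℕ → ℕ → ℤ) (l : ℕ) :
    Factors W.num (W.edgeBound n + m) 0 (W.fullMatrix n f a) 0 l ↔
      ∃ w : Fin l → (ℕ × ℕ × ℕ → ℤ) × (Fin m → ℤ), ∀ i < W.num,
        W.edgeVector f (fun i j => a i j) i ∈ Submodule.span ℤ (Set.range w) := by
  constructor
  · rintro ⟨C, X, Λ, h⟩
    simp only [Finset.range_zero, Finset.sum_empty, zero_add, Finset.sum_range] at h
    refine ⟨fun t => (fun e => if e.1 < W.size ∧ e.2.1 < n ∧ e.2.2 < W.size then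
      Λ t (W.edgeCode n e) else 0, fun j => Λ t (W.edgeBound n + j)), fun i hi => ?_⟩
    rw [Submodule.mem_span_range_iff_exists_fun]
    refine ⟨fun t => X i t, ?_⟩
    ext e
    · simp only [Prod.fst_sum, Prod.smul_fst, Finset.sum_apply, Pi.smul_apply, smul_eq_mul]
      by_cases he : e.1 < W.size ∧ e.2.1 < n ∧ e.2.2 < W.size
      · have h1 := edgeCode_lt (W := W) he.1 he.2.1 he.2.2
        have h2 := h i hi (W.edgeCode n e) (by omega)
        rw [fullMatrix, if_pos h1, ← edgeVector_decode hlt hlet (fun i (j : Fin m) => a i j) hi,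
          edgeDecode_edgeCode he.2.1 he.2.2] at h2
        rw [h2]
        simp [he]
      · rw [edgeVector_eq_zero hlt hlet _ hi he]
        simp [he]
    · simp only [Prod.snd_sum, Prod.smul_snd, Finset.sum_apply, Pi.smul_apply, smul_eq_mul]
      have h2 := h i hi (W.edgeBound n + e) (by omega)
      rw [fullMatrix, if_neg (by omega), Nat.add_sub_cancel_left] at h2
      rw [← h2]
      rfl
  · rintro ⟨w, hw⟩
    have hX : ∀ i, ∃ x : Fin l → ℤ, i < W.num →
        ∑ t, x t • w t = W.edgeVector f (fun i j => a i j) i := by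
      intro i
      by_cases hi : i < W.num
      · obtain ⟨x, hx⟩ := (Submodule.mem_span_range_iff_exists_fun ℤ).1 (hw i hi)
        exact ⟨x, fun _ => hx⟩
      · exact ⟨0, fun h => absurd h hi⟩
    choose X hX using hX
    refine ⟨0, fun i t => if h : t < l then X i ⟨t, h⟩ else 0, fun t c => if h : t < l then
      if c < W.edgeBound n then (w ⟨t, h⟩).1 (W.edgeDecode n c) else
        if hc : c - W.edgeBound n < m then (w ⟨t, h⟩).2 ⟨c - W.edgeBound n, hc⟩ else 0 else 0,
      fun i hi c hc => ?_⟩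
    simp only [Finset.range_zero, Finset.sum_empty, zero_add, Finset.sum_range, Fin.is_lt, dif_pos,
      Fin.eta]
    by_cases h : c < W.edgeBound n
    · simp only [fullMatrix, h, if_true]
      rw [← edgeVector_decode hlt hlet (fun i (j : Fin m) => a i j) hi, ← hX i hi]
      simp [Prod.fst_sum]
    · have hc' : c - W.edgeBound n < m := by omega
      simp only [fullMatrix, h, if_false, hc', dif_pos]
      have := congrFun (congrArg Prod.snd (hX i hi)) ⟨c - W.edgeBound n, hc'⟩
      simp only [edgeVector] at this
      rw [← this]
      simp [Prod.snd_sum]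

end Range

theorem edge_congr {f f' : ℕ → ℕ → ℕ} (h : ∀ i < W.num, ∀ j ≤ W.len i, f i j = f' i j) {i j : ℕ}
    (hi : i < W.num) (hj : j < W.len i) : W.edge f i j = W.edge f' i j := by
  simp only [edge, h i hi j hj.le, h i hi (j + 1) hj]

theorem edges_congr {f f' : ℕ → ℕ → ℕ} (h : ∀ i < W.num, ∀ j ≤ W.len i, f i j = f' i j) :
    W.edges f = W.edges f' := by
  ext e
  simp only [mem_edges]
  constructor
  · rintro ⟨i, hi, j, hj, rfl⟩
    exact ⟨i, hi, j, hj, (edge_congr h hi hj).symm⟩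
  · rintro ⟨i, hi, j, hj, rfl⟩
    exact ⟨i, hi, j, hj, edge_congr h hi hj⟩

theorem verts_congr {f f' : ℕ → ℕ → ℕ} (h : ∀ i < W.num, ∀ j ≤ W.len i, f i j = f' i j) :
    W.verts f = W.verts f' := by
  ext v
  simp only [mem_verts]
  refine or_congr Iff.rfl ⟨?_, ?_⟩
  · rintro ⟨i, hi, j, hj, rfl⟩
    exact ⟨i, hi, j, hj, (h i hi j hj).symm⟩
  · rintro ⟨i, hi, j, hj, rfl⟩
    exact ⟨i, hi, j, hj, h i hi j hj⟩

/-- The number of generators of the subgroup read off from a labelling. -/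
def labellingRank (W : WordData) (m n : ℕ) (f : ℕ → ℕ → ℕ) (a : ℕ → ℕ → ℤ) : ℕ :=
  (W.edges f).card + 1 + factorRank W.num m (W.edgeBound n) a (W.edgeMatrix n f) -
    (W.verts f).card

/-- A lower bound for the rank of the subgroup generated by the words, from a folded labelling. -/
def foldedRank (W : WordData) (m n : ℕ) (f : ℕ → ℕ → ℕ) (a : ℕ → ℕ → ℤ) : ℕ :=
  factorRank W.num (W.edgeBound n + m) 0 (W.fullMatrix n f a) 0

section Main

variable {m n : ℕ} (hlet : ∀ i < W.num, ∀ j < W.len i, (W.letter i j).1 < n) (a : ℕ → ℕ → ℤ)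

include hlet

/-- The matrix C of an optimal factorization labels the edges and the rows of Λ generate the
lattice. The equations of the factorization say exactly that the discrepancies lie in that lattice.
-/
theorem exists_generators_card_le {e : ℕ} (he : W.Closed (W.digitLabelling e)) :
    ∃ S : Finset (G m n), S.card ≤ W.labellingRank m n (W.digitLabelling e) a ∧
      W.subgroup (fun i j => a i j) ≤ Subgroup.closure (S : Set (G m n)) := by
  obtain ⟨C, X, Λ, h⟩ := factors_factorRank W.num m (W.edgeBound n) a
    (W.edgeMatrix n (W.digitLabelling e))
  obtain ⟨S, hS, hH, -⟩ := exists_generators_of_labelling (n := n) he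
    (fun e (j : Fin m) => C (W.edgeCode n e) j)
    (l := factorRank W.num m (W.edgeBound n) a (W.edgeMatrix n (W.digitLabelling e)))
    (fun t j => Λ t j) (fun i j => a i j) fun i hi => by
      rw [Submodule.mem_span_range_iff_exists_fun]
      refine ⟨fun t => X i t, ?_⟩
      ext j
      have h1 := h i hi j j.2
      rw [sum_edgeMatrix (fun i _ j _ => digitLabelling_lt e i j) hlet hi, Finset.sum_range (n :=
        factorRank W.num m (W.edgeBound n) a (W.edgeMatrix n (W.digitLabelling e)))] at h1
      simp only [Finset.sum_apply, Pi.smul_apply, smul_eq_mul, Pi.sub_apply, h1]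
      ring
  refine ⟨S, ?_, hH⟩
  unfold labellingRank
  omega

/-- The coset labelling of K serves all purposes. A basis of K ∩ ℤ^m shows that the factor rank is
at most the lattice rank, whence the bound for `labellingRank`. If K = H, the edge vectors span the
image of Φ, so `foldedRank` is at least |E| - |V| + 1 plus the lattice rank; and the spanning tree
generates K with at most that many elements. -/
theorem exists_labelling_of_le (K : Subgroup (G m n)) (hK : W.subgroup (fun i j => a i j) ≤ K) :
    ∃ e < W.labellingBound, W.Closed (W.digitLabelling e) ∧ W.Folded (W.digitLabelling e) ∧
      (∀ [Group.FG K], W.labellingRank m n (W.digitLabelling e) a ≤ Group.rank K) ∧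
      ∀ [Group.FG K], K = W.subgroup (fun i j => a i j) →
        Group.rank K ≤ W.foldedRank m n (W.digitLabelling e) a := by
  obtain ⟨f, C, g, hcl, hfo, hlt, hg0, hC, hlat, Φ, hΦ, hdim⟩ :=
    exists_coset_labelling hlet (fun i j => a i j) K hK
  obtain ⟨e, he, hef⟩ := exists_digitLabelling_eq f hlt
  have hfact : Factors W.num m (W.edgeBound n) a (W.edgeMatrix n (W.digitLabelling e))
      (Module.finrank ℤ (lattice K)) := by
    let b := Module.finBasis ℤ (lattice K)
    have hX : ∀ i, ∃ x : Fin (Module.finrank ℤ (lattice K)) → ℤ, i < W.num →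
        ∑ t, x t • (b t : Fin m → ℤ) = (fun (j : Fin m) => a i j) -
          ∑ j ∈ Finset.range (W.len i), W.sgn i j • C (W.edge f i j) := by
      intro i
      by_cases hi : i < W.num
      · refine ⟨b.repr ⟨_, hlat i hi⟩, fun _ => ?_⟩
        have := congrArg Subtype.val (b.sum_repr ⟨_, hlat i hi⟩)
        simp only [Submodule.coe_sum, Submodule.coe_smul] at this
        exact this
      · exact ⟨0, fun h => absurd h hi⟩
    choose X hX using hX
    refine ⟨fun c j => if h : j < m then C (W.edgeDecode n c) ⟨j, h⟩ else 0,
      fun i t => if h : t < _ then X i ⟨t, h⟩ else 0,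
      fun t j => if h : t < _ ∧ j < m then (b ⟨t, h.1⟩ : Fin m → ℤ) ⟨j, h.2⟩ else 0,
      fun i hi j hj => ?_⟩
    rw [sum_edgeMatrix (fun i _ j _ => digitLabelling_lt e i j) hlet hi,
      Finset.sum_range (n := Module.finrank ℤ (lattice K))]
    have h1 := congrFun (hX i hi) ⟨j, hj⟩
    simp only [Finset.sum_apply, Pi.smul_apply, smul_eq_mul, Pi.sub_apply] at h1
    simp only [Fin.is_lt, hj, dif_pos, Fin.eta, and_self, h1]
    have h2 : ∀ k ∈ Finset.range (W.len i), W.sgn i k *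
        C (W.edgeDecode n (W.edgeCode n (W.edge (W.digitLabelling e) i k))) ⟨j, hj⟩ =
          W.sgn i k * C (W.edge f i k) ⟨j, hj⟩ := by
      intro k hk
      have hk' := Finset.mem_range.1 hk
      obtain ⟨-, h2, h3⟩ := edge_mem_range hlt hlet hi hk'
      rw [edge_congr hef hi hk', edgeDecode_edgeCode h2 h3]
    exact ((congrArg₂ (· + ·) (Finset.sum_congr rfl h2) rfl).trans (add_sub_cancel _ _)).symm
  refine ⟨e, he, fun i hi => ?_, ?_, ?_, ?_⟩
  · rw [hef i hi 0 (Nat.zero_le _), hef i hi _ le_rfl]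
    exact hcl i hi
  · unfold Folded; rw [edges_congr hef]; exact hfo
  · intro _
    obtain ⟨w, hw⟩ := exists_span_of_rank Φ
    have h1 := hdim _ w hw
    have h2 := factorRank_le hfact
    unfold labellingRank
    rw [edges_congr hef, verts_congr hef]
    omega
  · intro _ hKH
    have h0 := factors_factorRank W.num (W.edgeBound n + m) 0
      (W.fullMatrix n (W.digitLabelling e) a) 0
    rw [factors_fullMatrix_iff (fun i _ j _ => digitLabelling_lt e i j) hlet] at h0
    obtain ⟨w, hw⟩ := h0
    have hev : ∀ i < W.num, W.edgeVector (W.digitLabelling e) (fun i (j : Fin m) => a i j) i =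
        W.edgeVector f (fun i j => a i j) i := by
      intro i hi
      simp only [edgeVector]
      congr 1
      refine Finset.sum_congr rfl fun k hk => ?_
      rw [edge_congr hef hi (Finset.mem_range.1 hk)]
    have hspan : ∀ x, (Φ x).toAdd ∈ Submodule.span ℤ (Set.range w) := by
      have : K ≤ Subgroup.map K.subtype ((AddSubgroup.toSubgroup
          (Submodule.span ℤ (Set.range w)).toAddSubgroup).comap Φ) := by
        nth_rewrite 1 [hKH]
        rw [subgroup, Subgroup.closure_le]
        rintro _ ⟨i, hi, rfl⟩
        refine ⟨⟨_, hK (elt_mem_subgroup hi)⟩, ?_, rfl⟩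
        change (Φ _).toAdd ∈ Submodule.span ℤ (Set.range w)
        rw [hΦ i hi, ← hev i hi]
        exact hw i hi
      rintro ⟨x, hx⟩
      obtain ⟨⟨y, hy⟩, hy', rfl⟩ := this hx
      exact hy'
    have h1 := hdim _ w hspan
    let b := Module.finBasis ℤ (lattice K)
    have hΛ : Submodule.span ℤ (Set.range fun t => (b t : Fin m → ℤ)) = lattice K := by
      have := congrArg (Submodule.map (lattice K).subtype) b.span_eq
      rw [Submodule.map_span, Submodule.map_subtype_top, ← Set.range_comp] at this
      exact this
    obtain ⟨S, hS, hHS, hSD⟩ := exists_generators_of_labelling (n := n) hcl C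
      (fun t => (b t : Fin m → ℤ)) (fun i j => a i j) (fun i hi => by rw [hΛ]; exact hlat i hi)
    -- The representatives g, placed over the abelian part 0, are transports whose edge values lie
    -- in K; so the spanning tree subgroup does not exceed K.
    have hSK : Subgroup.closure (S : Set (G m n)) = K := by
      refine le_antisymm (hSD K (fun v => elt 0 (g v)) (by rw [hg0, elt_zero_one])
        (fun e he => ?_) fun t => (b t).2) (by nth_rewrite 1 [hKH]; exact hHS)
      rw [elt_inv, elt_mul, elt_mul]; simpa using hC e he
    have h2 : Group.rank K ≤ S.card := by
      have := Subgroup.rank_closure_finset_le_card S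
      convert this using 1
      exact Subgroup.rank_congr hSK.symm
    unfold foldedRank
    omega

theorem foldedRank_le [Group.FG (W.subgroup (m := m) (n := n) (fun i j => a i j))] {e : ℕ}
    (hcl : W.Closed (W.digitLabelling e)) (hfo : W.Folded (W.digitLabelling e)) :
    W.foldedRank m n (W.digitLabelling e) a ≤
      Group.rank (W.subgroup (m := m) (n := n) (fun i j => a i j)) := by
  refine factorRank_le ?_
  rw [factors_fullMatrix_iff (fun i _ j _ => digitLabelling_lt e i j) hlet]
  exact hfo.exists_span hcl (fun i _ j _ => digitLabelling_lt e i j) hlet _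

end Main

end WordData
-- Primitive recursiveness of the graph data
/-- The input of the algorithm: `m`, `n` and a list of expressions. -/
abbrev RawInput : Type := ℕ × ℕ × List (List ℤ × List (ℕ × Bool))

/-- The words of an input. -/
def RawInput.words (x : RawInput) : WordData where
  num := x.2.2.length
  len i := (x.2.2.getD i ([], [])).2.length
  letter i j := (x.2.2.getD i ([], [])).2.getD j (0, true)

/-- The vectors of an input. -/
def RawInput.vec (x : RawInput) (i j : ℕ) : ℤ := (x.2.2.getD i ([], [])).1.getD j 0

section Primrec

open WordData

variable {τ : Type*} [Primcodable τ] {x : τ → RawInput} {e i j : τ → ℕ}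

theorem primrec_num (hx : Primrec x) : Primrec fun t => (x t).words.num :=
  Primrec.list_length.comp (Primrec.snd.comp (Primrec.snd.comp hx))

theorem primrec_len (hx : Primrec x) (hi : Primrec i) : Primrec fun t => (x t).words.len (i t) :=
  Primrec.list_length.comp (Primrec.snd.comp ((Primrec.list_getD ([], [])).comp
    (Primrec.snd.comp (Primrec.snd.comp hx)) hi))

theorem primrec_letter (hx : Primrec x) (hi : Primrec i) (hj : Primrec j) :
    Primrec fun t => (x t).words.letter (i t) (j t) :=
  (Primrec.list_getD (0, true)).comp (Primrec.snd.comp ((Primrec.list_getD ([], [])).comp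
    (Primrec.snd.comp (Primrec.snd.comp hx)) hi)) hj

theorem primrec_vec (hx : Primrec x) (hi : Primrec i) (hj : Primrec j) :
    Primrec fun t => (x t).vec (i t) (j t) :=
  (Primrec.list_getD 0).comp (Primrec.fst.comp ((Primrec.list_getD ([], [])).comp
    (Primrec.snd.comp (Primrec.snd.comp hx)) hi)) hj

theorem primrec_size (hx : Primrec x) : Primrec fun t => (x t).words.size := by
  have h : Primrec₂ fun (t : τ) (i : ℕ) => (x t).words.len i := primrec_len (hx.comp .fst) .snd
  exact Primrec.nat_add.comp (.const 1) (primrec_sum_nat (primrec_num hx) h)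

theorem primrec_digitLabelling (hx : Primrec x) (he : Primrec e) (hi : Primrec i)
    (hj : Primrec j) : Primrec fun t => (x t).words.digitLabelling (e t) (i t) (j t) :=
  Primrec.nat_mod.comp (Primrec.nat_div.comp he (primrec_nat_pow.comp (primrec_size hx)
    (Primrec.nat_add.comp (Primrec.nat_mul.comp hi (primrec_size hx)) hj))) (primrec_size hx)

theorem primrec_labellingBound (hx : Primrec x) : Primrec fun t => (x t).words.labellingBound :=
  primrec_nat_pow.comp (primrec_size hx) (Primrec.nat_mul.comp (primrec_num hx) (primrec_size hx))

theorem primrec_edgeBound (hx : Primrec x) :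
    Primrec fun t => (x t).words.edgeBound (x t).2.1 :=
  Primrec.nat_mul.comp (Primrec.nat_mul.comp (primrec_size hx) (Primrec.fst.comp
    (Primrec.snd.comp hx))) (primrec_size hx)

theorem primrecPred_letter (hx : Primrec x) (hi : Primrec i) (hj : Primrec j) :
    PrimrecPred fun t => ((x t).words.letter (i t) (j t)).2 = true :=
  Primrec.eq.comp (Primrec.snd.comp (primrec_letter hx hi hj)) (.const true)

theorem primrec_edge (hx : Primrec x) (he : Primrec e) (hi : Primrec i) (hj : Primrec j) :
    Primrec fun t => (x t).words.edge ((x t).words.digitLabelling (e t)) (i t) (j t) := by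
  have h1 := primrec_digitLabelling hx he hi hj
  have h2 := primrec_digitLabelling hx he hi (Primrec.succ.comp hj)
  have h3 := Primrec.fst.comp (primrec_letter hx hi hj)
  exact Primrec.ite (primrecPred_letter hx hi hj) (h1.pair (h3.pair h2)) (h2.pair (h3.pair h1))

theorem primrec_sgn (hx : Primrec x) (hi : Primrec i) (hj : Primrec j) :
    Primrec fun t => (x t).words.sgn (i t) (j t) :=
  Primrec.ite (primrecPred_letter hx hi hj) (.const 1) (.const (-1))

theorem primrec_edgeCode {f : τ → ℕ × ℕ × ℕ} (hx : Primrec x) (hf : Primrec f) :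
    Primrec fun t => (x t).words.edgeCode (x t).2.1 (f t) :=
  Primrec.nat_add.comp (Primrec.nat_mul.comp (Primrec.nat_add.comp (Primrec.nat_mul.comp
    (Primrec.fst.comp hf) (Primrec.fst.comp (Primrec.snd.comp hx)))
    (Primrec.fst.comp (Primrec.snd.comp hf))) (primrec_size hx))
    (Primrec.snd.comp (Primrec.snd.comp hf))

theorem primrec_edgeMatrix (hx : Primrec x) (he : Primrec e) (hi : Primrec i) (hj : Primrec j) :
    Primrec fun t => (x t).words.edgeMatrix (x t).2.1 ((x t).words.digitLabelling (e t))
      (i t) (j t) := by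
  have hx' : Primrec fun y : τ × ℕ => x y.1 := hx.comp .fst
  have hi' : Primrec fun y : τ × ℕ => i y.1 := hi.comp .fst
  have h : Primrec₂ fun (t : τ) (k : ℕ) =>
      if (x t).words.edgeCode (x t).2.1
        ((x t).words.edge ((x t).words.digitLabelling (e t)) (i t) k) = j t
      then (x t).words.sgn (i t) k else 0 :=
    Primrec.ite (Primrec.eq.comp (primrec_edgeCode hx' (primrec_edge hx' (he.comp .fst) hi' .snd))
      (hj.comp .fst)) (primrec_sgn hx' hi' .snd) (.const 0)
  exact primrec_sum_int (primrec_len hx hi) h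

theorem primrec_fullMatrix (hx : Primrec x) (he : Primrec e) (hi : Primrec i) (hj : Primrec j) :
    Primrec fun t => (x t).words.fullMatrix (x t).2.1 ((x t).words.digitLabelling (e t))
      (x t).vec (i t) (j t) :=
  Primrec.ite (Primrec.nat_lt.comp hj (primrec_edgeBound hx)) (primrec_edgeMatrix hx he hi hj)
    (primrec_vec hx hi (Primrec.nat_sub.comp hj (primrec_edgeBound hx)))

theorem primrecPred_closed (hx : Primrec x) (he : Primrec e) :
    PrimrecPred fun t => (x t).words.Closed ((x t).words.digitLabelling (e t)) := by
  have hx' : Primrec fun y : τ × ℕ => x y.1 := hx.comp .fst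
  have he' : Primrec fun y : τ × ℕ => e y.1 := he.comp .fst
  have h : PrimrecPred fun y : τ × ℕ => (x y.1).words.digitLabelling (e y.1) y.2 0 = 0 ∧
      (x y.1).words.digitLabelling (e y.1) y.2 ((x y.1).words.len y.2) = 0 :=
    (Primrec.eq.comp (primrec_digitLabelling hx' he' .snd (.const 0)) (.const 0)).and
      (Primrec.eq.comp (primrec_digitLabelling hx' he' .snd (primrec_len hx' .snd)) (.const 0))
  exact primrecPred_forall_lt (primrec_num hx) h

/-- The condition is rewritten with bounded quantifiers, conjunctions, disjunctions and negations
only, the operations under which primitive recursive predicates are shown to be closed. -/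
theorem folded_iff (W : WordData) (f : ℕ → ℕ → ℕ) : W.Folded f ↔
    ∀ i < W.num, ∀ j < W.len i, ∀ i' < W.num, ∀ j' < W.len i',
      ¬ (W.edge f i j).2.1 = (W.edge f i' j').2.1 ∨
      (((W.edge f i j).1 = (W.edge f i' j').1 ∧ (W.edge f i j).2.2 = (W.edge f i' j').2.2) ∨
        (¬ (W.edge f i j).1 = (W.edge f i' j').1 ∧
          ¬ (W.edge f i j).2.2 = (W.edge f i' j').2.2)) := by
  simp only [Folded, mem_edges]
  constructor
  · intro h i hi j hj i' hi' j' hj'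
    have := h _ ⟨i, hi, j, hj, rfl⟩ _ ⟨i', hi', j', hj', rfl⟩
    tauto
  · rintro h _ ⟨i, hi, j, hj, rfl⟩ _ ⟨i', hi', j', hj', rfl⟩
    have := h i hi j hj i' hi' j' hj'
    tauto

theorem primrecPred_folded (hx : Primrec x) (he : Primrec e) :
    PrimrecPred fun t => (x t).words.Folded ((x t).words.digitLabelling (e t)) := by
  simp only [folded_iff]
  have x1 : Primrec fun y : τ × ℕ => x y.1 := hx.comp .fst
  have x2 : Primrec fun y : (τ × ℕ) × ℕ => x y.1.1 := x1.comp .fst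
  have x3 : Primrec fun y : ((τ × ℕ) × ℕ) × ℕ => x y.1.1.1 := x2.comp .fst
  have x4 : Primrec fun y : (((τ × ℕ) × ℕ) × ℕ) × ℕ => x y.1.1.1.1 := x3.comp .fst
  have e4 : Primrec fun y : (((τ × ℕ) × ℕ) × ℕ) × ℕ => e y.1.1.1.1 :=
    he.comp (Primrec.fst.comp (Primrec.fst.comp (Primrec.fst.comp .fst)))
  have i4 : Primrec fun y : (((τ × ℕ) × ℕ) × ℕ) × ℕ => y.1.1.1.2 :=
    Primrec.snd.comp (Primrec.fst.comp (Primrec.fst.comp .fst))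
  have j4 : Primrec fun y : (((τ × ℕ) × ℕ) × ℕ) × ℕ => y.1.1.2 :=
    Primrec.snd.comp (Primrec.fst.comp .fst)
  have k4 : Primrec fun y : (((τ × ℕ) × ℕ) × ℕ) × ℕ => y.1.2 := Primrec.snd.comp .fst
  have l4 : Primrec fun y : (((τ × ℕ) × ℕ) × ℕ) × ℕ => y.2 := Primrec.snd
  have h1 := primrec_edge x4 e4 i4 j4
  have h2 := primrec_edge x4 e4 k4 l4
  have a1 := Primrec.eq.comp (Primrec.fst.comp h1) (Primrec.fst.comp h2)
  have a2 := Primrec.eq.comp (Primrec.fst.comp (Primrec.snd.comp h1))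
    (Primrec.fst.comp (Primrec.snd.comp h2))
  have a3 := Primrec.eq.comp (Primrec.snd.comp (Primrec.snd.comp h1))
    (Primrec.snd.comp (Primrec.snd.comp h2))
  have h4 := a2.not.or ((a1.and a3).or (a1.not.and a3.not))
  have l3 := primrec_len x3 (Primrec.snd (α := (τ × ℕ) × ℕ) (β := ℕ))
  have l1 := primrec_len x1 (Primrec.snd (α := τ) (β := ℕ))
  exact primrecPred_forall_lt (primrec_num hx) (primrecPred_forall_lt l1
    (primrecPred_forall_lt (primrec_num x2) (primrecPred_forall_lt l3 h4)))

/-- Cardinalities become sums of indicator functions over a bounded range of codes, which are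
visibly primitive recursive. -/
theorem card_edges_eq {W : WordData} {n : ℕ} {f : ℕ → ℕ → ℕ}
    (hlt : ∀ i < W.num, ∀ j ≤ W.len i, f i j < W.size)
    (hlet : ∀ i < W.num, ∀ j < W.len i, (W.letter i j).1 < n) :
    (W.edges f).card = ∑ c ∈ Finset.range (W.edgeBound n),
      if ∃ i < W.num, ∃ j < W.len i, W.edgeCode n (W.edge f i j) = c then 1 else 0 := by
  classical
  rw [Finset.sum_boole, Nat.cast_id]
  refine Finset.card_bij (fun e _ => W.edgeCode n e) ?_ ?_ ?_
  · intro e he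
    obtain ⟨i, hi, j, hj, rfl⟩ := mem_edges.1 he
    obtain ⟨h1, h2, h3⟩ := edge_mem_range hlt hlet hi hj
    exact Finset.mem_filter.2 ⟨Finset.mem_range.2 (edgeCode_lt h1 h2 h3), i, hi, j, hj, rfl⟩
  · intro e he e' he' h
    obtain ⟨i, hi, j, hj, rfl⟩ := mem_edges.1 he
    obtain ⟨i', hi', j', hj', rfl⟩ := mem_edges.1 he'
    obtain ⟨h1, h2, h3⟩ := edge_mem_range hlt hlet hi hj
    obtain ⟨h1', h2', h3'⟩ := edge_mem_range hlt hlet hi' hj'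
    rw [← edgeDecode_edgeCode h2 h3, ← edgeDecode_edgeCode h2' h3', h]
  · intro c hc
    obtain ⟨-, i, hi, j, hj, rfl⟩ := Finset.mem_filter.1 hc
    exact ⟨_, mem_edges.2 ⟨i, hi, j, hj, rfl⟩, rfl⟩

theorem card_verts_eq {W : WordData} {f : ℕ → ℕ → ℕ}
    (hlt : ∀ i < W.num, ∀ j ≤ W.len i, f i j < W.size) :
    (W.verts f).card = ∑ v ∈ Finset.range W.size,
      if v = 0 ∨ ∃ i < W.num, ∃ j < W.len i + 1, f i j = v then 1 else 0 := by
  classical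
  rw [Finset.sum_boole, Nat.cast_id]
  congr 1
  ext v
  simp only [mem_verts, Finset.mem_filter, Finset.mem_range, Nat.lt_succ_iff]
  refine ⟨fun h => ⟨?_, h⟩, fun h => h.2⟩
  rcases h with rfl | ⟨i, hi, j, hj, rfl⟩
  · exact size_pos
  · exact hlt i hi j hj

open Classical in
/-- The number of edges, as computed by the algorithm. -/
def RawInput.edgeCount (x : RawInput) (e : ℕ) : ℕ :=
  ∑ c ∈ Finset.range (x.words.edgeBound x.2.1),
    if ∃ i < x.words.num, ∃ j < x.words.len i,
      x.words.edgeCode x.2.1 (x.words.edge (x.words.digitLabelling e) i j) = c then 1 else 0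

open Classical in
/-- The number of vertices, as computed by the algorithm. -/
def RawInput.vertCount (x : RawInput) (e : ℕ) : ℕ :=
  ∑ v ∈ Finset.range x.words.size,
    if v = 0 ∨ ∃ i < x.words.num, ∃ j < x.words.len i + 1, x.words.digitLabelling e i j = v
    then 1 else 0

theorem primrec_edgeCount (hx : Primrec x) (he : Primrec e) :
    Primrec fun t => (x t).edgeCount (e t) := by
  classical
  have x1 : Primrec fun y : τ × ℕ => x y.1 := hx.comp .fst
  have x2 : Primrec fun y : (τ × ℕ) × ℕ => x y.1.1 := x1.comp .fst
  have x3 : Primrec fun y : ((τ × ℕ) × ℕ) × ℕ => x y.1.1.1 := x2.comp .fst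
  have e3 : Primrec fun y : ((τ × ℕ) × ℕ) × ℕ => e y.1.1.1 :=
    he.comp (Primrec.fst.comp (Primrec.fst.comp .fst))
  have c3 : Primrec fun y : ((τ × ℕ) × ℕ) × ℕ => y.1.1.2 :=
    Primrec.snd.comp (Primrec.fst.comp .fst)
  have i3 : Primrec fun y : ((τ × ℕ) × ℕ) × ℕ => y.1.2 := Primrec.snd.comp .fst
  have h : PrimrecPred fun y : ((τ × ℕ) × ℕ) × ℕ =>
      (x y.1.1.1).words.edgeCode (x y.1.1.1).2.1
        ((x y.1.1.1).words.edge ((x y.1.1.1).words.digitLabelling (e y.1.1.1)) y.1.2 y.2) =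
        y.1.1.2 :=
    Primrec.eq.comp (primrec_edgeCode x3 (primrec_edge x3 e3 i3 .snd)) c3
  have l2 : Primrec fun y : (τ × ℕ) × ℕ => (x y.1.1).words.len y.2 := primrec_len x2 .snd
  have h1 := primrecPred_exists_lt (p := fun (y : τ × ℕ) i => ∃ j < (x y.1).words.len i,
      (x y.1).words.edgeCode (x y.1).2.1
        ((x y.1).words.edge ((x y.1).words.digitLabelling (e y.1)) i j) = y.2) (primrec_num x1)
    (primrecPred_exists_lt (p := fun (y : (τ × ℕ) × ℕ) j => (x y.1.1).words.edgeCode (x y.1.1).2.1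
        ((x y.1.1).words.edge ((x y.1.1).words.digitLabelling (e y.1.1)) y.2 j) = y.1.2) l2 h)
  have h2 : Primrec₂ fun (t : τ) (c : ℕ) =>
      if ∃ i < (x t).words.num, ∃ j < (x t).words.len i, (x t).words.edgeCode (x t).2.1
        ((x t).words.edge ((x t).words.digitLabelling (e t)) i j) = c then 1 else 0 :=
    Primrec.ite h1 (.const 1) (.const 0)
  exact primrec_sum_nat (primrec_edgeBound hx) h2

theorem primrec_vertCount (hx : Primrec x) (he : Primrec e) :
    Primrec fun t => (x t).vertCount (e t) := by
  classical
  have x1 : Primrec fun y : τ × ℕ => x y.1 := hx.comp .fst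
  have x2 : Primrec fun y : (τ × ℕ) × ℕ => x y.1.1 := x1.comp .fst
  have x3 : Primrec fun y : ((τ × ℕ) × ℕ) × ℕ => x y.1.1.1 := x2.comp .fst
  have e3 : Primrec fun y : ((τ × ℕ) × ℕ) × ℕ => e y.1.1.1 :=
    he.comp (Primrec.fst.comp (Primrec.fst.comp .fst))
  have c3 : Primrec fun y : ((τ × ℕ) × ℕ) × ℕ => y.1.1.2 :=
    Primrec.snd.comp (Primrec.fst.comp .fst)
  have i3 : Primrec fun y : ((τ × ℕ) × ℕ) × ℕ => y.1.2 := Primrec.snd.comp .fst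
  have h : PrimrecPred fun y : ((τ × ℕ) × ℕ) × ℕ =>
      (x y.1.1.1).words.digitLabelling (e y.1.1.1) y.1.2 y.2 = y.1.1.2 :=
    Primrec.eq.comp (primrec_digitLabelling x3 e3 i3 .snd) c3
  have l2 : Primrec fun y : (τ × ℕ) × ℕ => (x y.1.1).words.len y.2 + 1 :=
    Primrec.succ.comp (primrec_len x2 .snd)
  have h1 := primrecPred_exists_lt (p := fun (y : τ × ℕ) i => ∃ j < (x y.1).words.len i + 1,
      (x y.1).words.digitLabelling (e y.1) i j = y.2) (primrec_num x1)
    (primrecPred_exists_lt (p := fun (y : (τ × ℕ) × ℕ) j =>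
      (x y.1.1).words.digitLabelling (e y.1.1) y.2 j = y.1.2) l2 h)
  have h0 : PrimrecPred fun y : τ × ℕ => y.2 = 0 := Primrec.eq.comp .snd (.const 0)
  have h2 : Primrec₂ fun (t : τ) (v : ℕ) =>
      if v = 0 ∨ ∃ i < (x t).words.num, ∃ j < (x t).words.len i + 1,
        (x t).words.digitLabelling (e t) i j = v then 1 else 0 :=
    Primrec.ite (h0.or h1) (.const 1) (.const 0)
  exact primrec_sum_nat (primrec_size hx) h2

end Primrec

/-! ### Ranks as folds over all labellings -/

/-- The number of generators read off from the `e`-th labelling, as computed by the algorithm. -/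
def RawInput.genCount (x : RawInput) (e : ℕ) : ℕ :=
  x.edgeCount e + 1 + factorRank x.words.num x.1 (x.words.edgeBound x.2.1) x.vec
    (x.words.edgeMatrix x.2.1 (x.words.digitLabelling e)) - x.vertCount e

theorem computable_genCount : Computable₂ RawInput.genCount := by
  have hx : Primrec fun y : RawInput × ℕ => y.1 := .fst
  have he : Primrec fun y : RawInput × ℕ => y.2 := .snd
  have h1 := primrec_edgeCount hx he
  have h2 := primrec_vertCount hx he
  have h3 := computable_factorRank (α := RawInput × ℕ) (q := fun y => y.1.words.num)
    (c := fun y => y.1.1) (u := fun y => y.1.words.edgeBound y.1.2.1) (A := fun y => y.1.vec)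
    (U := fun y => y.1.words.edgeMatrix y.1.2.1 (y.1.words.digitLabelling y.2))
    (primrec_num hx) (Primrec.fst.comp .fst) (primrec_edgeBound hx)
    (primrec_vec (Primrec.fst.comp .fst) (Primrec.fst.comp .snd) (Primrec.snd.comp .snd))
    (primrec_edgeMatrix (Primrec.fst.comp .fst) (Primrec.snd.comp .fst) (Primrec.fst.comp .snd)
      (Primrec.snd.comp .snd))
  exact Primrec.nat_sub.to_comp.comp (Primrec.nat_add.to_comp.comp (Primrec.succ.to_comp.comp
    h1.to_comp) h3) h2.to_comp

theorem computable_foldedRank : Computable₂ fun (x : RawInput) (e : ℕ) =>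
    x.words.foldedRank x.1 x.2.1 (x.words.digitLabelling e) x.vec := by
  have hx : Primrec fun y : RawInput × ℕ => y.1 := .fst
  exact computable_factorRank (α := RawInput × ℕ) (q := fun y => y.1.words.num)
    (c := fun y => y.1.words.edgeBound y.1.2.1 + y.1.1) (u := fun _ => 0)
    (A := fun y => y.1.words.fullMatrix y.1.2.1 (y.1.words.digitLabelling y.2) y.1.vec)
    (U := fun _ => 0)
    (primrec_num hx) (Primrec.nat_add.comp (primrec_edgeBound hx) (Primrec.fst.comp .fst))
    (.const 0)
    (primrec_fullMatrix (Primrec.fst.comp .fst) (Primrec.snd.comp .fst) (Primrec.fst.comp .snd)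
      (Primrec.snd.comp .snd)) (.const 0)

open Classical in
/-- The rank of the subgroup generated by the input, as computed by the algorithm. -/
def RawInput.rank (x : RawInput) : ℕ :=
  Nat.rec (motive := fun _ => ℕ) 0 (fun e s =>
    bif decide (x.words.Closed (x.words.digitLabelling e) ∧
      x.words.Folded (x.words.digitLabelling e)) then
      max s (x.words.foldedRank x.1 x.2.1 (x.words.digitLabelling e) x.vec) else s)
    x.words.labellingBound

open Classical in
/-- The least rank of a subgroup that contains the input, as computed by the algorithm. -/
def RawInput.compressedRank (x : RawInput) : ℕ :=
  Nat.rec (motive := fun _ => ℕ) (x.genCount 0) (fun e s =>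
    bif decide (x.words.Closed (x.words.digitLabelling e)) then min s (x.genCount e) else s)
    x.words.labellingBound

theorem computable_conditional_fold {α : Type*} [Primcodable α] {b g : α → ℕ} {c : α × ℕ → Bool}
    {w : α × ℕ → ℕ} {op : ℕ → ℕ → ℕ} (hb : Computable b) (hg : Computable g) (hc : Computable c)
    (hw : Computable w) (hop : Computable₂ op) : Computable fun x =>
      Nat.rec (motive := fun _ => ℕ) (g x)
        (fun e s => bif c (x, e) then op s (w (x, e)) else s) (b x) := by
  have h3 : Computable fun y : α × ℕ × ℕ => y.2.2 := Computable.snd.comp .snd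
  have h4 : Computable fun y : α × ℕ × ℕ => (y.1, y.2.1) :=
    Computable.fst.pair (Computable.fst.comp .snd)
  have h5 : Computable₂ fun (x : α) (p : ℕ × ℕ) =>
      bif c (x, p.1) then op p.2 (w (x, p.1)) else p.2 :=
    Computable.cond (hc.comp h4) (hop.comp h3 (hw.comp h4)) h3
  exact Computable.nat_rec hb hg h5

theorem computable_rank : Computable RawInput.rank := by
  classical
  have hx : Primrec fun y : RawInput × ℕ => y.1 := .fst
  have he : Primrec fun y : RawInput × ℕ => y.2 := .snd
  have h1 := ((primrecPred_closed hx he).and (primrecPred_folded hx he)).decide.to_comp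
  have h2 := (primrec_labellingBound (τ := RawInput) .id).to_comp
  have h := computable_conditional_fold h2 (.const 0) h1 computable_foldedRank
    Primrec.nat_max.to_comp
  refine h.of_eq fun x => ?_
  simp only [RawInput.rank, id]

theorem computable_compressedRank : Computable RawInput.compressedRank := by
  classical
  have hx : Primrec fun y : RawInput × ℕ => y.1 := .fst
  have he : Primrec fun y : RawInput × ℕ => y.2 := .snd
  have h1 := (primrecPred_closed hx he).decide.to_comp
  have h2 := (primrec_labellingBound (τ := RawInput) .id).to_comp
  have h := computable_conditional_fold h2 (computable_genCount.comp .id (.const 0)) h1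
    computable_genCount Primrec.nat_min.to_comp
  refine h.of_eq fun x => ?_
  simp only [RawInput.compressedRank, id]

theorem rec_max_spec (P : ℕ → Prop) [DecidablePred P] (w : ℕ → ℕ) (N k : ℕ)
    (hk : k = Nat.rec (motive := fun _ => ℕ) 0
      (fun e s => bif decide (P e) then max s (w e) else s) N) :
    (∀ e < N, P e → w e ≤ k) ∧ (k = 0 ∨ ∃ e < N, P e ∧ k = w e) := by
  induction N generalizing k with
  | zero => exact ⟨by simp, Or.inl hk⟩
  | succ N ih =>
    obtain ⟨h1, h2⟩ := ih _ rfl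
    generalize hs : (Nat.rec (motive := fun _ => ℕ) 0
      (fun e s => bif decide (P e) then max s (w e) else s) N : ℕ) = s at h1 h2
    have hk' : k = bif decide (P N) then max s (w N) else s := by rw [← hs]; exact hk
    clear hk hs
    subst hk'
    by_cases hN : P N
    · simp only [hN, decide_true, cond_true]
      refine ⟨fun e he hP => ?_, ?_⟩
      · rcases Nat.lt_succ_iff_lt_or_eq.1 he with he | rfl
        · exact (h1 e he hP).trans (le_max_left _ _)
        · exact le_max_right _ _
      · rcases le_total s (w N) with h | h
        · exact Or.inr ⟨N, by omega, hN, max_eq_right h⟩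
        · rw [max_eq_left h]
          rcases h2 with h2 | ⟨e, he, h2⟩
          · exact Or.inl h2
          · exact Or.inr ⟨e, by omega, h2⟩
    · simp only [hN, decide_false, cond_false]
      refine ⟨fun e he hP => ?_, ?_⟩
      · rcases Nat.lt_succ_iff_lt_or_eq.1 he with he | rfl
        · exact h1 e he hP
        · exact absurd hP hN
      · rcases h2 with h2 | ⟨e, he, h2⟩
        · exact Or.inl h2
        · exact Or.inr ⟨e, by omega, h2⟩

theorem rec_min_spec (P : ℕ → Prop) [DecidablePred P] (h0 : P 0) (w : ℕ → ℕ) (N k : ℕ)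
    (hk : k = Nat.rec (motive := fun _ => ℕ) (w 0)
      (fun e s => bif decide (P e) then min s (w e) else s) N) :
    (∀ e < N, P e → k ≤ w e) ∧ ∃ e, P e ∧ k = w e := by
  induction N generalizing k with
  | zero => exact ⟨by simp, 0, h0, hk⟩
  | succ N ih =>
    obtain ⟨h1, e₀, h2, h3⟩ := ih _ rfl
    generalize hs : (Nat.rec (motive := fun _ => ℕ) (w 0)
      (fun e s => bif decide (P e) then min s (w e) else s) N : ℕ) = s at h1 h2 h3
    have hk' : k = bif decide (P N) then min s (w N) else s := by rw [← hs]; exact hk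
    clear hk hs
    subst hk'
    by_cases hN : P N
    · simp only [hN, decide_true, cond_true]
      refine ⟨fun e he hP => ?_, ?_⟩
      · rcases Nat.lt_succ_iff_lt_or_eq.1 he with he | rfl
        · exact (min_le_left _ _).trans (h1 e he hP)
        · exact min_le_right _ _
      · rcases le_total s (w N) with h | h
        · exact ⟨e₀, h2, by rw [min_eq_left h, h3]⟩
        · exact ⟨N, hN, min_eq_right h⟩
    · simp only [hN, decide_false, cond_false]
      refine ⟨fun e he hP => ?_, e₀, h2, h3⟩
      rcases Nat.lt_succ_iff_lt_or_eq.1 he with he | rfl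
      · exact h1 e he hP
      · exact absurd hP hN

/-! ### The degree of compression as an attained supremum -/

theorem ratio_self (a : ℕ) : ratio a a = 1 := by
  unfold ratio
  split_ifs with h
  · rfl
  · exact ENNReal.div_self (by simpa using h) (ENNReal.natCast_ne_top a)

theorem ratio_anti {a b c : ℕ} (h : b ≤ c) : ratio a c ≤ ratio a b := by
  unfold ratio
  split_ifs with h1 h2 h2
  · exact le_rfl
  · omega
  · simp [h2.1]
  · exact ENNReal.div_le_div_left (by exact_mod_cast h) _

/-- The supremum in the degree of compression is attained at a subgroup of least reduced rank. -/
theorem dc_eq {Γ : Type*} [Group Γ] (H : Subgroup Γ) [Group.FG H] {c : ℕ}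
    (h1 : ∀ K : Subgroup Γ, H ≤ K → ∀ [Group.FG K], c ≤ redRank K)
    (h2 : ∃ K : Subgroup Γ, H ≤ K ∧ ∃ _ : Group.FG K, redRank K ≤ c) :
    dc H = ratio (redRank H) c := by
  obtain ⟨K, hK, hfg, hc⟩ := h2
  refine le_antisymm (iSup_le fun L => iSup_le fun hL => iSup_le fun hLfg => ratio_anti (h1 L hL))
    ((ratio_anti hc).trans ?_)
  exact le_iSup_of_le K (le_iSup_of_le hK (le_iSup_of_le hfg le_rfl))

theorem rank_closure_le_card {Γ : Type*} [Group Γ] (S : Finset Γ)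
    [Group.FG (Subgroup.closure (S : Set Γ))] :
    Group.rank (Subgroup.closure (S : Set Γ)) ≤ S.card := by
  convert Subgroup.rank_closure_finset_le_card S

/-- A subgroup of a group with at most one generator has at most one generator. -/
theorem rank_le_one_of_le_closure {Γ : Type*} [Group Γ] {H : Subgroup Γ} [Group.FG H]
    {S : Finset Γ} (hS : S.card ≤ 1) (h : H ≤ Subgroup.closure (S : Set Γ)) :
    Group.rank H ≤ 1 := by
  obtain ⟨g, hg⟩ : ∃ g : Γ, (S : Set Γ) ⊆ {g} := by
    rcases Nat.le_one_iff_eq_zero_or_eq_one.1 hS with h0 | h1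
    · exact ⟨1, by simp [Finset.card_eq_zero.1 h0]⟩
    · obtain ⟨g, rfl⟩ := Finset.card_eq_one.1 h1
      exact ⟨g, by simp⟩
  have hle : H ≤ Subgroup.zpowers g := by
    rw [Subgroup.zpowers_eq_closure]
    exact h.trans (Subgroup.closure_mono hg)
  have hcyc : IsCyclic H := by
    have := isCyclic_of_injective (Subgroup.inclusion hle) (Subgroup.inclusion_injective hle)
    exact this
  obtain ⟨x, hx⟩ := hcyc.exists_generator
  have : Subgroup.closure (({x} : Finset H) : Set H) = ⊤ := by
    rw [Finset.coe_singleton, ← Subgroup.zpowers_eq_closure, eq_top_iff]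
    exact fun y _ => hx y
  simpa using Group.rank_le this

/-! ### Correctness of the algorithm -/

namespace RawInput

variable {m n : ℕ} (g : List (Expr m n))

/-- The input of the algorithm for the subgroup generated by a list of expressions. -/
def ofExprs : RawInput := (m, n, code g)

theorem getD_code {i : ℕ} (hi : i < g.length) : (code g).getD i ([], []) =
    (List.ofFn (g[i]).1, (g[i]).2.map fun l => ((l.1 : ℕ), l.2)) := by
  simp [code, hi]

theorem num_ofExprs : (ofExprs g).words.num = g.length := by simp [ofExprs, words, code]

theorem len_ofExprs {i : ℕ} (hi : i < g.length) : (ofExprs g).words.len i = (g[i]).2.length := by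
  simp only [words, ofExprs, getD_code g hi, List.length_map]

theorem letter_ofExprs {i j : ℕ} (hi : i < g.length) (hj : j < (g[i]).2.length) :
    (ofExprs g).words.letter i j = (((g[i]).2[j].1 : ℕ), (g[i]).2[j].2) := by
  simp only [words, ofExprs, getD_code g hi]
  simp [hj]

theorem letter_lt : ∀ i < (ofExprs g).words.num, ∀ j < (ofExprs g).words.len i,
    ((ofExprs g).words.letter i j).1 < n := by
  intro i hi j hj
  rw [num_ofExprs] at hi
  rw [len_ofExprs g hi] at hj
  rw [letter_ofExprs g hi hj]
  exact Fin.isLt _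

theorem vec_ofExprs {i : ℕ} (hi : i < g.length) :
    (fun j : Fin m => (ofExprs g).vec i j) = (g[i]).1 := by
  ext j
  simp only [vec, ofExprs, getD_code g hi]
  simp

theorem letterVal_coe (l : Fin n × Bool) :
    letterVal n ((l.1 : ℕ), l.2) = FreeGroup.mk [l] := by
  obtain ⟨x, b⟩ := l
  cases b <;> simp [letterVal, gen, FreeGroup.of, FreeGroup.inv_mk, FreeGroup.invRev]

theorem pre_ofExprs {i : ℕ} (hi : i < g.length) (j : ℕ) (hj : j ≤ (g[i]).2.length) :
    (ofExprs g).words.pre n i j = FreeGroup.mk ((g[i]).2.take j) := by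
  induction j with
  | zero => rfl
  | succ j ih =>
    rw [WordData.pre, ih (by omega), letter_ofExprs g hi hj, letterVal_coe, FreeGroup.mul_mk,
      List.take_concat_get']

theorem subgroup_ofExprs :
    (ofExprs g).words.subgroup (fun i (j : Fin m) => (ofExprs g).vec i j) = generated g := by
  unfold WordData.subgroup generated
  congr 1
  have key : ∀ i (hi : i < g.length), elt (fun j : Fin m => (ofExprs g).vec i j)
      ((ofExprs g).words.pre n i ((ofExprs g).words.len i)) = (g[i]).eval := by
    intro i hi
    rw [vec_ofExprs g hi, len_ofExprs g hi, pre_ofExprs g hi _ le_rfl, List.take_length]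
    rfl
  ext x
  constructor
  · rintro ⟨i, hi, rfl⟩
    rw [Set.mem_Iio, num_ofExprs] at hi
    exact ⟨⟨i, hi⟩, (key i hi).symm⟩
  · rintro ⟨i, rfl⟩
    exact ⟨i, by rw [Set.mem_Iio, num_ofExprs]; exact i.2, key i i.2⟩

theorem genCount_ofExprs (e : ℕ) : (ofExprs g).genCount e =
    (ofExprs g).words.labellingRank m n ((ofExprs g).words.digitLabelling e) (ofExprs g).vec := by
  have hlt : ∀ i < (ofExprs g).words.num, ∀ j ≤ (ofExprs g).words.len i,
      (ofExprs g).words.digitLabelling e i j < (ofExprs g).words.size :=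
    fun i _ j _ => WordData.digitLabelling_lt e i j
  unfold genCount WordData.labellingRank
  rw [card_edges_eq hlt (letter_lt g), card_verts_eq hlt]
  congr!

theorem closed_digitLabelling_zero (W : WordData) : W.Closed (W.digitLabelling 0) :=
  fun i _ => by simp [WordData.digitLabelling]

/-- Every closed folded labelling gives a lower bound for the rank, and the coset labelling of the
subgroup itself gives an upper bound, so the maximum is the rank. -/
theorem rank_ofExprs : (ofExprs g).rank = Group.rank (generated g) := by
  classical
  have hfg : Group.FG
      ((ofExprs g).words.subgroup (n := n) (fun i (j : Fin m) => (ofExprs g).vec i j)) := by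
    rw [subgroup_ofExprs]; infer_instance
  have hr := Subgroup.rank_congr (subgroup_ofExprs g)
  obtain ⟨h1, h2⟩ := rec_max_spec
    (fun e => (ofExprs g).words.Closed ((ofExprs g).words.digitLabelling e) ∧
      (ofExprs g).words.Folded ((ofExprs g).words.digitLabelling e))
    (fun e => (ofExprs g).words.foldedRank m n ((ofExprs g).words.digitLabelling e)
      (ofExprs g).vec) (ofExprs g).words.labellingBound (ofExprs g).rank
    (by unfold rank; congr!)
  apply le_antisymm
  · rcases h2 with h2 | ⟨e, -, ⟨hcl, hfo⟩, h2⟩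
    · omega
    · rw [h2, ← hr]
      exact WordData.foldedRank_le (letter_lt g) (ofExprs g).vec hcl hfo
  · obtain ⟨e, he, hcl, hfo, -, h⟩ := WordData.exists_labelling_of_le (letter_lt g) (ofExprs g).vec
      (generated g) (subgroup_ofExprs g).le
    exact (h (subgroup_ofExprs g).symm).trans (h1 e he ⟨hcl, hfo⟩)

/-- Every closed labelling gives generators of an overgroup, and each overgroup K has a closed
labelling that needs no more than rank K of them. The fold starts at the labelling 0, which is
closed since every label is 0. -/
theorem compressedRank_ofExprs :
    (∀ K : Subgroup (G m n), generated g ≤ K → ∀ [Group.FG K],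
      (ofExprs g).compressedRank ≤ Group.rank K) ∧
    ∃ S : Finset (G m n), S.card ≤ (ofExprs g).compressedRank ∧
      generated g ≤ Subgroup.closure (S : Set (G m n)) := by
  classical
  obtain ⟨h1, e, h2, h3⟩ := rec_min_spec
    (fun e => (ofExprs g).words.Closed ((ofExprs g).words.digitLabelling e))
    (closed_digitLabelling_zero _) (ofExprs g).genCount (ofExprs g).words.labellingBound
    (ofExprs g).compressedRank (by unfold compressedRank; congr!)
  constructor
  · intro K hK _
    obtain ⟨e, he, hcl, -, h, -⟩ := WordData.exists_labelling_of_le (letter_lt g) (ofExprs g).vec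
      K ((subgroup_ofExprs g).le.trans hK)
    exact (h1 e he hcl).trans ((genCount_ofExprs g e).le.trans h)
  · obtain ⟨S, hS, h⟩ := WordData.exists_generators_card_le (letter_lt g) (ofExprs g).vec h2
    rw [h3, genCount_ofExprs, ← subgroup_ofExprs]
    exact ⟨S, hS, h⟩

/-- The output of the algorithm: the degree of compression as a fraction. -/
def answer (x : RawInput) : ℕ × ℕ :=
  -- If some overgroup has at most one generator, the subgroup is cyclic and 0/0 = 1; the output 1/1
  -- keeps the denominator nonzero.
  Nat.casesOn (x.compressedRank - 1) (1, 1) fun c => (x.rank - 1, c + 1)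

theorem computable_answer : Computable answer := by
  have h1 : Computable fun x : RawInput => x.compressedRank - 1 :=
    Primrec.nat_sub.to_comp.comp computable_compressedRank (.const 1)
  have h2 : Computable fun x : RawInput => x.rank - 1 :=
    Primrec.nat_sub.to_comp.comp computable_rank (.const 1)
  have h3 : Computable₂ fun (x : RawInput) (c : ℕ) => (x.rank - 1, c + 1) :=
    (h2.comp .fst).pair (Computable.succ.comp .snd)
  exact Computable.nat_casesOn h1 (.const (1, 1)) h3

theorem answer_spec : (answer (ofExprs g)).2 ≠ 0 ∧
    dc (generated g) = ((answer (ofExprs g)).1 : ℝ≥0∞) / ((answer (ofExprs g)).2 : ℝ≥0∞) := by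
  obtain ⟨h1, S, hS, h2⟩ := compressedRank_ofExprs g
  have hdc : dc (generated g) = ratio (redRank (generated g)) ((ofExprs g).compressedRank - 1) := by
    apply dc_eq
    · intro K hK _
      exact Nat.sub_le_sub_right (h1 K hK) 1
    · have hfg : Group.FG (Subgroup.closure (S : Set (G m n))) := Group.closure_finset_fg S
      exact ⟨_, h2, hfg, Nat.sub_le_sub_right ((rank_closure_le_card S).trans hS) 1⟩
  have hr := rank_ofExprs g
  unfold answer
  rw [hdc]
  cases hc : (ofExprs g).compressedRank - 1 with
  | zero =>
    have h0 : redRank (generated g) = 0 := by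
      have := rank_le_one_of_le_closure (hS.trans (by omega)) h2
      unfold redRank
      omega
    simp [h0, ratio_self]
  | succ c => simp [ratio, redRank, hr]

end RawInput

/-! ### Ranks of free groups and of their free factors -/

section FreeGroupBasis

variable {Γ ι : Type*} [Group Γ]

theorem closure_range_basis (b : FreeGroupBasis ι Γ) : Subgroup.closure (Set.range b) = ⊤ := by
  have h : Set.range b = b.repr.symm.toMonoidHom '' Set.range FreeGroup.of := by
    rw [← Set.range_comp]
    congr 1
  rw [h, ← MonoidHom.map_closure, FreeGroup.closure_range_of, ← MonoidHom.range_eq_map,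
    MonoidHom.range_eq_top]
  exact b.repr.symm.surjective

theorem lift_basis_apply {Δ : Type*} [Group Δ] (b : FreeGroupBasis ι Γ) (f : ι → Δ) (i : ι) :
    b.lift f (b i) = f i := by
  rw [FreeGroupBasis.lift_apply_apply, FreeGroupBasis.repr_apply_coe, FreeGroup.lift_apply_of]

theorem finite_and_card_le_rank {V : Type*} [Group.FG Γ] [AddCommGroup V]
    (φ : Γ →* Multiplicative V) (x : ι → Γ)
    (h : LinearIndependent ℤ fun i => (φ (x i)).toAdd) :
    Finite ι ∧ Nat.card ι ≤ Group.rank Γ := by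
  obtain ⟨w, hw⟩ := exists_span_of_rank φ
  have hfin : Finite ι := h.finite_of_le_span_finite _ (Set.range w)
    (by rintro _ ⟨i, rfl⟩; exact hw _)
  have := Fintype.ofFinite ι
  refine ⟨hfin, ?_⟩
  rw [Nat.card_eq_fintype_card]
  simpa using card_le_of_linearIndependent_of_mem_span h fun i => hw _

/-- The conditions that φ kills y and ψ kills x make the joint family independent in V × W, so the
two lower bounds add up. -/
theorem finite_and_card_le_rank_of_prod {κ V W : Type*} [Group.FG Γ] [AddCommGroup V]
    [AddCommGroup W] (φ : Γ →* Multiplicative V) (ψ : Γ →* Multiplicative W) (x : ι → Γ) (y : κ → Γ)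
    (hx : LinearIndependent ℤ fun i => (φ (x i)).toAdd)
    (hy : LinearIndependent ℤ fun k => (ψ (y k)).toAdd) (hx' : ∀ i, ψ (x i) = 1)
    (hy' : ∀ k, φ (y k) = 1) :
    Finite ι ∧ Finite κ ∧ Nat.card ι + Nat.card κ ≤ Group.rank Γ := by
  obtain ⟨h1, h2⟩ := finite_and_card_le_rank
    ((MulEquiv.prodMultiplicative (G := V) (H := W)).symm.toMonoidHom.comp (φ.prod ψ))
    (Sum.elim x y) (by
      have h := linearIndependent_inl_union_inr' hx hy
      have he : (fun i => (((MulEquiv.prodMultiplicative (G := V) (H := W)).symm.toMonoidHom.comp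
          (φ.prod ψ)) (Sum.elim x y i)).toAdd) =
          Sum.elim (LinearMap.inl ℤ V W ∘ fun i => (φ (x i)).toAdd)
            (LinearMap.inr ℤ V W ∘ fun k => (ψ (y k)).toAdd) := by
        ext i : 1
        rcases i with i | k
        · exact Prod.ext rfl (congrArg Multiplicative.toAdd (hx' i))
        · exact Prod.ext (congrArg Multiplicative.toAdd (hy' k)) rfl
      rw [he]
      convert h)
  have hι : Finite ι := Finite.of_injective _ (Sum.inl_injective (β := κ))
  have hκ : Finite κ := Finite.of_injective _ (Sum.inr_injective (α := ι))
  exact ⟨hι, hκ, by rwa [← Nat.card_sum]⟩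

theorem finite_and_card_eq_rank (b : FreeGroupBasis ι Γ) [Group.FG Γ] :
    Finite ι ∧ Nat.card ι = Group.rank Γ := by
  classical
  obtain ⟨h1, h2⟩ := finite_and_card_le_rank
    (b.lift fun i => Multiplicative.ofAdd (Finsupp.single i (1 : ℤ))) b (by
      simpa only [lift_basis_apply, toAdd_ofAdd] using Finsupp.linearIndependent_single_one ℤ ι)
  refine ⟨h1, h2.antisymm ?_⟩
  have := Fintype.ofFinite ι
  have hcl : Subgroup.closure ((Finset.univ.image b : Finset Γ) : Set Γ) = ⊤ := by
    rw [Finset.coe_image, Finset.coe_univ, Set.image_univ, closure_range_basis]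
  refine (Group.rank_le hcl).trans ?_
  rw [Nat.card_eq_fintype_card]
  exact Finset.card_image_le

end FreeGroupBasis

/-- A proper free factor of a finitely generated subgroup of a free group is finitely generated, of
smaller rank. -/
theorem IsInternalFreeProduct.rank_lt {F : Type*} [Group F] [IsFreeGroup F] {J A B : Subgroup F}
    [Group.FG J] (h : IsInternalFreeProduct J A B) (hB : B ≠ ⊥) :
    ∃ _ : Group.FG A, Group.rank A < Group.rank J := by
  obtain ⟨hinj, rfl⟩ := h
  let e := MonoidHom.ofInjective hinj
  have hfg : Group.FG (Monoid.Coprod A B) := Group.fg_of_surjective (f := e.symm.toMonoidHom)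
    e.symm.surjective
  have hA : Group.FG A := Group.fg_of_surjective (f := (Monoid.Coprod.fst : Monoid.Coprod A B →* A))
    fun a => ⟨Monoid.Coprod.inl a, by simp⟩
  refine ⟨hA, ?_⟩
  rw [← Group.rank_congr e]
  let bA := IsFreeGroup.basis A
  let bB := IsFreeGroup.basis B
  -- The abelianizations of A and B, each extended trivially to the other factor, separate the two
  -- bases.
  obtain ⟨hfA, hfB, h2⟩ := finite_and_card_le_rank_of_prod
    (Monoid.Coprod.lift (bA.lift fun i => Multiplicative.ofAdd (Finsupp.single i (1 : ℤ))) 1)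
    (Monoid.Coprod.lift 1 (bB.lift fun i => Multiplicative.ofAdd (Finsupp.single i (1 : ℤ))))
    (fun i => Monoid.Coprod.inl (bA i)) (fun i => Monoid.Coprod.inr (bB i))
    (by simpa only [Monoid.Coprod.lift_apply_inl, lift_basis_apply, toAdd_ofAdd] using
      Finsupp.linearIndependent_single_one ℤ (IsFreeGroup.Generators A))
    (by simpa only [Monoid.Coprod.lift_apply_inr, lift_basis_apply, toAdd_ofAdd] using
      Finsupp.linearIndependent_single_one ℤ (IsFreeGroup.Generators B))
    (fun i => by simp) (fun i => by simp)
  have hne : Nonempty (IsFreeGroup.Generators B) := by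
    by_contra hne
    rw [not_nonempty_iff] at hne
    have := closure_range_basis bB
    rw [Set.range_eq_empty, Subgroup.closure_empty] at this
    have : Subsingleton B := (Subgroup.subsingleton_iff).1 (subsingleton_of_bot_eq_top this)
    exact hB ((Subgroup.eq_bot_iff_forall _).2 fun x hx =>
      congrArg Subtype.val (Subsingleton.elim (⟨x, hx⟩ : B) 1))
  rw [(finite_and_card_eq_rank bA).2] at h2
  have := Nat.card_pos (α := IsFreeGroup.Generators B)
  omega

/-! ### Ranks in ℤ^m × F_n and algebraic extensions -/

section Rank

variable {m n : ℕ}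

instance fg_proj (K : Subgroup (G m n)) [Group.FG K] : Group.FG (proj K) :=
  Group.fg_of_surjective (MonoidHom.subgroupMap_surjective (MonoidHom.snd _ _) K)

theorem proj_mono {H K : Subgroup (G m n)} (h : H ≤ K) : proj H ≤ proj K := Subgroup.map_mono h

theorem lattice_mono {H K : Subgroup (G m n)} (h : H ≤ K) : lattice H ≤ lattice K :=
  fun _ ha => h ha

/-- Freeness of Kπ splits K over its projection, and the splitting gives a homomorphism to ℤ^m that
is the identity on K ∩ ℤ^m and kills the lifts of a basis. Together with the abelianization of Kπ it
detects both ranks at once. -/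
theorem rank_proj_add_finrank_lattice_le (K : Subgroup (G m n)) [Group.FG K] :
    Group.rank (proj K) + Module.finrank ℤ (lattice K) ≤ Group.rank K := by
  let b := IsFreeGroup.basis (proj K)
  let π : K →* proj K := (MonoidHom.snd _ _).subgroupMap K
  have hlift : ∀ i, ∃ x : K, π x = b i := fun i => MonoidHom.subgroupMap_surjective _ K (b i)
  choose x hx using hlift
  let ψ : proj K →* Multiplicative (Fin m → ℤ) := b.lift fun i => (x i : G m n).1
  -- Subtracting the abelian part of the chosen section makes φ vanish on the lifts x i.
  let φ : K →* Multiplicative (Fin m → ℤ) := ((MonoidHom.fst _ _).comp K.subtype) / (ψ.comp π)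
  let c := Module.finBasis ℤ (lattice K)
  let y : Fin (Module.finrank ℤ (lattice K)) → K := fun t => ⟨elt (c t : Fin m → ℤ) 1, (c t).2⟩
  have hy : ∀ t, π (y t) = 1 := fun t => rfl
  have hc : LinearIndependent ℤ fun t => (c t : Fin m → ℤ) :=
    c.linearIndependent.map' (lattice K).subtype (Submodule.ker_subtype _)
  obtain ⟨-, -, h⟩ := finite_and_card_le_rank_of_prod
    ((b.lift fun i => Multiplicative.ofAdd (Finsupp.single i (1 : ℤ))).comp π) φ x y
    (by simpa only [MonoidHom.comp_apply, hx, lift_basis_apply, toAdd_ofAdd] using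
      Finsupp.linearIndependent_single_one ℤ (IsFreeGroup.Generators (proj K)))
    (by
      have he : (fun t => (φ (y t)).toAdd) = fun t => (c t : Fin m → ℤ) := by
        ext1 t
        simp only [φ, MonoidHom.div_apply, MonoidHom.comp_apply, hy, map_one, div_one]
        rfl
      rw [he]
      exact hc)
    (fun i => by simp [φ, ψ, hx])
    (fun t => by rw [MonoidHom.comp_apply, hy, map_one])
  rw [(finite_and_card_eq_rank b).2] at h
  simpa using h

/-- Generators for the subgroup given by lifts of `v` and by a lattice `L`. -/
theorem exists_generators_card_le {p : ℕ} (v : Fin p → FreeGroup (Fin n))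
    (C : Fin p → Fin m → ℤ) (L : Submodule ℤ (Fin m → ℤ)) :
    ∃ S : Finset (G m n), S.card ≤ p + Module.finrank ℤ L ∧
      (∀ k, elt (C k) (v k) ∈ Subgroup.closure (S : Set (G m n))) ∧
      L ≤ lattice (Subgroup.closure (S : Set (G m n))) ∧
      ∀ D : Subgroup (G m n), (∀ k, elt (C k) (v k) ∈ D) → L ≤ lattice D →
        Subgroup.closure (S : Set (G m n)) ≤ D := by
  classical
  let c := Module.finBasis ℤ L
  refine ⟨Finset.univ.image (fun k => elt (C k) (v k)) ∪
    Finset.univ.image (fun t => elt (c t : Fin m → ℤ) 1), ?_, ?_, ?_, ?_⟩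
  · refine (Finset.card_union_le _ _).trans (add_le_add ?_ ?_)
    · simpa using Finset.card_image_le (s := Finset.univ) (f := fun k => elt (C k) (v k))
    · simpa using Finset.card_image_le (s := Finset.univ)
        (f := fun t => (elt (c t : Fin m → ℤ) 1 : G m n))
  · exact fun k => Subgroup.subset_closure (by simp)
  · intro l hl
    have := congrArg Subtype.val (c.sum_repr ⟨l, hl⟩)
    simp only [Submodule.coe_sum, Submodule.coe_smul] at this
    rw [← this]
    exact Submodule.sum_mem _ fun t _ => Submodule.smul_mem _ _
      (mem_lattice.2 (Subgroup.subset_closure (by simp)))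
  · intro D h1 h2
    rw [Subgroup.closure_le]
    intro x hx
    simp only [Finset.coe_union, Finset.coe_image, Finset.coe_univ, Set.image_univ] at hx
    rcases hx with ⟨k, rfl⟩ | ⟨t, rfl⟩
    · exact h1 k
    · exact h2 (c t).2

theorem abelianize_mul {p : ℕ} (w w' : FreeGroup (Fin p)) :
    abelianize (w * w') = abelianize w + abelianize w' := by
  simp [abelianize]

theorem abelianize_of {p : ℕ} (k : Fin p) : abelianize (FreeGroup.of k) = Pi.single k 1 := by
  simp [abelianize]

/-- If `K` contains lifts of the elements of a free basis of `J`, then it contains a lift of every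
element of `J`. -/
theorem elt_vecMul_mem {K : Subgroup (G m n)} {J : Subgroup (FreeGroup (Fin n))} {p : ℕ}
    (v : FreeGroupBasis (Fin p) J) (C : Matrix (Fin p) (Fin m) ℤ)
    (h : ∀ k, elt (C k) (v k : FreeGroup (Fin n)) ∈ K) (x : J) :
    elt (Matrix.vecMul (abelianize (v.repr x)) C) (x : FreeGroup (Fin n)) ∈ K := by
  let η : J →* G m n := MonoidHom.mk'
    (fun x => elt (Matrix.vecMul (abelianize (v.repr x)) C) (x : FreeGroup (Fin n))) fun x y => by
      rw [map_mul, abelianize_mul, Matrix.add_vecMul, elt_mul, Subgroup.coe_mul]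
  have hle : Subgroup.closure (Set.range v) ≤ K.comap η := by
    rw [Subgroup.closure_le]
    rintro _ ⟨k, rfl⟩
    change elt (Matrix.vecMul (abelianize (v.repr (v k))) C) (v k : FreeGroup (Fin n)) ∈ K
    rw [FreeGroupBasis.repr_apply_coe, abelianize_of, Matrix.single_one_vecMul]
    exact h k
  rw [closure_range_basis] at hle
  exact hle (Subgroup.mem_top x)

/-- Between a finitely generated subgroup and a subgroup that contains it there is an algebraic
extension whose rank is at most that of the latter. -/
theorem exists_algebraicExtension_le {F : Type*} [Group F] [IsFreeGroup F] {P Q : Subgroup F}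
    [hP : Group.FG P] [hQ : Group.FG Q] (h : P ≤ Q) :
    ∃ J : AE P, (J : Subgroup F) ≤ Q ∧ Group.rank (J : Subgroup F) ≤ Group.rank Q := by
  classical
  -- A J of least rank is algebraic: a proper free factor of J containing P would still lie between
  -- P and Q, with smaller rank.
  have hex : ∃ k, ∃ J : Subgroup F, P ≤ J ∧ J ≤ Q ∧ ∃ _ : Group.FG J, Group.rank J = k :=
    ⟨_, Q, h, le_rfl, hQ, rfl⟩
  obtain ⟨J, hPJ, hJQ, hJ, hk⟩ := Nat.find_spec hex
  refine ⟨⟨J, hP, hJ, hPJ, fun A B hAB hPA => ?_⟩, hJQ, ?_⟩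
  · by_contra hB
    obtain ⟨hA, hlt⟩ := hAB.rank_lt hB
    have hAJ : A ≤ J := by
      intro a ha
      rw [← hAB.2]
      exact ⟨Monoid.Coprod.inl ⟨a, ha⟩, by simp⟩
    exact Nat.find_min hex (hlt.trans_eq hk) ⟨A, hPA, hAJ.trans hJQ, hA, rfl⟩
  · exact hk.le.trans (Nat.find_min' hex ⟨Q, h, le_rfl, hQ, rfl⟩)

theorem rank_pos_of_ne_bot {Γ : Type*} [Group Γ] {P J : Subgroup Γ} [Group.FG J] (hP : P ≠ ⊥)
    (h : P ≤ J) : 0 < Group.rank J := by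
  rw [Nat.pos_iff_ne_zero, Ne, Group.rank_eq_zero_iff]
  intro hs
  refine hP ((Subgroup.eq_bot_iff_forall _).2 fun x hx => ?_)
  exact congrArg Subtype.val (Subsingleton.elim (⟨x, h hx⟩ : J) 1)

end Rank

/-! ### The formula for the degree of compression -/

section Compression

variable {m n r s : ℕ} {H : Subgroup (G m n)}

/-- A finitely generated subgroup of `ℤ^m` is not compressed at all. -/
theorem dc_eq_one_of_proj_eq_bot [Group.FG H] (h : proj H = ⊥) : dc H = 1 := by
  rw [← ratio_self (redRank H)]
  apply dc_eq H _ ⟨H, le_rfl, inferInstance, le_rfl⟩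
  intro K hK _
  apply Nat.sub_le_sub_right
  -- With no free lifts, a basis of the lattice alone generates H, so the rank of H is at most the
  -- rank of its lattice, which embeds in that of K.
  obtain ⟨S, hS, -, h1, h2⟩ := exists_generators_card_le (n := n) Fin.elim0 Fin.elim0 (lattice H)
  have hH : Subgroup.closure (S : Set (G m n)) = H := by
    refine le_antisymm (h2 H (fun k => k.elim0) le_rfl) fun x hx => ?_
    obtain ⟨a, u⟩ := x
    have hu : u ∈ proj H := ⟨_, hx, rfl⟩
    rw [h, Subgroup.mem_bot] at hu
    subst hu
    exact h1 (mem_lattice.2 hx)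
  have hfg : Group.FG (Subgroup.closure (S : Set (G m n))) := Group.closure_finset_fg S
  have h3 := rank_proj_add_finrank_lattice_le K
  have h4 := Submodule.finrank_mono (lattice_mono hK)
  have h5 := rank_closure_le_card S
  rw [Subgroup.rank_congr hH] at h5
  omega

theorem SubgroupBasis.elt_u_mem (β : SubgroupBasis H r s) (i : Fin r) :
    elt (β.A i) (β.u i : FreeGroup (Fin n)) ∈ H :=
  β.closure_eq.le (Subgroup.subset_closure (Or.inl ⟨i, rfl⟩))

variable (β : SubgroupBasis H r s) (J : AE (proj H)) {p : ℕ}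
  (v : FreeGroupBasis (Fin p) (J : Subgroup (FreeGroup (Fin n))))

theorem SubgroupBasis.exists_d_eq : ∃ L : Submodule ℤ (Fin m → ℤ),
    Module.finrank ℤ L = d β.A β.B (β.U J v) ∧ rowSpan β.B ≤ L ∧
      ∃ C : Matrix (Fin p) (Fin m) ℤ, rowSpan (β.A - β.U J v * C) ≤ L :=
  Nat.sInf_mem (s := {k | ∃ L : Submodule ℤ (Fin m → ℤ), Module.finrank ℤ L = k ∧
    rowSpan β.B ≤ L ∧ ∃ C : Matrix (Fin p) (Fin m) ℤ, rowSpan (β.A - β.U J v * C) ≤ L})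
    ⟨_, ⊤, rfl, le_top, 0, le_top⟩

/-- An optimal lattice L and the lifts of the basis of J with abelian parts C generate an overgroup:
each t^{a_i} u_i is the lift of u_i with abelian part (U C)_i, corrected by an element of L.
Positivity of rank J turns rank J + d - 1 into r̃(J) + d. -/
theorem SubgroupBasis.exists_compression [Group.FG H] (h : proj H ≠ ⊥) :
    ∃ K : Subgroup (G m n), H ≤ K ∧ ∃ _ : Group.FG K,
      redRank K ≤ redRank (J : Subgroup (FreeGroup (Fin n))) + d β.A β.B (β.U J v) := by
  obtain ⟨L, hL, hB, C, hC⟩ := β.exists_d_eq J v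
  obtain ⟨S, hS, h1, h2, -⟩ := exists_generators_card_le (fun k => (v k : FreeGroup (Fin n))) C L
  have hfg : Group.FG (Subgroup.closure (S : Set (G m n))) := Group.closure_finset_fg S
  refine ⟨Subgroup.closure (S : Set (G m n)), ?_, hfg, ?_⟩
  · refine β.closure_eq.ge.trans ((Subgroup.closure_le _).2 ?_)
    rintro _ (⟨i, rfl⟩ | ⟨j, rfl⟩)
    · have h3 := mem_lattice.1 (h2 (hC (Submodule.subset_span ⟨i, rfl⟩)))
      have h4 := elt_vecMul_mem v C h1 ⟨(β.u i : FreeGroup (Fin n)), J.2.le (β.u i).2⟩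
      have h5 := mul_mem h3 h4
      rw [elt_mul, one_mul] at h5
      have h6 : (β.A - β.U J v * C).row i + Matrix.vecMul (abelianize (v.repr
          ⟨(β.u i : FreeGroup (Fin n)), J.2.le (β.u i).2⟩)) C = β.A i := sub_add_cancel (β.A i) _
      rwa [h6] at h5
    · exact mem_lattice.1 (h2 (hB (Submodule.subset_span ⟨j, rfl⟩)))
  · have h3 := (finite_and_card_eq_rank v).2
    have h4 := rank_pos_of_ne_bot h J.2.le
    have h5 := rank_closure_le_card S
    rw [Nat.card_fin] at h3
    unfold redRank
    omega

/-- Any lifts into K of the basis of J define C. The lift of u_i that they produce differs from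
t^{a_i} u_i, which is also in K, by an element of K ∩ ℤ^m, so this lattice is admissible. -/
theorem SubgroupBasis.d_le {K : Subgroup (G m n)} (hK : H ≤ K)
    (hJ : (J : Subgroup (FreeGroup (Fin n))) ≤ proj K) :
    d β.A β.B (β.U J v) ≤ Module.finrank ℤ (lattice K) := by
  have hex : ∀ k, ∃ a, elt a (v k : FreeGroup (Fin n)) ∈ K := fun k => mem_proj.1 (hJ (v k).2)
  choose C hC using hex
  refine Nat.sInf_le ⟨lattice K, rfl, ?_, Matrix.of C, ?_⟩
  · refine Submodule.span_le.2 ?_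
    rintro _ ⟨j, rfl⟩
    exact lattice_mono hK (β.b j).2
  · refine Submodule.span_le.2 ?_
    rintro _ ⟨i, rfl⟩
    have h1 := elt_vecMul_mem v (Matrix.of C) hC ⟨(β.u i : FreeGroup (Fin n)), J.2.le (β.u i).2⟩
    have h2 := mul_mem (hK (β.elt_u_mem i)) (inv_mem h1)
    rw [elt_inv, elt_mul, mul_inv_cancel, ← sub_eq_add_neg] at h2
    exact mem_lattice.2 h2

/-- The degree of compression of a subgroup that is not contained in `ℤ^m`, or is trivial. -/
theorem SubgroupBasis.dc_eq_ratio [Group.FG H] (p : AE (proj H) → ℕ)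
    (v : ∀ J : AE (proj H), FreeGroupBasis (Fin (p J)) (J : Subgroup (FreeGroup (Fin n))))
    (h : proj H ≠ ⊥ ∨ H = ⊥) : ∃ N : ℕ,
      IsLeast (Set.range fun J : AE (proj H) =>
        redRank (J : Subgroup (FreeGroup (Fin n))) + d β.A β.B (β.U J (v J))) N ∧
      dc H = ratio (redRank H) N := by
  by_cases hb : proj H = ⊥
  -- For trivial H the minimum is 0, attained at J = 1 because the lattice is zero, and the
  -- convention 0/0 = 1 gives the value.
  · obtain rfl := h.resolve_left fun h => h hb
    have hfg : Group.FG (⊥ : Subgroup (FreeGroup (Fin n))) := Group.fg_of_finite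
    have hAE : (⊥ : Subgroup (FreeGroup (Fin n))) ∈ AE (proj (⊥ : Subgroup (G m n))) := by
      refine ⟨inferInstance, hfg, hb.le, fun A B hAB _ => ?_⟩
      rw [eq_bot_iff, ← hAB.2]
      exact fun b hb => ⟨Monoid.Coprod.inr ⟨b, hb⟩, by simp⟩
    have hlat : Module.finrank ℤ (lattice (⊥ : Subgroup (G m n))) = 0 := by
      have : lattice (⊥ : Subgroup (G m n)) = ⊥ := by
        refine (Submodule.eq_bot_iff _).2 fun a ha => ?_
        exact congrArg Prod.fst (Subgroup.mem_bot.1 (mem_lattice.1 ha))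
      rw [this, finrank_bot]
    have hd := β.d_le ⟨⊥, hAE⟩ (v ⟨⊥, hAE⟩) le_rfl bot_le
    have h0 : Group.rank (⊥ : Subgroup (FreeGroup (Fin n))) = 0 :=
      Group.rank_eq_zero_iff.2 inferInstance
    have h1 : Group.rank (⊥ : Subgroup (G m n)) = 0 := Group.rank_eq_zero_iff.2 inferInstance
    refine ⟨0, ⟨⟨⟨⊥, hAE⟩, ?_⟩, fun _ _ => Nat.zero_le _⟩, ?_⟩
    · change redRank (⊥ : Subgroup (FreeGroup (Fin n))) + _ = 0
      unfold redRank
      omega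
    · rw [dc_eq_one_of_proj_eq_bot hb, redRank, h1, ratio_self]
  · have hne : (Set.range fun J : AE (proj H) =>
        redRank (J : Subgroup (FreeGroup (Fin n))) + d β.A β.B (β.U J (v J))).Nonempty := by
      obtain ⟨J, -⟩ := exists_algebraicExtension_le (le_refl (proj H))
      exact ⟨_, J, rfl⟩
    refine ⟨_, ⟨Nat.sInf_mem hne, fun _ h => Nat.sInf_le h⟩, dc_eq H ?_ ?_⟩
    · intro K hK _
      obtain ⟨J, hJ, hr⟩ := exists_algebraicExtension_le (proj_mono hK)
      have h0 := Nat.sInf_le (Set.mem_range_self (f := fun J : AE (proj H) =>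
        redRank (J : Subgroup (FreeGroup (Fin n))) + d β.A β.B (β.U J (v J))) J)
      refine h0.trans ?_
      have h1 := β.d_le J (v J) hK hJ
      have h2 := rank_proj_add_finrank_lattice_le K
      have h3 := rank_pos_of_ne_bot hb J.2.le
      unfold redRank
      omega
    · obtain ⟨J, hJ⟩ := Nat.sInf_mem hne
      dsimp only at hJ
      rw [← hJ]
      exact β.exists_compression J (v J) hb

end Compression

end FATF
end

theorem theorem1p9 :
    -- the formula, for every basis of `H` and every choice of free bases of the extensions `J`
    (∀ (m n : ℕ) (H : Subgroup (FATF.G m n)) [Group.FG H] (r s : ℕ)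
      (β : FATF.SubgroupBasis H r s)
      (p : FATF.AE (FATF.proj H) → ℕ)
      (v : ∀ J : FATF.AE (FATF.proj H),
        FreeGroupBasis (Fin (p J)) (J : Subgroup (FreeGroup (Fin n)))),
      FATF.proj H ≠ ⊥ ∨ H = ⊥ →
        ∃ N : ℕ,
          IsLeast (Set.range fun J : FATF.AE (FATF.proj H) =>
            FATF.redRank (J : Subgroup (FreeGroup (Fin n))) +
              FATF.d β.A β.B (β.U J (v J))) N ∧
          FATF.dc H = FATF.ratio (FATF.redRank H) N) ∧
    -- the remaining subgroups, those contained in `ℤ^m`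
    (∀ (m n : ℕ) (H : Subgroup (FATF.G m n)) [Group.FG H],
      FATF.proj H = ⊥ → FATF.dc H = 1) ∧
    -- one algorithm that computes `dc` from `m`, `n` and generators, as a fraction
    (∃ F : ℕ × ℕ × List (List ℤ × List (ℕ × Bool)) → ℕ × ℕ,
      Computable F ∧
      ∀ (m n : ℕ) (g : List (FATF.Expr m n)),
        (F (m, n, FATF.code g)).2 ≠ 0 ∧
        FATF.dc (FATF.generated g) =
          ((F (m, n, FATF.code g)).1 : ENNReal) / ((F (m, n, FATF.code g)).2 : ENNReal)) := by
  exact ⟨fun m n H _ r s β p v h => β.dc_eq_ratio p v h,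
    fun m n H _ h => FATF.dc_eq_one_of_proj_eq_bot h,
    FATF.RawInput.answer, FATF.RawInput.computable_answer,
    fun m n g => FATF.RawInput.answer_spec g⟩
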